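/- Let $\mu$ be the surface measure of the unit sphere $\mathbb S^2\subset\mathbb R^3$, let $Y_{\ell,k}$ ($\ell\ge 0$, $1\le k\le 2\ell+1$) be the real orthonormal spherical harmonics, and put $\lambda_\ell=\ell(\ell+1)$. For $s\ge 0$ the scalar Sobolev space $H^s(\mathbb S^2)$ has the norm $\|f\|_{H^s}^2=\sum_{\ell\ge 0}\sum_k(1+\lambda_\ell)^s|\langle f,Y_{\ell,k}\rangle|^2$. With the surface gradient $\nabla_*=(I-xx^\top)\nabla$ and the surface curl $\mathbf L_*=x\times\nabla$ let $\mathbf y_{\ell,k}=\mathbf L_*Y_{\ell,k}/\sqrt{\lambda_\ell}$ and $\mathbf z_{\ell,k}=\nabla_*Y_{\ell,k}/\sqrt{\lambda_\ell}$ for $\ell\ge1$; the space $\mathbf H^s(\mathbb S^2)$ of tangential $L_2$ vector fields has the norm $\|\mathbf f\|_{\mathbf H^s}^2=\sum_{\ell\ge1}\sum_k(1+\lambda_\ell)^s\left(|\langle\mathbf f,\mathbf y_{\ell,k}\rangle|^2+|\langle\mathbf f,\mathbf z_{\ell,k}\rangle|^2\right)$. For $s>1$ elements of these spaces are identified with their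 continuous representatives. Let $\sigma>1$ and $0\le\tau\le\sigma$. Let $(X_N)$, $X_N=\{x_1,\dots,x_N\}\subset\mathbb S^2$, be a sequence, with $N\to\infty$, of QMC designs for $H^\sigma(\mathbb S^2)$: there is $c_\sigma>0$, independent of $N$, with $$\left|\int_{\mathbb S^2}f\,d\mu-\frac{4\pi}{N}\sum_{j=1}^N f(x_j)\right|\le c_\sigma N^{-\sigma/2}\|f\|_{H^\sigma}\qquad\text{for all } f\in H^\sigma(\mathbb S^2).$$ Let $\psi_\rho\in C[-1,1]$, $0<\rho<1$, be a family of zonal kernels (for instance scaled ones, $\psi_\rho(x\cdot y)=C_\rho\,\phi(\|x-y\|/\rho)$), normalized by $2\pi\int_{-1}^1\psi_\rho=1$, with Fourier--Legendre coefficients $\widehat\psi_\rho(\ell)=2\pi\int_{-1}^1\psi_\rho(t)P_\ell(t)\,dt$. Suppose that there are $0<\rho_0<1$ and $c_1,c_2>0$ such that for $0<\rho<\rho_0$ $$|1-\widehat\psi_\rho(\ell)|\le c_1(\ell\rho)^\sigma\ \ \text{for }0\le\ell\le\lfloor\rho^{-1}-1\rfloor,\qquad \widehat\psi_\rho(\ell)\le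 c_2\ \ \text{for }\ell>\lfloor\rho^{-1}-1\rfloor,$$ and that there is $c_4>0$ such that $|\widehat\psi_\rho(\ell)|\le c_4(1+\rho\ell)^{-(\tau+\sigma)}$ for all $0<\rho<1$ and $\ell\ge1$. Put $t=x\cdot y$ and $\kappa_\rho(t)=\frac{1}{4\pi(1-t^2)}\int_{-1}^t(1-4\pi\psi_\rho(u))\,du$ (extended continuously to $t=\pm1$), and let $\Psi_\rho(x,y)=\Psi_\rho^{\mathrm{div}}(x,y)+\Psi_\rho^{\mathrm{curl}}(x,y)$ with $$\Psi_\rho^{\mathrm{div}}=-\kappa_\rho'(t)(x\times y)(x\times y)^\top+\kappa_\rho(t)(tI-yx^\top),$$ $$\Psi_\rho^{\mathrm{curl}}=\kappa_\rho'(t)(y-tx)(x-ty)^\top+\kappa_\rho(t)(I-xx^\top)(I-yy^\top)$$ (the terms with $\kappa_\rho'$ being $0$ at $t=\pm1$), and let $$(\mathcal L_{\Psi_\rho}\mathbf f)(x)=\frac{4\pi}{N}\sum_{j=1}^N\Psi_\rho(x,x_j)\,\mathbf f(x_j).$$ Then there is a constant $C>0$, independent of $\rho$, $N$ and $\mathbf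 f$, such that for all $0<\rho<1$, all $N$ of the sequence and all $\mathbf f\in\mathbf H^\sigma(\mathbb S^2)$ one has $\mathbf f-\mathcal L_{\Psi_\rho}\mathbf f\in\mathbf H^\tau(\mathbb S^2)$ and $$\|\mathbf f-\mathcal L_{\Psi_\rho}\mathbf f\|_{\mathbf H^\tau}\le C\left(\rho^{\sigma-\tau}+\rho^{-(\tau+\sigma)}N^{-\sigma/2}\right)\|\mathbf f\|_{\mathbf H^\sigma}.$$ -/

import Mathlib

open MeasureTheory Matrix

namespace VecQI

/-- Euclidean three-space. -/
abbrev E3 : Type := EuclideanSpace ℝ (Fin 3)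

/-- The unit sphere in `E3`. -/
abbrev S2 : Type := Metric.sphere (0 : E3) 1

/-- The surface measure of the unit sphere, of total mass `4π`. -/
noncomputable def surf : Measure S2 := (volume : Measure E3).toSphere

/-- The Legendre polynomial of degree `l`, with value `1` at `1` (Rodrigues' formula). -/
noncomputable def legendre (l : ℕ) : Polynomial ℝ :=
  Polynomial.C ((2 ^ l * (l.factorial : ℝ))⁻¹) *
    Polynomial.derivative^[l] ((Polynomial.X ^ 2 - 1) ^ l)

/-- The real spherical harmonic of degree `l` and order `m`, `|m| ≤ l`, written as a polynomial
function on the whole of `E3`. In spherical coordinates its restriction to the sphere is a constant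
multiple of `P_l^|m|(cos θ) cos (m φ)` for `0 ≤ m` and of `P_l^|m|(cos θ) sin (|m| φ)` for `m < 0`;
the constants make the family orthonormal in `L²` of the sphere. -/
noncomputable def sphHarm (l : ℕ) (m : ℤ) (x : E3) : ℝ :=
  Real.sqrt ((if m = 0 then 1 else 2) * ((2 * l + 1) / (4 * Real.pi)) *
      (((l - m.natAbs).factorial : ℝ) / ((l + m.natAbs).factorial : ℝ))) *
    (Polynomial.derivative^[m.natAbs] (legendre l)).eval (x 2) *
    (if 0 ≤ m then (((x 0 : ℂ) + (x 1 : ℂ) * Complex.I) ^ m.natAbs).re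
      else (((x 0 : ℂ) + (x 1 : ℂ) * Complex.I) ^ m.natAbs).im)

/-- The orders `-l, …, l` of the `2 l + 1` spherical harmonics of degree `l`. -/
noncomputable def orders (l : ℕ) : Finset ℤ := Finset.Icc (-(l : ℤ)) (l : ℤ)

/-- The number `1 + λ_l`, where `λ_l = l (l + 1)` is the eigenvalue of minus the Laplace-Beltrami
operator on harmonics of degree `l`. -/
noncomputable def onePlusEig (l : ℕ) : ℝ := 1 + (l : ℝ) * ((l : ℝ) + 1)

/-! ### Scalar Sobolev spaces -/

/-- The Fourier coefficient of a scalar function. -/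
noncomputable def coeff (f : S2 → ℝ) (l : ℕ) (m : ℤ) : ℝ :=
  ∫ x, f x * sphHarm l m (x : E3) ∂surf

/-- The degree `l` part of the squared `H^s` norm. -/
noncomputable def sobTerm (s : ℝ) (f : S2 → ℝ) (l : ℕ) : ℝ :=
  onePlusEig l ^ s * ∑ m ∈ orders l, coeff f l m ^ 2

/-- Membership in the scalar Sobolev space `H^s` of the sphere. -/
def MemSobolev (s : ℝ) (f : S2 → ℝ) : Prop :=
  MemLp f 2 surf ∧ Summable (sobTerm s f)

/-- The norm of the scalar Sobolev space `H^s` of the sphere. -/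
noncomputable def sobNorm (s : ℝ) (f : S2 → ℝ) : ℝ :=
  Real.sqrt (∑' l, sobTerm s f l)

/-! ### Vector spherical harmonics and vectorial Sobolev spaces -/

/-- The cross product of `E3`. -/
noncomputable def cross (x y : E3) : E3 := WithLp.toLp 2 (crossProduct x.ofLp y.ofLp)

/-- The surface gradient `(I - x xᵀ) ∇F (x)` of (the restriction to the sphere of) `F`. -/
noncomputable def surfGrad (F : E3 → ℝ) (x : E3) : E3 :=
  gradient F x - inner ℝ x (gradient F x) • x

/-- The surface curl `x × ∇F (x)` of (the restriction to the sphere of) `F`. -/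
noncomputable def surfCurl (F : E3 → ℝ) (x : E3) : E3 := cross x (gradient F x)

/-- The divergence-free vector spherical harmonics (for `1 ≤ l`). -/
noncomputable def vecY (l : ℕ) (m : ℤ) (x : S2) : E3 :=
  (Real.sqrt ((l : ℝ) * ((l : ℝ) + 1)))⁻¹ • surfCurl (sphHarm l m) (x : E3)

/-- The curl-free vector spherical harmonics (for `1 ≤ l`). -/
noncomputable def vecZ (l : ℕ) (m : ℤ) (x : S2) : E3 :=
  (Real.sqrt ((l : ℝ) * ((l : ℝ) + 1)))⁻¹ • surfGrad (sphHarm l m) (x : E3)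

/-- The divergence-free Fourier coefficient of a vector field. -/
noncomputable def coeffDiv (f : S2 → E3) (l : ℕ) (m : ℤ) : ℝ :=
  ∫ x, inner ℝ (f x) (vecY l m x) ∂surf

/-- The curl-free Fourier coefficient of a vector field. -/
noncomputable def coeffCurl (f : S2 → E3) (l : ℕ) (m : ℤ) : ℝ :=
  ∫ x, inner ℝ (f x) (vecZ l m x) ∂surf

/-- The degree `l` part of the squared norm of the vectorial Sobolev space of order `s`. -/
noncomputable def vecSobTerm (s : ℝ) (f : S2 → E3) (l : ℕ) : ℝ :=
  onePlusEig l ^ s * ∑ m ∈ orders l, (coeffDiv f l m ^ 2 + coeffCurl f l m ^ 2)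

/-- A vector field on the sphere is tangential. -/
def IsTangential (f : S2 → E3) : Prop := ∀ x : S2, inner ℝ (x : E3) (f x) = 0

/-- Membership in the Sobolev space of order `s` of tangential vector fields; the degrees are
`l + 1` with `l = 0, 1, 2, …`. -/
def MemVecSobolev (s : ℝ) (f : S2 → E3) : Prop :=
  IsTangential f ∧ MemLp f 2 surf ∧ Summable fun l : ℕ => vecSobTerm s f (l + 1)

/-- The norm of the Sobolev space of order `s` of tangential vector fields. -/
noncomputable def vecSobNorm (s : ℝ) (f : S2 → E3) : ℝ :=
  Real.sqrt (∑' l : ℕ, vecSobTerm s f (l + 1))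

/-! ### QMC designs -/

/-- The equal-weight quadrature `(4π / N) ∑ⱼ f (xⱼ)`. -/
noncomputable def quad {N : ℕ} (X : Fin N → S2) (f : S2 → ℝ) : ℝ :=
  4 * Real.pi / N * ∑ j, f (X j)

/-- `X 0, X 1, …`, where `X n` consists of `N n` points, is a sequence of QMC designs for `H^σ`.
For `σ > 1` every element of `H^σ` has a unique continuous representative, to which the point
evaluations in the quadrature refer. -/
structure IsQMCDesign (σ : ℝ) (N : ℕ → ℕ) (X : ∀ n, Fin (N n) → S2) : Prop where
  pos : ∀ n, 0 < N n
  tendsto : Filter.Tendsto N Filter.atTop Filter.atTop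
  bound : ∃ c > 0, ∀ n, ∀ f : S2 → ℝ, Continuous f → MemSobolev σ f →
    |(∫ x, f x ∂surf) - quad (X n) f| ≤ c * (N n : ℝ) ^ (-(σ / 2)) * sobNorm σ f

/-! ### Zonal kernels -/

/-- The Fourier-Legendre coefficient of `ψ`, so that `ψ` has the expansion
`ψ = ∑ (2 l + 1) / (4π) * zonalCoeff ψ l * P_l`. -/
noncomputable def zonalCoeff (ψ : ℝ → ℝ) (l : ℕ) : ℝ :=
  2 * Real.pi * ∫ t in (-1 : ℝ)..1, ψ t * (legendre l).eval t

/-- A family of zonal kernels `ψ ρ (x ⬝ y)` with parameter `0 < ρ < 1`: each is continuous, and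
normalised to have integral `1` over the sphere (in `x`, for each fixed `y`). -/
structure IsZonalFamily (ψ : ℝ → ℝ → ℝ) : Prop where
  cont : ∀ ρ, 0 < ρ → ρ < 1 → ContinuousOn (ψ ρ) (Set.Icc (-1) 1)
  normalized : ∀ ρ, 0 < ρ → ρ < 1 → 2 * Real.pi * ∫ t in (-1 : ℝ)..1, ψ ρ t = 1

/-- The family has approximation order `m`. -/
def HasOrder (ψ : ℝ → ℝ → ℝ) (m : ℝ) : Prop :=
  ∃ ρ₀ > 0, ρ₀ < 1 ∧ ∃ c₁ > 0, ∃ c₂ > 0, ∀ ρ, 0 < ρ → ρ < ρ₀ →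
    (∀ l : ℕ, l ≤ ⌊ρ⁻¹ - 1⌋₊ → |1 - zonalCoeff (ψ ρ) l| ≤ c₁ * ((l : ℝ) * ρ) ^ m) ∧
    (∀ l : ℕ, ⌊ρ⁻¹ - 1⌋₊ < l → zonalCoeff (ψ ρ) l ≤ c₂)

/-- The Fourier-Legendre coefficients decay at the rate `(1 + ρ l)^(-s)`, uniformly in `ρ`. -/
def HasDecay (ψ : ℝ → ℝ → ℝ) (s : ℝ) : Prop :=
  ∃ c > 0, ∀ ρ, 0 < ρ → ρ < 1 → ∀ l : ℕ, 0 < l →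
    |zonalCoeff (ψ ρ) l| ≤ c * (1 + ρ * (l : ℝ)) ^ (-s)

/-! ### The matrix-valued kernels and the quasi-interpolant -/

/-- The auxiliary function `κ`, extended by continuity to the end points `1` and `-1`. -/
noncomputable def kappa (ψ : ℝ → ℝ) (t : ℝ) : ℝ :=
  if t = 1 then (4 * Real.pi * ψ 1 - 1) / (8 * Real.pi)
  else if t = -1 then (1 - 4 * Real.pi * ψ (-1)) / (8 * Real.pi)
  else 1 / (4 * Real.pi * (1 - t ^ 2)) * ∫ s in (-1 : ℝ)..t, (1 - 4 * Real.pi * ψ s)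

/-- `Q (x, y) = -(x × y)(x × y)ᵀ`. -/
def matQ (x y : Fin 3 → ℝ) : Matrix (Fin 3) (Fin 3) ℝ :=
  -vecMulVec (crossProduct x y) (crossProduct x y)

/-- `R (x, y) = t I - y xᵀ` with `t = x ⬝ y`. -/
def matR (x y : Fin 3 → ℝ) : Matrix (Fin 3) (Fin 3) ℝ :=
  (x ⬝ᵥ y) • (1 : Matrix (Fin 3) (Fin 3) ℝ) - vecMulVec y x

/-- `V (x, y) = (y - t x)(x - t y)ᵀ` with `t = x ⬝ y`. -/
def matV (x y : Fin 3 → ℝ) : Matrix (Fin 3) (Fin 3) ℝ :=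
  vecMulVec (y - (x ⬝ᵥ y) • x) (x - (x ⬝ᵥ y) • y)

/-- `W (x, y) = (I - x xᵀ)(I - y yᵀ)`. -/
def matW (x y : Fin 3 → ℝ) : Matrix (Fin 3) (Fin 3) ℝ :=
  (1 - vecMulVec x x) * (1 - vecMulVec y y)

/-- The divergence-free kernel `κ'(t) Q + κ(t) R`. For `y = ±x` the matrix `Q` vanishes, so that the
first term is zero there, its limit value. -/
noncomputable def kernelDiv (ψ : ℝ → ℝ) (x y : Fin 3 → ℝ) : Matrix (Fin 3) (Fin 3) ℝ :=
  deriv (kappa ψ) (x ⬝ᵥ y) • matQ x y + kappa ψ (x ⬝ᵥ y) • matR x y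

/-- The curl-free kernel `κ'(t) V + κ(t) W`. For `y = ±x` the matrix `V` vanishes, so that the
first term is zero there, its limit value. -/
noncomputable def kernelCurl (ψ : ℝ → ℝ) (x y : Fin 3 → ℝ) : Matrix (Fin 3) (Fin 3) ℝ :=
  deriv (kappa ψ) (x ⬝ᵥ y) • matV x y + kappa ψ (x ⬝ᵥ y) • matW x y

/-- The matrix-valued kernel `Ψ`, the sum of the divergence-free and the curl-free kernel. -/
noncomputable def kernel (ψ : ℝ → ℝ) (x y : Fin 3 → ℝ) : Matrix (Fin 3) (Fin 3) ℝ :=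
  kernelDiv ψ x y + kernelCurl ψ x y

/-- The quasi-interpolant `(4π / N) ∑ⱼ Ψ(x, xⱼ) f(xⱼ)`. -/
noncomputable def quasiInterp (ψ : ℝ → ℝ) {N : ℕ} (X : Fin N → S2) (f : S2 → E3) (x : S2) : E3 :=
  (4 * Real.pi / N) • ∑ j, WithLp.toLp 2
    (kernel ψ (x : E3).ofLp (X j : E3).ofLp *ᵥ (f (X j)).ofLp)

end VecQI

/-! Let z_l be the Fourier–Legendre coefficients of ψ_ρ, Q the quadrature and E = ∫ - Q its error.
For tangential v at y, the field x ↦ Ψ_ρ(x,y)v has coefficient z_l ⟨v, Y(y)⟩ against every vector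
harmonic Y of degree l ≥ 1 (`exists_kerField`). So the quasi-interpolant of f has coefficients z_l
Q(f·Y), and the error f - L f has coefficients (1 - z_l)⟨f,Y⟩ + z_l E(f·Y). The two summands give
the two terms of the estimate (`sobSq_sub_quasiInterp_le`).

The first is a multiplier bound: |1 - z_l| ≤ C (ρ √(1+λ_l))^(σ-τ) in all degrees l ≥ 1
(`exists_abs_one_sub_zonalCoeff_le`).

The second is handled by duality (`sum_errPow_le`). Let S be a partial sum of (1+λ_l)^τ z_l²
|E(f·Y)|². Linearity gives S = E(f·g) with g = ∑ (1+λ_l)^τ z_l² E(f·Y) Y. The design property bounds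
S by c N^(-σ/2) times the H^σ norm of f·g, the product estimate `sobolev_dotF` bounds that by a
multiple of ‖f‖‖g‖, and the decay of z_l gives ‖g‖² ≤ A S with A of size ρ^(-2(τ+σ)). Dividing by S
bounds S itself.

The product estimate compares f·g with the product of the truncations of f and g at degree n. That
product is a polynomial of degree at most 2n+4, hence orthogonal to all higher harmonics. The
sup-norm embedding of H^σ (σ > 1) then controls tails of the coefficients of f·g by tails of those
of f and g, and summation by parts turns tails into weighted sums.

For the multiplier property, the kernel on tangential vectors is rewritten so that only ψ and its
primitive occur, not κ'. It then depends continuously on ψ in the sup norm, and Weierstrass reduces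
to polynomial ψ. For these, Ψ(·,y)v is a surface gradient plus a surface curl of explicit
polynomials, whose coefficients follow from integration by parts and the Funk–Hecke formula.

All the harmonic analysis is done on polynomials in three variables modulo |x|² - 1. Its only
analytic inputs are rotation invariance of the measure, which makes the infinitesimal rotations
skew-adjoint, and concentration of powers of (1 + x·y)/2 at y. -/

namespace VecQI

/-! ### Polynomial functions on the sphere, and rotation invariance of the surface measure -/

/-- Polynomials in the three coordinates of `E3`. -/
abbrev Poly3 : Type := MvPolynomial (Fin 3) ℝ

/-- Evaluation of a polynomial at a point of `E3`. -/
noncomputable def ev (x : E3) : Poly3 →ₐ[ℝ] ℝ := MvPolynomial.aeval (fun i => x i)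

@[simp] lemma ev_X (x : E3) (i : Fin 3) : ev x (MvPolynomial.X i) = x i := by simp [ev]

lemma hasFDerivAt_ev (p : Poly3) (x : E3) :
    HasFDerivAt (fun y : E3 => ev y p)
      (∑ i, ev x (MvPolynomial.pderiv i p) • (EuclideanSpace.proj i : E3 →L[ℝ] ℝ)) x := by
  induction p using MvPolynomial.induction_on with
  | C a => simpa using hasFDerivAt_const a x
  | add p q hp hq =>
    simp only [map_add, add_smul, Finset.sum_add_distrib]
    exact hp.add hq
  | mul_X p j hp =>
    have h := hp.mul (EuclideanSpace.proj j : E3 →L[ℝ] ℝ).hasFDerivAt (x := x)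
    have e : (fun y : E3 => ev y (p * MvPolynomial.X j)) =
        (fun y => ev y p) * fun y => (EuclideanSpace.proj j : E3 →L[ℝ] ℝ) y := by
      ext y; simp
    rw [e]
    refine h.congr_fderiv ?_
    ext v
    simp [Pi.single_apply, add_mul, Finset.sum_add_distrib, Finset.mul_sum, apply_ite, ite_mul,
      mul_assoc]

lemma continuous_ev (p : Poly3) : Continuous fun x : E3 => ev x p :=
  continuous_iff_continuousAt.2 fun x => (hasFDerivAt_ev p x).continuousAt

lemma continuous_ev_sphere (p : Poly3) : Continuous fun x : S2 => ev (x : E3) p :=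
  (continuous_ev p).comp continuous_subtype_val

/-- The gradient of a polynomial. -/
noncomputable def grad (p : Poly3) (x : E3) : E3 :=
  WithLp.toLp 2 fun i => ev x (MvPolynomial.pderiv i p)

lemma gradient_ev (p : Poly3) (x : E3) : gradient (fun y : E3 => ev y p) x = grad p x := by
  refine HasGradientAt.gradient ?_
  rw [hasGradientAt_iff_hasFDerivAt]
  refine (hasFDerivAt_ev p x).congr_fderiv ?_
  ext v
  simp [grad, PiLp.inner_apply, mul_comm]

instance : IsFiniteMeasure surf := by unfold surf; infer_instance

instance : surf.IsOpenPosMeasure := by unfold surf; infer_instance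

lemma integrable_of_continuous {E : Type*} [NormedAddCommGroup E] {f : S2 → E} (hf : Continuous f) :
    Integrable f surf :=
  hf.integrable_of_hasCompactSupport (HasCompactSupport.of_compactSpace f)

lemma norm_sphere (x : S2) : ‖(x : E3)‖ = 1 := norm_eq_of_mem_sphere x

/-- The action of a linear isometry on the sphere. -/
noncomputable def sphereMap (R : E3 ≃ₗᵢ[ℝ] E3) (x : S2) : S2 := ⟨R x, by simp⟩

lemma continuous_sphereMap (R : E3 ≃ₗᵢ[ℝ] E3) : Continuous (sphereMap R) :=
  (R.continuous.comp continuous_subtype_val).subtype_mk _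

-- `Measure.toSphere` measures a set through the volume of the cone over it, and a linear isometry
-- carries cones to cones and preserves volume.
open scoped Pointwise in
lemma measurePreserving_sphereMap (R : E3 ≃ₗᵢ[ℝ] E3) :
    MeasurePreserving (sphereMap R) surf surf := by
  refine ⟨(continuous_sphereMap R).measurable, ?_⟩
  ext s hs
  rw [Measure.map_apply (continuous_sphereMap R).measurable hs]
  unfold surf
  rw [Measure.toSphere_apply' _ ((continuous_sphereMap R).measurable hs),
    Measure.toSphere_apply' _ hs]
  congr 1
  have : Set.Ioo (0 : ℝ) 1 • ((↑) '' (sphereMap R ⁻¹' s) : Set E3) =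
      R ⁻¹' (Set.Ioo (0 : ℝ) 1 • ((↑) '' s : Set E3)) := by
    ext x
    simp only [Set.mem_smul, Set.mem_image, Set.mem_preimage]
    constructor
    · rintro ⟨r, hr, _, ⟨y, hy, rfl⟩, rfl⟩
      exact ⟨r, hr, _, ⟨_, hy, rfl⟩, by simp [sphereMap]⟩
    · rintro ⟨r, hr, _, ⟨y, hy, rfl⟩, h⟩
      refine ⟨r, hr, R.symm y, ⟨⟨R.symm y, by simp⟩, ?_, rfl⟩, ?_⟩
      · simpa [sphereMap] using hy
      · apply R.injective
        simp [h]
  rw [this]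
  exact R.measurePreserving.measure_preimage_emb R.toHomeomorph.measurableEmbedding _

lemma integral_sphereMap (R : E3 ≃ₗᵢ[ℝ] E3) {E : Type*} [NormedAddCommGroup E] [NormedSpace ℝ E]
    {f : S2 → E} (hf : Continuous f) :
    ∫ x, f (sphereMap R x) ∂surf = ∫ x, f x ∂surf := by
  have := measurePreserving_sphereMap R
  conv_rhs => rw [← this.map_eq]
  rw [integral_map this.measurable.aemeasurable hf.aestronglyMeasurable]

/-- The integral over the sphere, as a linear functional on polynomials. -/
noncomputable def intS : Poly3 →ₗ[ℝ] ℝ where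
  toFun p := ∫ x : S2, ev (x : E3) p ∂surf
  map_add' p q := by
    simp only [map_add]
    exact integral_add (integrable_of_continuous (continuous_ev_sphere p))
      (integrable_of_continuous (continuous_ev_sphere q))
  map_smul' c p := by
    simp only [map_smul, RingHom.id_apply]
    exact integral_smul c _

lemma intS_apply (p : Poly3) : intS p = ∫ x : S2, ev (x : E3) p ∂surf := rfl

/-- The rotation of the plane of the coordinates `j` and `k` by an angle `θ`, on coordinates. -/
noncomputable def rotFun (j k : Fin 3) (θ : ℝ) (x : Fin 3 → ℝ) (i : Fin 3) : ℝ :=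
  if i = j then Real.cos θ * x j - Real.sin θ * x k
  else if i = k then Real.sin θ * x j + Real.cos θ * x k else x i

lemma sum_sq_rotFun {j k : Fin 3} (h : j ≠ k) (θ : ℝ) (x : Fin 3 → ℝ) :
    ∑ i, rotFun j k θ x i ^ 2 = ∑ i, x i ^ 2 := by
  have := Real.sin_sq_add_cos_sq θ
  fin_cases j <;> fin_cases k <;> first | exact absurd rfl h | skip
  all_goals
    simp [rotFun, Fin.sum_univ_three]
    grind

/-- The rotation of the plane of the coordinates `j` and `k` by an angle `θ`. -/
noncomputable def rotLin (j k : Fin 3) (θ : ℝ) : E3 →ₗ[ℝ] E3 where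
  toFun x := WithLp.toLp 2 (rotFun j k θ x)
  map_add' x y := by
    ext i
    simp only [rotFun, PiLp.add_apply]
    split_ifs <;> ring
  map_smul' c x := by
    ext i
    simp only [rotFun, PiLp.smul_apply, RingHom.id_apply, smul_eq_mul]
    split_ifs <;> ring

/-- The rotation of the plane of the coordinates `j` and `k`, as an isometry. -/
noncomputable def rotIso {j k : Fin 3} (h : j ≠ k) (θ : ℝ) : E3 ≃ₗᵢ[ℝ] E3 :=
  LinearIsometry.toLinearIsometryEquiv
    (⟨rotLin j k θ, fun x => by
      rw [EuclideanSpace.norm_eq, EuclideanSpace.norm_eq]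
      congr 1
      simpa [rotLin] using sum_sq_rotFun h θ x⟩ : E3 →ₗᵢ[ℝ] E3) rfl

lemma rotIso_apply {j k : Fin 3} (h : j ≠ k) (θ : ℝ) (x : E3) (i : Fin 3) :
    rotIso h θ x i = rotFun j k θ x i := rfl

-- The generator of the rotation is a derivation, so it suffices to check the coordinate functions
-- and to propagate by the product rule.
open MvPolynomial in
lemma hasDerivAt_ev_rotIso {j k : Fin 3} (h : j ≠ k) (p : Poly3) (x : E3) (θ : ℝ) :
    HasDerivAt (fun t => ev (rotIso h t x) p)
      (ev (rotIso h θ x) (X j * pderiv k p - X k * pderiv j p)) θ := by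
  induction p using MvPolynomial.induction_on with
  | C a => simpa using hasDerivAt_const θ a
  | add p q hp hq =>
    have e : (fun t => ev (rotIso h t x) (p + q)) =
        (fun t => ev (rotIso h t x) p) + fun t => ev (rotIso h t x) q := by
      ext t; simp
    rw [e]
    refine (hp.add hq).congr_deriv ?_
    simp only [map_sub, map_add, map_mul]; ring
  | mul_X p i hp =>
    have hX : HasDerivAt (fun t => ev (rotIso h t x) (X i))
        (ev (rotIso h θ x) (X j * pderiv k (X i) - X k * pderiv j (X i))) θ := by
      simp only [ev_X, rotIso_apply, rotFun, map_sub, map_mul]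
      by_cases h1 : i = j
      · subst h1
        simp only [if_true, pderiv_X_self, pderiv_X_of_ne h, map_zero, map_one, h.symm, if_false]
        have := ((Real.hasDerivAt_cos θ).mul_const (x i)).sub
          ((Real.hasDerivAt_sin θ).mul_const (x k))
        refine this.congr_deriv ?_
        ring
      · by_cases h2 : i = k
        · subst h2
          simp only [if_true, pderiv_X_self, pderiv_X_of_ne h.symm, map_zero, map_one, h1, if_false]
          have := ((Real.hasDerivAt_sin θ).mul_const (x j)).add
            ((Real.hasDerivAt_cos θ).mul_const (x i))
          refine this.congr_deriv ?_
          ring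
        · simp only [h1, h2, if_false, pderiv_X_of_ne h1, pderiv_X_of_ne h2, map_zero, mul_zero,
            sub_zero]
          exact hasDerivAt_const _ _
    have := hp.mul hX
    have e : (fun t => ev (rotIso h t x) (p * X i)) =
        (fun t => ev (rotIso h t x) p) * fun t => ev (rotIso h t x) (X i) := by
      ext t; simp
    rw [e]
    refine this.congr_deriv ?_
    simp only [map_sub, map_mul, pderiv_mul, map_add]
    ring

-- The integral of p over the rotated point does not depend on the angle; differentiate under the
-- integral sign at angle 0.
open MvPolynomial in
lemma intS_rotation {j k : Fin 3} (h : j ≠ k) (p : Poly3) :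
    intS (X j * pderiv k p - X k * pderiv j p) = 0 := by
  set q := X j * pderiv k p - X k * pderiv j p with hq
  obtain ⟨M, hM⟩ := (isCompact_range (continuous_ev_sphere q).norm).bddAbove
  have hM' : ∀ x : S2, ‖ev (x : E3) q‖ ≤ M := fun x => hM ⟨x, rfl⟩
  have key := hasDerivAt_integral_of_dominated_loc_of_deriv_le (μ := surf) (x₀ := (0 : ℝ))
    (s := Set.univ) (F := fun θ x => ev (rotIso h θ (x : E3)) p)
    (F' := fun θ x => ev (rotIso h θ (x : E3)) q) (bound := fun _ => M) Filter.univ_mem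
    (Filter.Eventually.of_forall fun θ => ((continuous_ev p).comp
      ((rotIso h θ).continuous.comp continuous_subtype_val)).aestronglyMeasurable)
    (integrable_of_continuous ((continuous_ev p).comp
      ((rotIso h 0).continuous.comp continuous_subtype_val)))
    ((continuous_ev q).comp
      ((rotIso h 0).continuous.comp continuous_subtype_val)).aestronglyMeasurable
    (Filter.Eventually.of_forall fun x θ _ => hM' (sphereMap (rotIso h θ) x))
    (integrable_const M)
    (Filter.Eventually.of_forall fun x θ _ => hasDerivAt_ev_rotIso h p x θ)
  have e1 : ∀ (r : Poly3) (θ : ℝ), ∫ x : S2, ev (rotIso h θ (x : E3)) r ∂surf = intS r :=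
    fun r θ => integral_sphereMap (rotIso h θ) (continuous_ev_sphere r)
  simp only [e1] at key
  exact key.2.unique (hasDerivAt_const _ _)

/-- The derivation `w ⬝ (x × ∇)`, the infinitesimal rotation about `w`. -/
noncomputable def rot (w : Fin 3 → ℝ) : Derivation ℝ Poly3 Poly3 :=
  MvPolynomial.mkDerivation ℝ
    (crossProduct (fun i => MvPolynomial.C (w i)) (MvPolynomial.X : Fin 3 → Poly3))

open MvPolynomial in
lemma rot_apply (w : Fin 3 → ℝ) (p : Poly3) :
    rot w p = C (w 0) * (X 1 * pderiv 2 p - X 2 * pderiv 1 p) +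
      C (w 1) * (X 2 * pderiv 0 p - X 0 * pderiv 2 p) +
      C (w 2) * (X 0 * pderiv 1 p - X 1 * pderiv 0 p) := by
  have : rot w = (C (w 0) : Poly3) • ((X 1 : Poly3) • pderiv 2 - (X 2 : Poly3) • pderiv 1) +
      (C (w 1) : Poly3) • ((X 2 : Poly3) • pderiv 0 - (X 0 : Poly3) • pderiv 2) +
      (C (w 2) : Poly3) • ((X 0 : Poly3) • pderiv 1 - (X 1 : Poly3) • pderiv 0) := by
    apply MvPolynomial.derivation_ext
    intro i
    fin_cases i <;> simp [rot, cross_apply] <;> ring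
  rw [this]
  rfl

lemma intS_rot (w : Fin 3 → ℝ) (p : Poly3) : intS (rot w p) = 0 := by
  rw [rot_apply]
  simp only [map_add, MvPolynomial.C_mul', map_smul]
  rw [intS_rotation (by decide), intS_rotation (by decide), intS_rotation (by decide)]
  simp

/-- Integration by parts: the integral of the derivation applied to the product p q vanishes. -/
lemma intS_rot_mul (w : Fin 3 → ℝ) (p q : Poly3) : intS (rot w p * q) = -intS (p * rot w q) := by
  have := intS_rot w (p * q)
  rw [Derivation.leibniz, map_add, smul_eq_mul, smul_eq_mul, mul_comm q] at this
  linarith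

/-- The polynomial `|x|² - 1`, which vanishes on the sphere. -/
noncomputable def sph : Poly3 :=
  MvPolynomial.X 0 ^ 2 + MvPolynomial.X 1 ^ 2 + MvPolynomial.X 2 ^ 2 - 1

lemma sum_sq_sphere (x : S2) : (x : E3) 0 ^ 2 + (x : E3) 1 ^ 2 + (x : E3) 2 ^ 2 = 1 := by
  have h := norm_sphere x
  rw [EuclideanSpace.norm_eq, Real.sqrt_eq_one] at h
  simpa [Fin.sum_univ_three] using h

@[simp] lemma ev_sph (x : S2) : ev (x : E3) sph = 0 := by
  have := sum_sq_sphere x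
  simp [sph]; linarith

@[simp] lemma intS_sph_mul (p : Poly3) : intS (sph * p) = 0 := by
  simp [intS_apply]

@[simp] lemma rot_sph (w : Fin 3 → ℝ) : rot w sph = 0 := by
  rw [rot_apply]
  simp [sph]
  ring

/-! ### Legendre polynomials -/

section Legendre

open Polynomial

/-- The integral over `[-1, 1]`, as a linear functional on polynomials. -/
noncomputable def int1 : ℝ[X] →ₗ[ℝ] ℝ where
  toFun G := ∫ t in (-1 : ℝ)..1, G.eval t
  map_add' G H := by
    simp only [eval_add]
    exact intervalIntegral.integral_add (G.continuous.intervalIntegrable _ _)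
      (H.continuous.intervalIntegrable _ _)
  map_smul' c G := by
    simp only [eval_smul, RingHom.id_apply]
    exact intervalIntegral.integral_smul c _

lemma int1_derivative (G : ℝ[X]) : int1 (derivative G) = G.eval 1 - G.eval (-1) :=
  intervalIntegral.integral_eq_sub_of_hasDerivAt (fun t _ => G.hasDerivAt t)
    ((derivative G).continuous.intervalIntegrable _ _)

/-- The Legendre operator `((1 - t²) G')'`. -/
noncomputable def legOp : ℝ[X] →ₗ[ℝ] ℝ[X] :=
  derivative ∘ₗ LinearMap.mulLeft ℝ (1 - X ^ 2) ∘ₗ derivative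

lemma legOp_eq (G : ℝ[X]) : legOp G = derivative ((1 - X ^ 2) * derivative G) := rfl

lemma legOp_apply (G : ℝ[X]) :
    legOp G = (1 - X ^ 2) * derivative (derivative G) - 2 * X * derivative G := by
  simp [legOp_eq]
  ring

lemma int1_legOp_mul (G H : ℝ[X]) : int1 (legOp G * H) = int1 (G * legOp H) := by
  have h := int1_derivative ((1 - X ^ 2) * (derivative G * H - G * derivative H))
  have e : derivative ((1 - X ^ 2) * (derivative G * H - G * derivative H)) =
      legOp G * H - G * legOp H := by
    simp [legOp_apply]
    ring
  rw [e, map_sub] at h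
  simp only [eval_mul, eval_sub, eval_one, eval_pow, eval_X] at h
  norm_num at h
  linarith

/-- The operator is triangular on monomials with diagonal entries -n(n+1). The truncated exponent n
- 2 is harmless, since its coefficient vanishes for n = 0, 1. -/
lemma legOp_X_pow (n : ℕ) : legOp (X ^ n) =
    ((n : ℝ) * (n - 1)) • (X : ℝ[X]) ^ (n - 2) - ((n : ℝ) * (n + 1)) • X ^ n := by
  rw [legOp_apply]
  rcases n with _ | _ | n
  · simp
  · simp [smul_eq_C_mul]
    norm_num
  · simp [smul_eq_C_mul]
    ring

/-- A functional with eigenvalue `l (l + 1)` for the Legendre operator vanishes on lower powers. -/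
lemma eigenfunctional_lower {l : ℕ} {a : ℝ[X] →ₗ[ℝ] ℝ}
    (ha : ∀ G, a (legOp G) = -((l : ℝ) * (l + 1)) * a G) (n : ℕ) (hn : n < l) :
    a (X ^ n) = 0 := by
  induction n using Nat.strong_induction_on with
  | _ n ih =>
    have h := ha (X ^ n)
    rw [legOp_X_pow, map_sub, map_smul, map_smul, smul_eq_mul, smul_eq_mul] at h
    have h2 : (n : ℝ) * (n - 1) * a (X ^ (n - 2)) = 0 := by
      rcases n with _ | _ | n
      · simp
      · simp
      · rw [ih (n + 2 - 2) (by omega) (by omega), mul_zero]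
    rw [h2] at h
    have h3 : ((l : ℝ) * (l + 1) - n * (n + 1)) * a (X ^ n) = 0 := by linarith
    refine (mul_eq_zero.1 h3).resolve_left ?_
    have : (n : ℝ) < l := by exact_mod_cast hn
    nlinarith [Nat.cast_nonneg (α := ℝ) n]

lemma eigenfunctional_lower' {l : ℕ} {a : ℝ[X] →ₗ[ℝ] ℝ}
    (ha : ∀ G, a (legOp G) = -((l : ℝ) * (l + 1)) * a G) (G : ℝ[X]) (hG : G.degree < l) :
    a G = 0 := by
  have : G ∈ degreeLT ℝ l := mem_degreeLT.2 hG
  rw [degreeLT_eq_span_X_pow] at this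
  induction this using Submodule.span_induction with
  | mem x hx =>
    simp only [Finset.coe_image, Finset.coe_range, Set.mem_image, Set.mem_Iio] at hx
    obtain ⟨n, hn, rfl⟩ := hx
    exact eigenfunctional_lower ha n hn
  | zero => simp
  | add x y hx hy h1 h2 =>
    rw [map_add, h1 (mem_degreeLT.1 (by rwa [degreeLT_eq_span_X_pow])),
      h2 (mem_degreeLT.1 (by rwa [degreeLT_eq_span_X_pow])), add_zero]
  | smul c x hx h1 =>
    rw [map_smul, h1 (mem_degreeLT.1 (by rwa [degreeLT_eq_span_X_pow])), smul_zero]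

/-- On monomials the eigenvalue equation expresses (l(l+1) - n(n+1)) a(X^n) through a(X^(n-2)). The
factor vanishes only at n = l, so an eigenfunctional is determined by its value at X^l. -/
lemma eigenfunctional_eq_zero {l : ℕ} {a : ℝ[X] →ₗ[ℝ] ℝ}
    (ha : ∀ G, a (legOp G) = -((l : ℝ) * (l + 1)) * a G) (h0 : a (X ^ l) = 0) : a = 0 := by
  have key : ∀ n, a (X ^ n) = 0 := by
    intro n
    induction n using Nat.strong_induction_on with
    | _ n ih =>
      rcases eq_or_ne n l with rfl | hnl
      · exact h0
      have h := ha (X ^ n)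
      rw [legOp_X_pow, map_sub, map_smul, map_smul, smul_eq_mul, smul_eq_mul] at h
      have h2 : (n : ℝ) * (n - 1) * a (X ^ (n - 2)) = 0 := by
        rcases n with _ | _ | n
        · simp
        · simp
        · rw [ih (n + 2 - 2) (by omega), mul_zero]
      rw [h2] at h
      have h3 : ((l : ℝ) - n) * ((l + n + 1) * a (X ^ n)) = 0 := by linarith
      have h4 : ((l : ℝ) - n) ≠ 0 := sub_ne_zero.2 (by exact_mod_cast hnl.symm)
      exact (mul_eq_zero.1 ((mul_eq_zero.1 h3).resolve_left h4)).resolve_left (by positivity)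
  ext n
  simp [key, ← X_pow_eq_monomial]

/-- The combination of a and b that vanishes at X^l is again an eigenfunctional, hence zero:
eigenfunctionals form a space of dimension at most one. -/
lemma eigenfunctional_comm {l : ℕ} {a b : ℝ[X] →ₗ[ℝ] ℝ}
    (ha : ∀ G, a (legOp G) = -((l : ℝ) * (l + 1)) * a G)
    (hb : ∀ G, b (legOp G) = -((l : ℝ) * (l + 1)) * b G) (G : ℝ[X]) :
    a G * b (X ^ l) = b G * a (X ^ l) := by
  have h := eigenfunctional_eq_zero (l := l) (a := b (X ^ l) • a - a (X ^ l) • b)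
    (fun G => by simp [ha, hb]; ring) (by simp; ring)
  have := LinearMap.congr_fun h G
  simp at this
  linarith

/-- Obtained by differentiating (X² - 1) u' = 2 l X u, with u = (X² - 1)^l, k + 1 times. -/
lemma derivative_iterate_ode (l k : ℕ) :
    (X ^ 2 - 1) * derivative^[k + 2] ((X ^ 2 - 1) ^ l : ℝ[X]) +
      C (2 * ((k : ℝ) + 1) - 2 * l) * X * derivative^[k + 1] ((X ^ 2 - 1) ^ l) +
      C (((k : ℝ) + 1) * (k - 2 * l)) * derivative^[k] ((X ^ 2 - 1) ^ l) = 0 := by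
  induction k with
  | zero =>
    have h : (X ^ 2 - 1) * derivative ((X ^ 2 - 1) ^ l : ℝ[X]) =
        C (2 * (l : ℝ)) * X * (X ^ 2 - 1) ^ l := by
      rcases l with _ | l
      · simp
      · simp [derivative_pow, C_ofNat]
        ring
    have h' := congrArg derivative h
    simp only [derivative_mul, derivative_sub, derivative_X_pow, derivative_one, derivative_C,
      derivative_X] at h'
    simp only [Function.iterate_succ, Function.iterate_zero, Function.comp, id]
    simp only [map_sub, map_mul, map_add, map_natCast, map_one, C_ofNat] at h' ⊢
    push_cast at h' ⊢
    linear_combination h'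
  | succ k ih =>
    have h' := congrArg derivative ih
    simp only [derivative_mul, derivative_sub, derivative_add, derivative_X_pow, derivative_one,
      derivative_C, derivative_X, ← Function.iterate_succ_apply' derivative, derivative_zero] at h'
    simp only [map_sub, map_mul, map_add, map_natCast, map_one, C_ofNat] at h' ⊢
    push_cast at h' ⊢
    linear_combination h'

/-- The derivative of order `m` of the Legendre polynomial of degree `l`. -/
noncomputable def legD (l m : ℕ) : ℝ[X] := derivative^[m] (legendre l)

lemma legD_zero (l : ℕ) : legD l 0 = legendre l := rfl

lemma derivative_legD (l m : ℕ) : derivative (legD l m) = legD l (m + 1) :=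
  (Function.iterate_succ_apply' derivative m _).symm

lemma legD_eq (l m : ℕ) : legD l m =
    C ((2 ^ l * (l.factorial : ℝ))⁻¹) * derivative^[l + m] ((X ^ 2 - 1) ^ l) := by
  rw [legD, legendre, iterate_derivative_C_mul, ← Function.iterate_add_apply, add_comm]

lemma legD_ode (l m : ℕ) :
    (1 - X ^ 2) * legD l (m + 2) - C (2 * ((m : ℝ) + 1)) * X * legD l (m + 1) +
      C (((l : ℝ) - m) * (l + m + 1)) * legD l m = 0 := by
  have h := derivative_iterate_ode l (l + m)
  rw [legD_eq, legD_eq, legD_eq, ← add_assoc, ← add_assoc]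
  simp only [map_sub, map_mul, map_add, map_natCast, map_one, C_ofNat] at h ⊢
  push_cast at h
  linear_combination (-C ((2 ^ l * (l.factorial : ℝ))⁻¹)) * h

lemma legOp_legendre (l : ℕ) : legOp (legendre l) = -((l : ℝ) * (l + 1)) • legendre l := by
  have h := legD_ode l 0
  have e1 : legD l (0 + 1) = derivative (legendre l) := (derivative_legD l 0).symm
  have e2 : legD l (0 + 2) = derivative (derivative (legendre l)) := by
    rw [← e1, derivative_legD]
  rw [e1, e2, legD_zero] at h
  rw [legOp_apply, smul_eq_C_mul]
  simp only [map_sub, map_mul, map_add, map_natCast, map_one, C_ofNat, map_neg] at h ⊢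
  push_cast at h
  linear_combination h

/-- At a = ±1 the Taylor shift of (X² - 1)^l is X^l (X + 2a)^l, so its l-th Taylor coefficient is
(2a)^l. -/
lemma legendre_eval_of_sq {a : ℝ} (ha : a ^ 2 = 1) (l : ℕ) : (legendre l).eval a = a ^ l := by
  rw [legendre, eval_mul, eval_C, ← factorial_smul_hasseDeriv]
  simp only [LinearMap.smul_apply, eval_smul]
  rw [← taylor_coeff]
  have : taylor a ((X ^ 2 - 1 : ℝ[X]) ^ l) = (X + C (2 * a)) ^ l * X ^ l := by
    rw [← mul_pow, ← taylorAlgHom_apply, map_pow]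
    congr 1
    have : (C a : ℝ[X]) ^ 2 = 1 := by rw [← map_pow, ha, map_one]
    simp only [map_sub, map_pow, map_one, taylorAlgHom_apply, taylor_X, map_mul, C_ofNat]
    linear_combination this
  have h0 := coeff_mul_X_pow ((X + C (2 * a)) ^ l) l 0
  rw [zero_add] at h0
  rw [this, h0, coeff_zero_eq_eval_zero]
  simp [mul_pow]
  have := l.factorial_ne_zero
  field_simp

lemma legendre_eval_one (l : ℕ) : (legendre l).eval 1 = 1 := by
  simp [legendre_eval_of_sq (a := 1) (by norm_num) l]

lemma natDegree_legD_le (l m : ℕ) : (legD l m).natDegree ≤ l - m := by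
  rw [legD_eq]
  refine (natDegree_C_mul_le _ _).trans ((natDegree_iterate_derivative _ _).trans ?_)
  have : ((X ^ 2 - 1 : ℝ[X]) ^ l).natDegree ≤ 2 * l := by
    refine natDegree_pow_le.trans ?_
    rw [mul_comm]
    exact Nat.mul_le_mul_right l (by compute_degree)
  omega

lemma coeff_legD_ne_zero {l m : ℕ} (h : m ≤ l) : (legD l m).coeff (l - m) ≠ 0 := by
  rw [legD_eq, coeff_C_mul, coeff_iterate_derivative]
  have e : l - m + (l + m) = l * 2 := by omega
  have h1 : ((X ^ 2 - 1 : ℝ[X]) ^ l).coeff (l * 2) = 1 := by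
    have h2 : (X ^ 2 - 1 : ℝ[X]).natDegree ≤ 2 := by compute_degree
    rw [coeff_pow_of_natDegree_le h2]
    simp [coeff_one]
  rw [e, h1, nsmul_eq_mul, mul_one]
  refine mul_ne_zero (inv_ne_zero (by positivity)) ?_
  rw [Nat.cast_ne_zero, Ne, Nat.descFactorial_eq_zero_iff_lt]
  omega

lemma int1_legOp_mul_legendre (l : ℕ) (G : ℝ[X]) :
    int1 (legOp G * legendre l) = -((l : ℝ) * (l + 1)) * int1 (G * legendre l) := by
  rw [int1_legOp_mul, legOp_legendre, mul_smul_comm, map_smul, smul_eq_mul]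

lemma int1_mul_legendre_of_degree_lt (l : ℕ) (G : ℝ[X]) (hG : G.degree < l) :
    int1 (G * legendre l) = 0 :=
  eigenfunctional_lower' (l := l) (a := int1 ∘ₗ LinearMap.mulRight ℝ (legendre l))
    (fun G => int1_legOp_mul_legendre l G) G hG

/-- The polynomial X P' - l P loses its leading term, so it is orthogonal to P. Integrating (X P²)'
then leaves (2l+1) ∫ P² = 2. -/
lemma int1_legendre_sq (l : ℕ) : int1 (legendre l ^ 2) = 2 / (2 * l + 1) := by
  have hlow : int1 ((X * derivative (legendre l) - C (l : ℝ) * legendre l) * legendre l) = 0 := by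
    refine int1_mul_legendre_of_degree_lt l _ ?_
    rw [degree_lt_iff_coeff_zero]
    intro n hn
    have hd := natDegree_legD_le l 0
    rw [legD_zero, Nat.sub_zero] at hd
    rw [coeff_sub, coeff_C_mul]
    rcases n with _ | n
    · obtain rfl : l = 0 := by omega
      simp
    · rw [coeff_X_mul, coeff_derivative]
      rcases hn.eq_or_lt with h | h
      · subst h
        push_cast
        ring
      · rw [coeff_eq_zero_of_natDegree_lt (lt_of_le_of_lt hd h)]
        simp
  have hpart := int1_derivative (X * legendre l ^ 2)
  have h1 := legendre_eval_of_sq (a := 1) (by norm_num) l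
  have h2 := legendre_eval_of_sq (a := -1) (by norm_num) l
  simp only [eval_mul, eval_X, eval_pow, h1, h2, ← pow_mul, mul_comm l 2] at hpart
  rw [pow_mul (-1 : ℝ)] at hpart
  norm_num at hpart
  have e : (X * (2 * legendre l * derivative (legendre l))) + legendre l ^ 2 =
      (2 : ℝ) • ((X * derivative (legendre l) - C (l : ℝ) * legendre l) * legendre l) +
        (2 * (l : ℝ) + 1) • legendre l ^ 2 := by
    simp only [smul_eq_C_mul, map_add, map_mul, C_ofNat, map_one, map_natCast]
    ring
  rw [derivative_pow, ← map_add] at hpart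
  rw [show (legendre l ^ 2 + X * (C ((2 : ℕ) : ℝ) * legendre l ^ (2 - 1) * derivative (legendre l)))
    = (X * (2 * legendre l * derivative (legendre l))) + legendre l ^ 2 by
      simp [C_ofNat]; ring] at hpart
  rw [e, map_add, map_smul, map_smul, hlow, smul_zero, zero_add, smul_eq_mul] at hpart
  rw [eq_div_iff (by positivity)]
  linarith

/-- Integrate the derivative of P^(m) (1-X²)^(m+1) P^(m+1): the boundary terms vanish, and the
differential equation removes P^(m+2). -/
lemma int1_legD_succ (l m : ℕ) : int1 (legD l (m + 1) ^ 2 * (1 - X ^ 2) ^ (m + 1)) =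
    ((l : ℝ) - m) * (l + m + 1) * int1 (legD l m ^ 2 * (1 - X ^ 2) ^ m) := by
  have h := int1_derivative (legD l m * ((1 - X ^ 2) ^ (m + 1) * legD l (m + 1)))
  simp only [eval_mul, eval_pow, eval_sub, eval_one, eval_X] at h
  norm_num at h
  have hode := legD_ode l m
  have e : derivative (legD l m) * ((1 - X ^ 2) ^ (m + 1) * legD l (m + 1)) +
      legD l m * (derivative ((1 - X ^ 2) ^ (m + 1)) * legD l (m + 1) +
        (1 - X ^ 2) ^ (m + 1) * derivative (legD l (m + 1))) =
      legD l (m + 1) ^ 2 * (1 - X ^ 2) ^ (m + 1) -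
        (((l : ℝ) - m) * (l + m + 1)) • (legD l m ^ 2 * (1 - X ^ 2) ^ m) := by
    rw [derivative_legD, derivative_legD, derivative_pow, smul_eq_C_mul]
    simp only [map_sub, map_mul, map_add, map_natCast, map_one, C_ofNat,
      derivative_one, derivative_X_pow, Nat.cast_add, Nat.cast_one, Nat.add_sub_cancel] at hode ⊢
    simp only [Nat.cast_ofNat]
    linear_combination (legD l m * (1 - X ^ 2) ^ m) * hode
  rw [← map_add, e, map_sub, map_smul, smul_eq_mul] at h
  linarith

lemma int1_legD_sq {l m : ℕ} (h : m ≤ l) : int1 (legD l m ^ 2 * (1 - X ^ 2) ^ m) =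
    2 / (2 * l + 1) * ((l + m).factorial / (l - m).factorial) := by
  induction m with
  | zero =>
    simp [legD_zero, int1_legendre_sq]
    rw [div_self (by positivity), mul_one]
  | succ m ih =>
    rw [int1_legD_succ, ih (by omega)]
    obtain ⟨k, rfl⟩ : ∃ k, l = m + 1 + k := ⟨l - (m + 1), by omega⟩
    rw [show m + 1 + k - m = k + 1 by omega, show m + 1 + k - (m + 1) = k by omega,
      ← add_assoc, Nat.factorial_succ k, Nat.factorial_succ (m + 1 + k + m)]
    push_cast
    field_simp
    ring

end Legendre

/-! ### The Laplace-Beltrami operator on polynomials -/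

section Laplace

open MvPolynomial

/-- The infinitesimal rotation about the `i`-th coordinate axis. -/
noncomputable def ang (i : Fin 3) : Derivation ℝ Poly3 Poly3 := rot (Pi.single i 1)

lemma ang_zero_apply (p : Poly3) : ang 0 p = X 1 * pderiv 2 p - X 2 * pderiv 1 p := by
  simp [ang, rot_apply]

lemma ang_one_apply (p : Poly3) : ang 1 p = X 2 * pderiv 0 p - X 0 * pderiv 2 p := by
  simp [ang, rot_apply]

lemma ang_two_apply (p : Poly3) : ang 2 p = X 0 * pderiv 1 p - X 1 * pderiv 0 p := by
  simp [ang, rot_apply]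

lemma rot_eq_ang (w : Fin 3 → ℝ) (p : Poly3) :
    rot w p = w 0 • ang 0 p + w 1 • ang 1 p + w 2 • ang 2 p := by
  rw [rot_apply, ang_zero_apply, ang_one_apply, ang_two_apply]
  simp only [C_mul']

lemma ang_comm_zero_one (p : Poly3) : ang 0 (ang 1 p) - ang 1 (ang 0 p) = -ang 2 p := by
  have : ⁅ang 0, ang 1⁆ = -ang 2 := by
    apply derivation_ext
    intro i
    rw [Derivation.commutator_apply]
    fin_cases i <;> simp [ang_zero_apply, ang_one_apply, ang_two_apply]
  exact DFunLike.congr_fun this p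

lemma ang_comm_one_two (p : Poly3) : ang 1 (ang 2 p) - ang 2 (ang 1 p) = -ang 0 p := by
  have : ⁅ang 1, ang 2⁆ = -ang 0 := by
    apply derivation_ext
    intro i
    rw [Derivation.commutator_apply]
    fin_cases i <;> simp [ang_zero_apply, ang_one_apply, ang_two_apply]
  exact DFunLike.congr_fun this p

lemma ang_comm_two_zero (p : Poly3) : ang 2 (ang 0 p) - ang 0 (ang 2 p) = -ang 1 p := by
  have : ⁅ang 2, ang 0⁆ = -ang 1 := by
    apply derivation_ext
    intro i
    rw [Derivation.commutator_apply]
    fin_cases i <;> simp [ang_zero_apply, ang_one_apply, ang_two_apply]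
  exact DFunLike.congr_fun this p

/-- The Laplace-Beltrami operator on polynomials. -/
noncomputable def lap : Poly3 →ₗ[ℝ] Poly3 :=
  ∑ i, (ang i : Poly3 →ₗ[ℝ] Poly3) ∘ₗ (ang i : Poly3 →ₗ[ℝ] Poly3)

lemma lap_apply (p : Poly3) :
    lap p = ang 0 (ang 0 p) + ang 1 (ang 1 p) + ang 2 (ang 2 p) := by
  simp [lap, Fin.sum_univ_three]

/-- The sum of squares of the generators is the Casimir element of the rotation algebra, so it
commutes with each of them. -/
lemma lap_ang (i : Fin 3) (p : Poly3) : lap (ang i p) = ang i (lap p) := by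
  have h01 := ang_comm_zero_one
  have h12 := ang_comm_one_two
  have h20 := ang_comm_two_zero
  have e (j : Fin 3) {a b c : Poly3} (h : a - b = -c) : ang j a - ang j b = -ang j c := by
    rw [← map_sub, h, map_neg]
  fin_cases i
  · simp only [lap_apply, map_add]
    change ang 0 (ang 0 (ang 0 p)) + ang 1 (ang 1 (ang 0 p)) + ang 2 (ang 2 (ang 0 p)) =
      ang 0 (ang 0 (ang 0 p)) + ang 0 (ang 1 (ang 1 p)) + ang 0 (ang 2 (ang 2 p))
    linear_combination -(e 1 (h01 p)) - h01 (ang 1 p) + e 2 (h20 p) + h20 (ang 2 p)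
  · simp only [lap_apply, map_add]
    change ang 0 (ang 0 (ang 1 p)) + ang 1 (ang 1 (ang 1 p)) + ang 2 (ang 2 (ang 1 p)) =
      ang 1 (ang 0 (ang 0 p)) + ang 1 (ang 1 (ang 1 p)) + ang 1 (ang 2 (ang 2 p))
    linear_combination (e 0 (h01 p)) + h01 (ang 0 p) - e 2 (h12 p) - h12 (ang 2 p)
  · simp only [lap_apply, map_add]
    change ang 0 (ang 0 (ang 2 p)) + ang 1 (ang 1 (ang 2 p)) + ang 2 (ang 2 (ang 2 p)) =
      ang 2 (ang 0 (ang 0 p)) + ang 2 (ang 1 (ang 1 p)) + ang 2 (ang 2 (ang 2 p))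
    linear_combination -(e 0 (h20 p)) - h20 (ang 0 p) + e 1 (h12 p) + h12 (ang 1 p)

lemma lap_rot (w : Fin 3 → ℝ) (p : Poly3) : lap (rot w p) = rot w (lap p) := by
  simp only [rot_eq_ang, map_add, map_smul, lap_ang]

lemma intS_ang_mul (i : Fin 3) (p q : Poly3) : intS (ang i p * q) = -intS (p * ang i q) :=
  intS_rot_mul _ p q

lemma intS_lap_mul (p q : Poly3) : intS (lap p * q) = intS (p * lap q) := by
  simp only [lap_apply, add_mul, map_add, intS_ang_mul, mul_comm p, neg_neg]

/-- `p` restricts to an eigenfunction of the Laplace-Beltrami operator with eigenvalue `-μ`. -/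
def IsEig (μ : ℝ) (p : Poly3) : Prop := ∃ q, lap p + μ • p = sph * q

/-- Infinitesimal rotations commute with `lap` and preserve the ideal generated by |x|² - 1. -/
lemma IsEig.rot {μ : ℝ} {p : Poly3} (h : IsEig μ p) (w : Fin 3 → ℝ) : IsEig μ (rot w p) := by
  obtain ⟨q, hq⟩ := h
  refine ⟨VecQI.rot w q, ?_⟩
  rw [lap_rot, ← Derivation.map_smul, ← map_add, hq, Derivation.leibniz, rot_sph]
  simp

lemma IsEig.smul {μ : ℝ} {p : Poly3} (h : IsEig μ p) (c : ℝ) : IsEig μ (c • p) := by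
  obtain ⟨q, hq⟩ := h
  refine ⟨c • q, ?_⟩
  rw [map_smul, smul_comm μ, ← smul_add, hq, mul_smul_comm]

lemma IsEig.intS_mul_lap {μ : ℝ} {p : Poly3} (h : IsEig μ p) (g : Poly3) :
    intS (g * lap p) = -μ * intS (g * p) := by
  obtain ⟨q, hq⟩ := h
  have : lap p = sph * q - μ • p := by rw [← hq]; abel
  rw [this, mul_sub, map_sub, mul_left_comm, intS_sph_mul, mul_smul_comm, map_smul, smul_eq_mul]
  ring

lemma IsEig.intS_mul_eq_zero {μ ν : ℝ} {p q : Poly3} (hp : IsEig μ p) (hq : IsEig ν q)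
    (h : μ ≠ ν) : intS (p * q) = 0 := by
  have h1 := hp.intS_mul_lap q
  have h2 := hq.intS_mul_lap p
  rw [mul_comm, intS_lap_mul, h2, mul_comm q] at h1
  have : (μ - ν) * intS (p * q) = 0 := by linarith
  exact (mul_eq_zero.1 this).resolve_left (sub_ne_zero.2 h)

/-! ### Zonal polynomials and the Funk–Hecke formula -/

/-- The polynomial `x ↦ x ⬝ y`. -/
noncomputable def dotP (y : E3) : Poly3 := C (y 0) * X 0 + C (y 1) * X 1 + C (y 2) * X 2

/-- The zonal polynomial `x ↦ G (x ⬝ y)`. -/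
noncomputable def zon (y : E3) : Polynomial ℝ →ₐ[ℝ] Poly3 := Polynomial.aeval (dotP y)

lemma inner_eq (x y : E3) : inner ℝ x y = x 0 * y 0 + x 1 * y 1 + x 2 * y 2 := by
  simp [PiLp.inner_apply, Fin.sum_univ_three, mul_comm]

@[simp] lemma ev_dotP (x y : E3) : ev x (dotP y) = inner ℝ x y := by
  simp [dotP, inner_eq, mul_comm]

@[simp] lemma ev_zon (x y : E3) (G : Polynomial ℝ) : ev x (zon y G) = G.eval (inner ℝ x y) := by
  rw [zon, ← Polynomial.aeval_algHom_apply, ev_dotP, Polynomial.coe_aeval_eq_eval]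

lemma rot_zon (w : Fin 3 → ℝ) (y : E3) (G : Polynomial ℝ) :
    rot w (zon y G) = zon y (Polynomial.derivative G) * rot w (dotP y) := by
  rw [zon, Derivation.map_aeval, smul_eq_mul]

lemma ang_zon (i : Fin 3) (y : E3) (G : Polynomial ℝ) :
    ang i (zon y G) = zon y (Polynomial.derivative G) * ang i (dotP y) :=
  rot_zon _ y G

lemma zon_X (y : E3) : zon y Polynomial.X = dotP y := Polynomial.aeval_X _

/-- With |y| = 1 the squared angular derivatives of x·y add up to |x|² - (x·y)², which is 1 - t²
modulo |x|² - 1, and `lap` sends x·y to -2 x·y. -/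
lemma lap_zon (y : S2) (G : Polynomial ℝ) : lap (zon y G) =
    zon y (legOp G) + sph * zon y (Polynomial.derivative (Polynomial.derivative G)) := by
  have h1 : (C ((y : E3) 0) ^ 2 + C ((y : E3) 1) ^ 2 + C ((y : E3) 2) ^ 2 : Poly3) = 1 := by
    rw [← map_pow, ← map_pow, ← map_pow, ← map_add, ← map_add, sum_sq_sphere, map_one]
  have hsq : ang 0 (dotP y) ^ 2 + ang 1 (dotP y) ^ 2 + ang 2 (dotP y) ^ 2 =
      sph + 1 - dotP y ^ 2 := by
    simp only [ang_zero_apply, ang_one_apply, ang_two_apply, dotP, sph]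
    simp
    linear_combination (X 0 ^ 2 + X 1 ^ 2 + X 2 ^ 2) * h1
  have hlin : ang 0 (ang 0 (dotP y)) + ang 1 (ang 1 (dotP y)) + ang 2 (ang 2 (dotP y)) =
      -2 * dotP y := by
    simp only [ang_zero_apply, ang_one_apply, ang_two_apply, dotP]
    simp
    ring
  simp only [lap_apply, ang_zon, Derivation.leibniz, smul_eq_mul, legOp_apply, map_sub, map_mul,
    map_pow, map_one, zon_X, map_ofNat]
  linear_combination (zon y (Polynomial.derivative (Polynomial.derivative G))) * hsq +
    (zon y (Polynomial.derivative G)) * hlin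

lemma isEig_zon_legendre (y : S2) (l : ℕ) : IsEig ((l : ℝ) * (l + 1)) (zon y (legendre l)) := by
  refine ⟨zon y (Polynomial.derivative (Polynomial.derivative (legendre l))), ?_⟩
  rw [lap_zon, legOp_legendre, map_smul]
  module

/-- This makes G ↦ ∫ G(x·y) F(x) an eigenfunctional of the Legendre operator, so that
one-dimensionality of the eigenfunctionals yields Funk–Hecke. -/
lemma intS_zon_legOp_mul {μ : ℝ} {F : Poly3} (hF : IsEig μ F) (y : S2) (G : Polynomial ℝ) :
    intS (zon y (legOp G) * F) = -μ * intS (zon y G * F) := by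
  rw [← hF.intS_mul_lap, ← intS_lap_mul, lap_zon, add_mul, mul_assoc sph, map_add, intS_sph_mul,
    add_zero]

lemma inner_sphere_le (x y : S2) : inner ℝ (x : E3) (y : E3) ≤ 1 := by
  have := real_inner_le_norm (x : E3) (y : E3)
  simpa [norm_sphere] using this

lemma neg_one_le_inner_sphere (x y : S2) : -1 ≤ inner ℝ (x : E3) (y : E3) := by
  have := (abs_le.1 (abs_real_inner_le_norm (x : E3) (y : E3))).1
  simpa [norm_sphere] using this

lemma continuous_inner_sphere (y : E3) : Continuous fun x : S2 => inner ℝ (x : E3) y :=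
  continuous_subtype_val.inner continuous_const

/-- The powers of `(1 + x ⬝ y) / 2` concentrate at `y`. -/
lemma tendsto_peak (y : S2) {g : S2 → ℝ} (hg : Continuous g) :
    Filter.Tendsto (fun n : ℕ => (∫ x : S2, ((1 + inner ℝ (x : E3) (y : E3)) / 2) ^ n ∂surf)⁻¹ *
      ∫ x : S2, ((1 + inner ℝ (x : E3) (y : E3)) / 2) ^ n * g x ∂surf)
      Filter.atTop (nhds (g y)) := by
  have hc : Continuous fun x : S2 => (1 + inner ℝ (x : E3) (y : E3)) / 2 :=
    (continuous_const.add (continuous_inner_sphere _)).div_const _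
  have hyy : inner ℝ (y : E3) (y : E3) = 1 := by
    rw [real_inner_self_eq_norm_sq, norm_sphere, one_pow]
  have := tendsto_setIntegral_pow_smul_of_unique_maximum_of_isCompact_of_continuousOn
    (μ := surf) (x₀ := y) (s := Set.univ) isCompact_univ hc.continuousOn ?_ ?_ ?_ (by simp)
    hg.continuousOn
  · simpa using this
  · intro x _ hx
    have h1 := inner_sphere_le x y
    have h2 : inner ℝ (x : E3) (y : E3) ≠ 1 := by
      rw [Ne, inner_eq_one_iff_of_norm_eq_one (norm_sphere x) (norm_sphere y)]
      exact fun h => hx (Subtype.ext h)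
    have := lt_of_le_of_ne h1 h2
    simp only [hyy]
    linarith
  · intro x _
    have := neg_one_le_inner_sphere x y
    linarith
  · simp only [hyy]
    norm_num

/-- The polynomials whose zonal functions concentrate at their pole. -/
noncomputable def peak (n : ℕ) : Polynomial ℝ := (Polynomial.C (1 / 2) * (1 + Polynomial.X)) ^ n

lemma tendsto_intS_peak (y : S2) (F : Poly3) :
    Filter.Tendsto (fun n : ℕ => (intS (zon y (peak n)))⁻¹ * intS (zon y (peak n) * F))
      Filter.atTop (nhds (ev (y : E3) F)) := by
  convert tendsto_peak y (continuous_ev_sphere F) using 2 with n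
  have e : ∀ x : S2, ev (x : E3) (zon y (peak n)) =
      ((1 + inner ℝ (x : E3) (y : E3)) / 2) ^ n := by
    intro x
    rw [ev_zon, peak]
    simp
    rw [mul_comm, div_eq_mul_inv, mul_pow]
  simp only [intS_apply, map_mul, e]

/-- Two eigenfunctionals are proportional, the ratio being determined at the pole. -/
lemma intS_zon_mul_comm {l : ℕ} {F H : Poly3} (hF : IsEig ((l : ℝ) * (l + 1)) F)
    (hH : IsEig ((l : ℝ) * (l + 1)) H) (y : S2) (hHy : ev (y : E3) H = 1) (G : Polynomial ℝ) :
    intS (zon y G * F) = intS (zon y G * H) * ev (y : E3) F := by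
  let a (F : Poly3) : Polynomial ℝ →ₗ[ℝ] ℝ := intS ∘ₗ LinearMap.mulRight ℝ F ∘ₗ (zon y).toLinearMap
  have ha (F : Poly3) (h : IsEig ((l : ℝ) * (l + 1)) F) (G : Polynomial ℝ) :
    a F (legOp G) = -((l : ℝ) * (l + 1)) * a F G := intS_zon_legOp_mul h y G
  have hab := eigenfunctional_comm (ha F hF) (ha H hH)
  -- Otherwise the functional of H vanishes on all peaks, although their normalised values tend to
  -- H(y) = 1.
  have hb : a H (Polynomial.X ^ l) ≠ 0 := by
    intro h0
    have h1 := eigenfunctional_eq_zero (ha H hH) h0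
    have h2 := tendsto_intS_peak y H
    have h3 : ∀ n, intS (zon y (peak n) * H) = 0 := fun n => LinearMap.congr_fun h1 (peak n)
    simp only [h3, mul_zero, hHy] at h2
    exact zero_ne_one (tendsto_nhds_unique tendsto_const_nhds h2)
  have hr : ∀ G, a F G = a F (Polynomial.X ^ l) / a H (Polynomial.X ^ l) * a H G := by
    intro G
    have := hab G
    field_simp
    linarith
  -- The constant ratio of the two functionals is read off by concentrating at the pole.
  have h4 : ev (y : E3) F = a F (Polynomial.X ^ l) / a H (Polynomial.X ^ l) := by
    have h2 := tendsto_intS_peak y F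
    have h5 := (tendsto_intS_peak y H).const_mul (a F (Polynomial.X ^ l) / a H (Polynomial.X ^ l))
    rw [hHy, mul_one] at h5
    refine tendsto_nhds_unique h2 (h5.congr fun n => ?_)
    have : intS (zon y (peak n) * F) = _ * intS (zon y (peak n) * H) := hr (peak n)
    rw [this]
    ring
  rw [h4]
  exact (hr G).trans (mul_comm _ _)

lemma intS_one : intS 1 = 4 * Real.pi := by
  have : surf.real Set.univ = 4 * Real.pi := by
    unfold surf
    rw [Measure.toSphere_real_apply_univ, measureReal_def, EuclideanSpace.volume_ball_fin_three]
    simp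
    rw [ENNReal.toReal_ofReal (by positivity)]
    ring
  simp [intS_apply, this]

/-- Archimedes' theorem for polynomials. -/
lemma intS_zon (y : S2) (G : Polynomial ℝ) : intS (zon y G) = 2 * Real.pi * int1 G := by
  -- The constant 1 is an eigenfunction of degree 0, and both integrals annihilate the range of the
  -- Legendre operator; it remains to compare them on G = 1.
  have hE : IsEig (((0 : ℕ) : ℝ) * ((0 : ℕ) + 1)) (1 : Poly3) := ⟨0, by simp [lap_apply]⟩
  have h := eigenfunctional_comm (l := 0) (a := intS ∘ₗ (zon y).toLinearMap) (b := int1)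
    (fun G => by
      have := intS_zon_legOp_mul hE y G
      simpa using this)
    (fun G => by
      have := int1_legOp_mul G 1
      simpa [legOp_eq] using this) G
  simp at h
  have h1 : int1 1 = 2 := by
    have := int1_derivative Polynomial.X
    norm_num at this
    exact this
  rw [intS_one, h1] at h
  linarith

/-- The Funk-Hecke formula. -/
lemma funkHecke {l : ℕ} {F : Poly3} (hF : IsEig ((l : ℝ) * (l + 1)) F) (y : S2)
    (G : Polynomial ℝ) :
    intS (zon y G * F) = 2 * Real.pi * int1 (G * legendre l) * ev (y : E3) F := by
  rw [intS_zon_mul_comm hF (isEig_zon_legendre y l) y, ← map_mul, intS_zon]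
  rw [ev_zon, real_inner_self_eq_norm_sq, norm_sphere, one_pow, legendre_eval_one]

end Laplace

/-! ### Spherical harmonics as polynomials -/

section Harmonics

open MvPolynomial

lemma pderiv_comm (i j : Fin 3) (p : Poly3) :
    pderiv i (pderiv j p) = pderiv j (pderiv i p) := by
  have : ⁅(pderiv i : Derivation ℝ Poly3 Poly3), (pderiv j : Derivation ℝ Poly3 Poly3)⁆ = 0 := by
    apply derivation_ext
    intro k
    rw [Derivation.commutator_apply]
    simp [Pi.single_apply, apply_ite]
  exact sub_eq_zero.1 (DFunLike.congr_fun this p)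

lemma C_two : (C 2 : Poly3) = 2 := map_ofNat C 2

lemma intS_congr {p q : Poly3} (h : ∀ x : S2, ev (x : E3) p = ev (x : E3) q) :
    intS p = intS q := by
  simp only [intS_apply, h]

/-- The real and imaginary parts of `(x₀ + i x₁) ^ n`. -/
noncomputable def zeta : ℕ → Poly3 × Poly3
  | 0 => (1, 0)
  | n + 1 => (X 0 * (zeta n).1 - X 1 * (zeta n).2, X 1 * (zeta n).1 + X 0 * (zeta n).2)

lemma zeta_succ_fst (n : ℕ) : (zeta (n + 1)).1 = X 0 * (zeta n).1 - X 1 * (zeta n).2 := rfl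

lemma zeta_succ_snd (n : ℕ) : (zeta (n + 1)).2 = X 1 * (zeta n).1 + X 0 * (zeta n).2 := rfl

lemma ev_zeta (x : E3) (n : ℕ) :
    ev x (zeta n).1 = (((x 0 : ℂ) + (x 1 : ℂ) * Complex.I) ^ n).re ∧
      ev x (zeta n).2 = (((x 0 : ℂ) + (x 1 : ℂ) * Complex.I) ^ n).im := by
  induction n with
  | zero => simp [zeta]
  | succ n ih =>
    rw [zeta_succ_fst, zeta_succ_snd, pow_succ]
    simp [ih.1, ih.2]
    constructor <;> ring

lemma zeta_normSq (n : ℕ) : (zeta n).1 ^ 2 + (zeta n).2 ^ 2 = (X 0 ^ 2 + X 1 ^ 2) ^ n := by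
  induction n with
  | zero => simp [zeta]
  | succ n ih =>
    rw [pow_succ (X 0 ^ 2 + X 1 ^ 2 : Poly3), ← ih, zeta_succ_fst, zeta_succ_snd]
    ring

lemma pderiv_two_zeta (n : ℕ) : pderiv 2 (zeta n).1 = 0 ∧ pderiv 2 (zeta n).2 = 0 := by
  induction n with
  | zero => simp [zeta]
  | succ n ih => simp [zeta_succ_fst, zeta_succ_snd, ih.1, ih.2]

lemma pderiv_zeta_succ (n : ℕ) :
    pderiv 0 (zeta (n + 1)).1 = ((n : Poly3) + 1) * (zeta n).1 ∧
    pderiv 1 (zeta (n + 1)).1 = -(((n : Poly3) + 1) * (zeta n).2) ∧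
    pderiv 0 (zeta (n + 1)).2 = ((n : Poly3) + 1) * (zeta n).2 ∧
    pderiv 1 (zeta (n + 1)).2 = ((n : Poly3) + 1) * (zeta n).1 := by
  induction n with
  | zero => simp [zeta]
  | succ n ih =>
    obtain ⟨h1, h2, h3, h4⟩ := ih
    have e : ∀ i : Fin 3, pderiv i (zeta (n + 1 + 1)).1 =
        pderiv i (X 0 * (zeta (n + 1)).1 - X 1 * (zeta (n + 1)).2) := fun i => rfl
    have e' : ∀ i : Fin 3, pderiv i (zeta (n + 1 + 1)).2 =
        pderiv i (X 1 * (zeta (n + 1)).1 + X 0 * (zeta (n + 1)).2) := fun i => rfl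
    rw [e, e', e, e']
    simp only [map_sub, map_add, Derivation.leibniz, h1, h2, h3, h4, smul_eq_mul]
    simp only [zeta_succ_fst, zeta_succ_snd, pderiv_X_self, Nat.cast_add, Nat.cast_one,
      pderiv_X_of_ne (show (1 : Fin 3) ≠ 0 by decide),
      pderiv_X_of_ne (show (0 : Fin 3) ≠ 1 by decide)]
    refine ⟨?_, ?_, ?_, ?_⟩ <;> ring

lemma ang_two_zeta (n : ℕ) : ang 2 (zeta n).1 = -((n : Poly3) * (zeta n).2) ∧
    ang 2 (zeta n).2 = (n : Poly3) * (zeta n).1 := by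
  rw [ang_two_apply, ang_two_apply]
  rcases n with _ | n
  · simp [zeta]
  · obtain ⟨h1, h2, h3, h4⟩ := pderiv_zeta_succ n
    rw [h1, h2, h3, h4, zeta_succ_fst, zeta_succ_snd]
    push_cast
    constructor <;> ring

/-- The properties of the real and imaginary parts of `(x₀ + i x₁) ^ n` on which the
eigenvalue equations of the spherical harmonics depend. -/
structure IsPlanar (n : ℕ) (h : Poly3) : Prop where
  pderiv_two : pderiv 2 h = 0
  euler : X 0 * pderiv 0 h + X 1 * pderiv 1 h = (n : Poly3) * h
  harmonic : pderiv 0 (pderiv 0 h) + pderiv 1 (pderiv 1 h) = 0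
  ang_two : ang 2 (ang 2 h) = -((n : Poly3) ^ 2 * h)

lemma isPlanar_zeta_fst (n : ℕ) : IsPlanar n (zeta n).1 := by
  refine ⟨(pderiv_two_zeta n).1, ?_, ?_, ?_⟩
  · rcases n with _ | n
    · simp [zeta]
    · obtain ⟨h1, h2, -⟩ := pderiv_zeta_succ n
      rw [h1, h2, zeta_succ_fst]
      push_cast
      ring
  · rcases n with _ | _ | n
    · simp [zeta]
    · simp [zeta]
    · obtain ⟨h1, h2, h3, h4⟩ := pderiv_zeta_succ (n + 1)
      obtain ⟨h1', h2', h3', h4'⟩ := pderiv_zeta_succ n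
      rw [h1, h2]
      simp [h1', h4']
  · rw [(ang_two_zeta n).1, map_neg, Derivation.leibniz, (ang_two_zeta n).2]
    simp
    ring

lemma isPlanar_zeta_snd (n : ℕ) : IsPlanar n (zeta n).2 := by
  refine ⟨(pderiv_two_zeta n).2, ?_, ?_, ?_⟩
  · rcases n with _ | n
    · simp [zeta]
    · obtain ⟨-, -, h1, h2⟩ := pderiv_zeta_succ n
      rw [h1, h2, zeta_succ_snd]
      push_cast
      ring
  · rcases n with _ | _ | n
    · simp [zeta]
    · simp [zeta]
    · obtain ⟨h1, h2, h3, h4⟩ := pderiv_zeta_succ (n + 1)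
      obtain ⟨h1', h2', h3', h4'⟩ := pderiv_zeta_succ n
      rw [h3, h4]
      simp [h3', h2']
  · rw [(ang_two_zeta n).2, Derivation.leibniz, (ang_two_zeta n).1]
    simp
    ring

/-- The north pole. -/
noncomputable def north : S2 := ⟨EuclideanSpace.single 2 1, by simp⟩

/-- A polynomial in the third coordinate. -/
noncomputable def axial : Polynomial ℝ →ₐ[ℝ] Poly3 := Polynomial.aeval (X 2)

lemma zon_north : zon (north : E3) = axial := by
  have : dotP (north : E3) = X 2 := by simp [dotP, north]
  rw [zon, this, axial]

@[simp] lemma ev_axial (x : E3) (G : Polynomial ℝ) : ev x (axial G) = G.eval (x 2) := by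
  rw [axial, ← Polynomial.aeval_algHom_apply, ev_X, Polynomial.coe_aeval_eq_eval]

lemma ang_axial (i : Fin 3) (G : Polynomial ℝ) :
    ang i (axial G) = axial (Polynomial.derivative G) * ang i (X 2) := by
  rw [axial, Derivation.map_aeval, smul_eq_mul]

lemma ang_two_axial_mul (G : Polynomial ℝ) (h : Poly3) :
    ang 2 (axial G * h) = axial G * ang 2 h := by
  rw [Derivation.leibniz, ang_axial]
  simp [ang_two_apply]

lemma IsPlanar.ang_two_ang_two {n : ℕ} {h : Poly3} (hh : IsPlanar n h) (G : Polynomial ℝ) :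
    ang 2 (ang 2 (axial G * h)) = -((n : ℝ) ^ 2) • (axial G * h) := by
  rw [ang_two_axial_mul, ang_two_axial_mul, hh.ang_two, MvPolynomial.smul_eq_C_mul]
  simp
  ring

/-- The cross terms of `lap` on a product reduce to -n x₂ G'(x₂) h by Euler's relation, and h itself
satisfies `lap h = -n(n+1) h` by harmonicity in the plane. -/
lemma IsPlanar.lap_axial_mul {n : ℕ} {h : Poly3} (hh : IsPlanar n h) (G : Polynomial ℝ) :
    lap (axial G * h) =
      axial (legOp G - (2 * (n : ℝ)) • (Polynomial.X * Polynomial.derivative G) -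
        ((n : ℝ) * (n + 1)) • G) * h +
      sph * (axial (Polynomial.derivative (Polynomial.derivative G)) * h) := by
  have h1 : lap (axial G) = axial (legOp G) +
      sph * axial (Polynomial.derivative (Polynomial.derivative G)) := by
    rw [← zon_north, lap_zon]
  have h2 : lap h = -((n : Poly3) * (n + 1)) * h := by
    have e0 : ang 0 h = -(X 2 * pderiv 1 h) := by
      rw [ang_zero_apply, hh.pderiv_two]; ring
    have e1 : ang 1 h = X 2 * pderiv 0 h := by
      rw [ang_one_apply, hh.pderiv_two]; ring
    have e2 : ∀ i : Fin 3, pderiv 2 (pderiv i h) = 0 := fun i => by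
      rw [pderiv_comm, hh.pderiv_two, map_zero]
    rw [lap_apply, e0, e1, hh.ang_two, map_neg, ang_zero_apply, ang_one_apply]
    simp only [Derivation.leibniz, e2, pderiv_X_self, smul_eq_mul,
      pderiv_X_of_ne (show (2 : Fin 3) ≠ 0 by decide),
      pderiv_X_of_ne (show (2 : Fin 3) ≠ 1 by decide)]
    linear_combination (X 2 ^ 2) * hh.harmonic - hh.euler
  have h3 : ang 0 (axial G) * ang 0 h + ang 1 (axial G) * ang 1 h + ang 2 (axial G) * ang 2 h =
      -(n : Poly3) * axial (Polynomial.X * Polynomial.derivative G) * h := by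
    simp only [ang_axial, ang_zero_apply, ang_one_apply, ang_two_apply, hh.pderiv_two, map_mul,
      pderiv_X_self, pderiv_X_of_ne (show (2 : Fin 3) ≠ 0 by decide),
      pderiv_X_of_ne (show (2 : Fin 3) ≠ 1 by decide)]
    have : axial Polynomial.X = X 2 := Polynomial.aeval_X _
    rw [this]
    linear_combination (-X 2 * axial (Polynomial.derivative G)) * hh.euler
  have h4 : lap (axial G * h) = lap (axial G) * h + axial G * lap h +
      2 * (ang 0 (axial G) * ang 0 h + ang 1 (axial G) * ang 1 h +
        ang 2 (axial G) * ang 2 h) := by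
    simp only [lap_apply, Derivation.leibniz, smul_eq_mul, map_add]
    ring
  rw [h4, h1, h2, h3]
  simp only [map_sub, map_smul, MvPolynomial.smul_eq_C_mul]
  simp [C_two]
  ring

/-- With G the n-th derivative of P_l, the factor of h becomes the differential equation `legD_ode`.
-/
lemma IsPlanar.isEig {n : ℕ} {h : Poly3} (hh : IsPlanar n h) (l : ℕ) :
    IsEig ((l : ℝ) * (l + 1)) (axial (legD l n) * h) := by
  refine ⟨axial (Polynomial.derivative (Polynomial.derivative (legD l n))) * h, ?_⟩
  have key : legOp (legD l n) - (2 * (n : ℝ)) • (Polynomial.X * Polynomial.derivative (legD l n)) -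
        ((n : ℝ) * (n + 1)) • legD l n = -((l : ℝ) * (l + 1)) • legD l n := by
    rw [legOp_apply, derivative_legD, derivative_legD]
    have := legD_ode l n
    simp only [Polynomial.smul_eq_C_mul]
    simp only [map_sub, map_mul, map_add, map_natCast, map_one, Polynomial.C_ofNat, map_neg]
      at this ⊢
    linear_combination this
  rw [hh.lap_axial_mul, key, map_smul, smul_mul_assoc]
  module

/-- The factor of a spherical harmonic of order `m` that depends on the azimuth. -/
noncomputable def azim (m : ℤ) : Poly3 :=
  if 0 ≤ m then (zeta m.natAbs).1 else (zeta m.natAbs).2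

lemma isPlanar_azim (m : ℤ) : IsPlanar m.natAbs (azim m) := by
  unfold azim
  split_ifs
  · exact isPlanar_zeta_fst _
  · exact isPlanar_zeta_snd _

/-- The normalising constant of a spherical harmonic. -/
noncomputable def normC (l : ℕ) (m : ℤ) : ℝ :=
  Real.sqrt ((if m = 0 then 1 else 2) * ((2 * l + 1) / (4 * Real.pi)) *
      (((l - m.natAbs).factorial : ℝ) / ((l + m.natAbs).factorial : ℝ)))

/-- The spherical harmonic as a polynomial. -/
noncomputable def harm (l : ℕ) (m : ℤ) : Poly3 :=
  normC l m • (axial (legD l m.natAbs) * azim m)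

lemma sphHarm_eq (l : ℕ) (m : ℤ) : sphHarm l m = fun x => ev x (harm l m) := by
  ext x
  simp only [sphHarm, harm, normC, map_smul, map_mul, ev_axial, smul_eq_mul, azim, legD]
  split_ifs
  · rw [(ev_zeta x _).1]; ring
  · rw [(ev_zeta x _).2]; ring
  · rw [(ev_zeta x _).1]; ring
  · rw [(ev_zeta x _).2]; ring

lemma isEig_harm (l : ℕ) (m : ℤ) : IsEig ((l : ℝ) * (l + 1)) (harm l m) :=
  ((isPlanar_azim m).isEig l).smul _

lemma ang_two_harm (l : ℕ) (m : ℤ) :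
    ang 2 (ang 2 (harm l m)) = -((m.natAbs : ℝ) ^ 2) • harm l m := by
  rw [harm, Derivation.map_smul, Derivation.map_smul, (isPlanar_azim m).ang_two_ang_two, smul_comm]

lemma intS_harm_mul_harm_of_degree_ne {l l' : ℕ} (m m' : ℤ) (h : l ≠ l') :
    intS (harm l m * harm l' m') = 0 := by
  refine (isEig_harm l m).intS_mul_eq_zero (isEig_harm l' m') ?_
  intro h'
  have h1 : ((l : ℝ) - l') * (l + l' + 1) = 0 := by linarith
  rcases mul_eq_zero.1 h1 with h2 | h2
  · exact h (by exact_mod_cast sub_eq_zero.1 h2)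
  · have : (0 : ℝ) < l + l' + 1 := by positivity
    exact absurd h2 this.ne'

/-- The product of real and imaginary parts is, up to a nonzero factor, the azimuthal derivative of
the squared real part. -/
lemma intS_axial_mul_zeta_mul (G : Polynomial ℝ) {n : ℕ} (hn : n ≠ 0) :
    intS (axial G * ((zeta n).1 * (zeta n).2)) = 0 := by
  have h1 := intS_rot (Pi.single 2 1) (axial G * (zeta n).1 ^ 2)
  change intS (ang 2 _) = 0 at h1
  rw [ang_two_axial_mul, Derivation.leibniz_pow, (ang_two_zeta _).1] at h1
  have e : axial G * (2 • (zeta n).1 ^ (2 - 1) • -((n : Poly3) * (zeta n).2)) =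
      (-2 * (n : ℝ)) • (axial G * ((zeta n).1 * (zeta n).2)) := by
    rw [MvPolynomial.smul_eq_C_mul]
    simp [nsmul_eq_mul, C_two]
    ring
  rw [e, map_smul, smul_eq_mul] at h1
  exact (mul_eq_zero.1 h1).resolve_left (by simpa using hn)

/-- Orders of different modulus belong to different eigenvalues of the squared azimuthal derivative.
Opposite orders leave a product of a real and an imaginary part. -/
lemma intS_harm_mul_harm_of_order_ne (l l' : ℕ) {m m' : ℤ} (h : m ≠ m') :
    intS (harm l m * harm l' m') = 0 := by
  by_cases hab : m.natAbs = m'.natAbs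
  · have h0 := intS_axial_mul_zeta_mul (legD l m.natAbs * legD l' m.natAbs)
      (n := m.natAbs) (by omega)
    rw [map_mul axial] at h0
    rw [harm, harm, ← hab, smul_mul_smul_comm, map_smul, smul_eq_mul]
    rcases le_or_gt 0 m with hm | hm
    · have hm' : ¬ 0 ≤ m' := by omega
      rw [azim, if_pos hm, azim, if_neg hm', ← hab, mul_mul_mul_comm, h0, mul_zero]
    · have hm' : 0 ≤ m' := by omega
      rw [azim, if_neg (not_le.2 hm), azim, if_pos hm', ← hab, mul_mul_mul_comm,
        mul_comm (zeta _).2, h0, mul_zero]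
  · have h1 : intS (ang 2 (ang 2 (harm l m)) * harm l' m') =
        intS (harm l m * ang 2 (ang 2 (harm l' m'))) := by
      rw [intS_ang_mul, intS_ang_mul, neg_neg]
    rw [ang_two_harm, ang_two_harm, smul_mul_assoc, mul_smul_comm, map_smul, map_smul, smul_eq_mul,
      smul_eq_mul] at h1
    have h2 : ((m.natAbs : ℝ) ^ 2 - (m'.natAbs : ℝ) ^ 2) * intS (harm l m * harm l' m') = 0 := by
      linarith
    refine (mul_eq_zero.1 h2).resolve_left (sub_ne_zero.2 fun h3 => hab ?_)
    exact_mod_cast (sq_eq_sq₀ (Nat.cast_nonneg _) (Nat.cast_nonneg _)).1 h3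

/-- On the sphere x₀² + x₁² = 1 - x₂², so the integrand is zonal about the north pole. -/
lemma intS_axial_mul_normSq (G : Polynomial ℝ) (n : ℕ) :
    intS (axial G * ((zeta n).1 ^ 2 + (zeta n).2 ^ 2)) =
      2 * Real.pi * int1 (G * (1 - Polynomial.X ^ 2) ^ n) := by
  rw [← intS_zon north, zon_north, zeta_normSq]
  refine intS_congr fun x => ?_
  have := sum_sq_sphere x
  simp
  left
  congr 1
  linarith

/-- The difference of the two squares is, up to the factor n, the azimuthal derivative of their
mixed product. -/
lemma intS_axial_mul_zeta_sq (G : Polynomial ℝ) {n : ℕ} (hn : n ≠ 0) :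
    intS (axial G * (zeta n).1 ^ 2) = intS (axial G * (zeta n).2 ^ 2) := by
  have h1 := intS_rot (Pi.single 2 1) (axial G * ((zeta n).1 * (zeta n).2))
  change intS (ang 2 _) = 0 at h1
  rw [ang_two_axial_mul, Derivation.leibniz, (ang_two_zeta _).1, (ang_two_zeta _).2] at h1
  have e : axial G * ((zeta n).1 • (↑n * (zeta n).1) + (zeta n).2 • -(↑n * (zeta n).2)) =
      (n : ℝ) • (axial G * (zeta n).1 ^ 2 - axial G * (zeta n).2 ^ 2) := by
    rw [MvPolynomial.smul_eq_C_mul]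
    simp
    ring
  rw [e, map_smul, smul_eq_mul, map_sub] at h1
  have := (mul_eq_zero.1 h1).resolve_left (by exact_mod_cast hn)
  linarith

lemma intS_axial_mul_azim_sq (G : Polynomial ℝ) (m : ℤ) :
    intS (axial G * azim m ^ 2) =
      (if m = 0 then 2 else 1) * Real.pi * int1 (G * (1 - Polynomial.X ^ 2) ^ m.natAbs) := by
  have h := intS_axial_mul_normSq G m.natAbs
  split_ifs with hm
  · subst hm
    simpa [azim, zeta] using h
  · have h2 := intS_axial_mul_zeta_sq G (n := m.natAbs) (by omega)
    rw [mul_add, map_add] at h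
    unfold azim
    split_ifs <;> linarith

lemma mem_orders {l : ℕ} {m : ℤ} : m ∈ orders l ↔ m.natAbs ≤ l := by
  rw [orders, Finset.mem_Icc]
  omega

lemma intS_harm_sq {l : ℕ} {m : ℤ} (hm : m ∈ orders l) : intS (harm l m * harm l m) = 1 := by
  have hm' := mem_orders.1 hm
  have e : harm l m * harm l m =
      (normC l m ^ 2) • (axial (legD l m.natAbs ^ 2) * azim m ^ 2) := by
    rw [harm, smul_mul_smul_comm, map_pow]
    congr 1
    · ring
    · ring
  rw [e, map_smul, intS_axial_mul_azim_sq, int1_legD_sq hm', smul_eq_mul, normC, Real.sq_sqrt]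
  · have := Real.pi_pos
    split_ifs <;> field_simp <;> norm_num
  · have := Real.pi_pos
    split_ifs <;> positivity

lemma normC_pos (l : ℕ) (m : ℤ) : 0 < normC l m := by
  have := Real.pi_pos
  unfold normC
  split_ifs <;> positivity

end Harmonics

/-! ### Polynomials on the sphere are spanned by spherical harmonics -/

section Span

open MvPolynomial

/-- The polynomials that agree on the sphere with a combination of harmonics of degree `≤ n`. -/
noncomputable def harmSpan (n : ℕ) : Submodule ℝ Poly3 :=
  Submodule.span ℝ {p | ∃ l ≤ n, ∃ m ∈ orders l, p = harm l m} ⊔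
    LinearMap.range (LinearMap.mulLeft ℝ sph)

/-- The polynomials that agree on the sphere with a combination of products of powers of the third
coordinate and of real or imaginary parts of powers of `x₀ + i x₁`, of total degree `≤ n`. -/
noncomputable def planSpan (n : ℕ) : Submodule ℝ Poly3 :=
  Submodule.span ℝ {p | ∃ k a, k + a ≤ n ∧
    (p = axial (Polynomial.X ^ k) * (zeta a).1 ∨ p = axial (Polynomial.X ^ k) * (zeta a).2)} ⊔
    LinearMap.range (LinearMap.mulLeft ℝ sph)

lemma sph_mul_mem_harmSpan (n : ℕ) (q : Poly3) : sph * q ∈ harmSpan n :=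
  Submodule.mem_sup_right ⟨q, rfl⟩

lemma sph_mul_mem_planSpan (n : ℕ) (q : Poly3) : sph * q ∈ planSpan n :=
  Submodule.mem_sup_right ⟨q, rfl⟩

lemma harm_mem_harmSpan {n l : ℕ} (hl : l ≤ n) {m : ℤ} (hm : m ∈ orders l) :
    harm l m ∈ harmSpan n :=
  Submodule.mem_sup_left (Submodule.subset_span ⟨l, hl, m, hm, rfl⟩)

lemma planSpan_fst {n k a : ℕ} (h : k + a ≤ n) :
    axial (Polynomial.X ^ k) * (zeta a).1 ∈ planSpan n :=
  Submodule.mem_sup_left (Submodule.subset_span ⟨k, a, h, Or.inl rfl⟩)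

lemma planSpan_snd {n k a : ℕ} (h : k + a ≤ n) :
    axial (Polynomial.X ^ k) * (zeta a).2 ∈ planSpan n :=
  Submodule.mem_sup_left (Submodule.subset_span ⟨k, a, h, Or.inr rfl⟩)

lemma planSpan_mono {n n' : ℕ} (h : n ≤ n') : planSpan n ≤ planSpan n' := by
  refine sup_le_sup_right (Submodule.span_mono ?_) _
  rintro p ⟨k, a, hka, hp⟩
  exact ⟨k, a, hka.trans h, hp⟩

lemma planSpan_induction {n : ℕ} {V : Submodule ℝ Poly3} {f : Poly3 →ₗ[ℝ] Poly3}
    (h1 : ∀ k a, k + a ≤ n → f (axial (Polynomial.X ^ k) * (zeta a).1) ∈ V)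
    (h2 : ∀ k a, k + a ≤ n → f (axial (Polynomial.X ^ k) * (zeta a).2) ∈ V)
    (h3 : ∀ q, f (sph * q) ∈ V) {p : Poly3} (hp : p ∈ planSpan n) : f p ∈ V := by
  suffices planSpan n ≤ V.comap f from this hp
  refine sup_le (Submodule.span_le.2 ?_) ?_
  · rintro p ⟨k, a, hka, rfl | rfl⟩
    · exact h1 k a hka
    · exact h2 k a hka
  · rintro _ ⟨q, rfl⟩
    exact h3 q

/-- With ζ = x₀ + i x₁ these are the real and imaginary parts of ζ^(a+2) ± |ζ|² ζ^a. They show that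
multiplication by x₀ or x₁ stays within the planar products. -/
lemma zeta_mul (a : ℕ) :
    X 0 * (zeta (a + 1)).1 = (1 / 2 : ℝ) • ((zeta (a + 2)).1 + (X 0 ^ 2 + X 1 ^ 2) * (zeta a).1) ∧
    X 1 * (zeta (a + 1)).2 = (1 / 2 : ℝ) • (-(zeta (a + 2)).1 + (X 0 ^ 2 + X 1 ^ 2) * (zeta a).1) ∧
    X 0 * (zeta (a + 1)).2 = (1 / 2 : ℝ) • ((zeta (a + 2)).2 + (X 0 ^ 2 + X 1 ^ 2) * (zeta a).2) ∧
    X 1 * (zeta (a + 1)).1 = (1 / 2 : ℝ) • ((zeta (a + 2)).2 - (X 0 ^ 2 + X 1 ^ 2) * (zeta a).2) := by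
  have h2 : C (1 / 2 : ℝ) * (2 : Poly3) = 1 := by
    rw [← C_two, ← C_mul]; norm_num
  simp only [zeta_succ_fst, zeta_succ_snd, MvPolynomial.smul_eq_C_mul]
  refine ⟨?_, ?_, ?_, ?_⟩
  · linear_combination (-X 0 * (X 0 * (zeta a).1 - X 1 * (zeta a).2)) * h2
  · linear_combination (-X 1 * (X 1 * (zeta a).1 + X 0 * (zeta a).2)) * h2
  · linear_combination (-X 0 * (X 1 * (zeta a).1 + X 0 * (zeta a).2)) * h2
  · linear_combination (-X 1 * (X 0 * (zeta a).1 - X 1 * (zeta a).2)) * h2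

lemma axial_X_pow (k : ℕ) : axial (Polynomial.X ^ k) = X 2 ^ k := by
  rw [map_pow, axial, Polynomial.aeval_X]

/-- Modulo |x|² - 1 the factor x₀² + x₁² is 1 - x₂², which trades planar degree for axial degree
without raising the total. -/
lemma planSpan_lower_fst {n k a : ℕ} (h : k + a + 2 ≤ n) :
    axial (Polynomial.X ^ k) * ((X 0 ^ 2 + X 1 ^ 2) * (zeta a).1) ∈ planSpan n := by
  have e : axial (Polynomial.X ^ k) * ((X 0 ^ 2 + X 1 ^ 2) * (zeta a).1) =
      sph * (axial (Polynomial.X ^ k) * (zeta a).1) + axial (Polynomial.X ^ k) * (zeta a).1 -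
        axial (Polynomial.X ^ (k + 2)) * (zeta a).1 := by
    rw [axial_X_pow, axial_X_pow, sph]
    ring
  rw [e]
  exact sub_mem (add_mem (sph_mul_mem_planSpan _ _) (planSpan_fst (by omega)))
    (planSpan_fst (by omega))

lemma planSpan_lower_snd {n k a : ℕ} (h : k + a + 2 ≤ n) :
    axial (Polynomial.X ^ k) * ((X 0 ^ 2 + X 1 ^ 2) * (zeta a).2) ∈ planSpan n := by
  have e : axial (Polynomial.X ^ k) * ((X 0 ^ 2 + X 1 ^ 2) * (zeta a).2) =
      sph * (axial (Polynomial.X ^ k) * (zeta a).2) + axial (Polynomial.X ^ k) * (zeta a).2 -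
        axial (Polynomial.X ^ (k + 2)) * (zeta a).2 := by
    rw [axial_X_pow, axial_X_pow, sph]
    ring
  rw [e]
  exact sub_mem (add_mem (sph_mul_mem_planSpan _ _) (planSpan_snd (by omega)))
    (planSpan_snd (by omega))

lemma X_mul_mem_planSpan (i : Fin 3) {n : ℕ} {p : Poly3} (hp : p ∈ planSpan n) :
    X i * p ∈ planSpan (n + 1) := by
  refine planSpan_induction (f := LinearMap.mulLeft ℝ (X i)) ?_ ?_ ?_ hp
  · intro k a h
    rw [LinearMap.mulLeft_apply, mul_left_comm]
    fin_cases i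
    · rcases a with _ | a
      · simpa [zeta] using planSpan_fst (n := n + 1) (k := k) (a := 1) (by omega)
      · simp only [Fin.zero_eta, (zeta_mul a).1, mul_smul_comm, mul_add]
        exact Submodule.smul_mem _ _ (add_mem (planSpan_fst (by omega))
          (planSpan_lower_fst (by omega)))
    · rcases a with _ | a
      · simpa [zeta] using planSpan_snd (n := n + 1) (k := k) (a := 1) (by omega)
      · simp only [Fin.mk_one, (zeta_mul a).2.2.2, mul_smul_comm, mul_sub]
        exact Submodule.smul_mem _ _ (sub_mem (planSpan_snd (by omega))
          (planSpan_lower_snd (by omega)))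
    · have := planSpan_fst (n := n + 1) (k := k + 1) (a := a) (by omega)
      rw [axial_X_pow, pow_succ, mul_assoc] at this
      rw [axial_X_pow]
      exact this
  · intro k a h
    rw [LinearMap.mulLeft_apply, mul_left_comm]
    fin_cases i
    · rcases a with _ | a
      · simp [zeta]
      · simp only [Fin.zero_eta, (zeta_mul a).2.2.1, mul_smul_comm, mul_add]
        exact Submodule.smul_mem _ _ (add_mem (planSpan_snd (by omega))
          (planSpan_lower_snd (by omega)))
    · rcases a with _ | a
      · simp [zeta]
      · simp only [Fin.mk_one, (zeta_mul a).2.1, mul_smul_comm, mul_add, mul_neg]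
        exact Submodule.smul_mem _ _ (add_mem (neg_mem (planSpan_fst (by omega)))
          (planSpan_lower_fst (by omega)))
    · have := planSpan_snd (n := n + 1) (k := k + 1) (a := a) (by omega)
      rw [axial_X_pow, pow_succ, mul_assoc] at this
      rw [axial_X_pow]
      exact this
  · intro q
    rw [LinearMap.mulLeft_apply, mul_left_comm]
    exact sph_mul_mem_planSpan _ _

lemma mem_planSpan {n : ℕ} {p : Poly3} (hp : p.totalDegree ≤ n) : p ∈ planSpan n := by
  have hmon : ∀ (n : ℕ) (s : Fin 3 →₀ ℕ), (s.sum fun _ e => e) = n →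
      monomial s (1 : ℝ) ∈ planSpan n := by
    intro n
    induction n with
    | zero =>
      intro s hs
      have : s = 0 := by
        ext i
        rw [Finsupp.sum_fintype _ _ (fun _ => rfl), Finset.sum_eq_zero_iff] at hs
        exact hs i (Finset.mem_univ _)
      subst this
      simpa [zeta] using planSpan_fst (n := 0) (k := 0) (a := 0) le_rfl
    | succ n ih =>
      intro s hs
      obtain ⟨i, hi⟩ : ∃ i, s i ≠ 0 := by
        by_contra! h
        have : s = 0 := by ext i; simpa using h i
        subst this
        simp at hs
      have hle : Finsupp.single i 1 ≤ s := by
        rw [Finsupp.single_le_iff]; omega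
      obtain ⟨t, rfl⟩ : ∃ t, s = Finsupp.single i 1 + t := ⟨_, (add_tsub_cancel_of_le hle).symm⟩
      rw [Finsupp.sum_add_index' (fun _ => rfl) (fun _ _ _ => rfl),
        Finsupp.sum_single_index rfl] at hs
      have := X_mul_mem_planSpan i (ih t (by omega))
      rwa [X, monomial_mul, one_mul] at this
  rw [p.as_sum]
  refine sum_mem fun s hs => ?_
  rw [show monomial s (MvPolynomial.coeff s p) = MvPolynomial.coeff s p • monomial s (1 : ℝ) by simp [smul_monomial]]
  exact Submodule.smul_mem _ _ (planSpan_mono ((le_totalDegree hs).trans hp) (hmon _ s rfl))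

/-- Triangular elimination: the a-th derivative of P_(k+a) has exact degree k, so a multiple of it
removes the leading term of G. -/
lemma axial_mul_mem_harmSpan {h : Poly3} {a : ℕ}
    (hh : ∀ l, a ≤ l → ∀ n, l ≤ n → axial (legD l a) * h ∈ harmSpan n) :
    ∀ (k : ℕ) (G : Polynomial ℝ), G.degree < k → ∀ n, k + a ≤ n + 1 → axial G * h ∈ harmSpan n := by
  intro k
  induction k with
  | zero =>
    intro G hG n _
    have : G = 0 := by
      rw [← Polynomial.degree_eq_bot]
      simpa using hG
    simp [this]
  | succ k ih =>
    intro G hG n hn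
    set c := G.coeff k / (legD (k + a) a).coeff k with hc
    have hne := coeff_legD_ne_zero (l := k + a) (m := a) (by omega)
    rw [Nat.add_sub_cancel] at hne
    have hlow : (G - c • legD (k + a) a).degree < k := by
      rw [Polynomial.degree_lt_iff_coeff_zero] at hG ⊢
      intro j hj
      rw [Polynomial.coeff_sub, Polynomial.coeff_smul, smul_eq_mul]
      rcases hj.eq_or_lt with rfl | hj
      · rw [hc]; field_simp; simp
      · rw [hG j hj, Polynomial.coeff_eq_zero_of_natDegree_lt]
        · simp
        · exact lt_of_le_of_lt (natDegree_legD_le _ _) (by omega)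
    have e : axial G * h = axial (G - c • legD (k + a) a) * h +
        c • (axial (legD (k + a) a) * h) := by
      rw [map_sub, map_smul, sub_mul, smul_mul_assoc, sub_add_cancel]
    rw [e]
    exact add_mem (ih _ hlow n (by omega))
      (Submodule.smul_mem _ _ (hh _ (by omega) n (by omega)))

lemma axial_legD_mul_azim_mem {l : ℕ} {m : ℤ} (hm : m ∈ orders l) {n : ℕ} (hn : l ≤ n) :
    axial (legD l m.natAbs) * azim m ∈ harmSpan n := by
  have := Submodule.smul_mem _ (normC l m)⁻¹ (harm_mem_harmSpan hn hm)
  rwa [harm, smul_smul, inv_mul_cancel₀ (normC_pos l m).ne', one_smul] at this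

lemma mem_harmSpan {n : ℕ} {p : Poly3} (hp : p.totalDegree ≤ n) : p ∈ harmSpan n := by
  have hX : ∀ k : ℕ, (Polynomial.X ^ k : Polynomial ℝ).degree < ((k + 1 : ℕ) : WithBot ℕ) := by
    intro k
    rw [Polynomial.degree_X_pow]
    exact_mod_cast Nat.lt_succ_self k
  refine planSpan_induction (f := LinearMap.id) ?_ ?_ (sph_mul_mem_harmSpan n) (mem_planSpan hp)
  · intro k a hka
    refine axial_mul_mem_harmSpan (a := a) (fun l hl n hn => ?_) (k + 1) _ (hX k) n (by omega)
    have := axial_legD_mul_azim_mem (l := l) (m := (a : ℤ)) (mem_orders.2 (by simpa using hl)) hn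
    simpa [azim] using this
  · intro k a hka
    refine axial_mul_mem_harmSpan (a := a) (fun l hl n hn => ?_) (k + 1) _ (hX k) n (by omega)
    rcases Nat.eq_zero_or_pos a with rfl | ha
    · simp [zeta]
    · have := axial_legD_mul_azim_mem (l := l) (m := -(a : ℤ)) (mem_orders.2 (by simpa using hl)) hn
      have h0 : a ≠ 0 := by omega
      simpa [azim, h0] using this

/-- On the sphere p is a combination of harmonics of degree at most n, all orthogonal to degree l.
-/
lemma intS_mul_harm_eq_zero {n l : ℕ} {p : Poly3} (hp : p.totalDegree ≤ n) (hl : n < l) (m : ℤ) :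
    intS (p * harm l m) = 0 := by
  suffices harmSpan n ≤ LinearMap.ker (intS ∘ₗ LinearMap.mulRight ℝ (harm l m)) from
    this (mem_harmSpan hp)
  refine sup_le (Submodule.span_le.2 ?_) ?_
  · rintro p ⟨l', hl', m', -, rfl⟩
    exact intS_harm_mul_harm_of_degree_ne m' m (by omega)
  · rintro _ ⟨q, rfl⟩
    simp [mul_assoc]

/-- A linear map that vanishes on all harmonics and on all multiples of `|x|² - 1` is zero. -/
lemma eq_zero_of_harm {M : Type*} [AddCommGroup M] [Module ℝ M] {f : Poly3 →ₗ[ℝ] M}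
    (h1 : ∀ l, ∀ m ∈ orders l, f (harm l m) = 0) (h2 : ∀ q, f (sph * q) = 0) : f = 0 := by
  refine LinearMap.ext fun p : Poly3 => ?_
  suffices harmSpan p.totalDegree ≤ LinearMap.ker f from this (mem_harmSpan le_rfl)
  refine sup_le (Submodule.span_le.2 ?_) ?_
  · rintro p ⟨l', hl', m', hm', rfl⟩
    exact h1 l' m' hm'
  · rintro _ ⟨q, rfl⟩
    exact h2 q

lemma totalDegree_pderiv_le (i : Fin 3) (p : Poly3) :
    (pderiv i p).totalDegree ≤ p.totalDegree := by
  have : pderiv i p = ∑ s ∈ p.support, pderiv i (monomial s (MvPolynomial.coeff s p)) := by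
    conv_lhs => rw [p.as_sum, map_sum]
  rw [this]
  refine totalDegree_finsetSum_le fun s hs => ?_
  rw [pderiv_monomial]
  refine (totalDegree_monomial_le _ _).trans (le_trans ?_ (le_totalDegree hs))
  rw [Finsupp.sum_fintype _ _ (fun _ => rfl), Finsupp.sum_fintype _ _ (fun _ => rfl)]
  exact Finset.sum_le_sum fun j _ => by simp

lemma totalDegree_zeta_le (n : ℕ) :
    (zeta n).1.totalDegree ≤ n ∧ (zeta n).2.totalDegree ≤ n := by
  induction n with
  | zero => simp [zeta]
  | succ n ih =>
    rw [zeta_succ_fst, zeta_succ_snd]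
    have hX : ∀ (i : Fin 3) (p : Poly3), p.totalDegree ≤ n → (X i * p).totalDegree ≤ n + 1 := by
      intro i p hp
      refine (totalDegree_mul _ _).trans ?_
      rw [totalDegree_X]
      omega
    exact ⟨(totalDegree_sub _ _).trans (max_le (hX _ _ ih.1) (hX _ _ ih.2)),
      (totalDegree_add _ _).trans (max_le (hX _ _ ih.1) (hX _ _ ih.2))⟩

lemma totalDegree_axial_le (G : Polynomial ℝ) : (axial G).totalDegree ≤ G.natDegree := by
  rw [axial, Polynomial.aeval_eq_sum_range]
  refine totalDegree_finsetSum_le fun i hi => ?_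
  refine (totalDegree_smul_le _ _).trans ?_
  rw [totalDegree_X_pow]
  exact Finset.mem_range_succ_iff.1 hi

lemma totalDegree_harm_le {l : ℕ} {m : ℤ} (hm : m ∈ orders l) : (harm l m).totalDegree ≤ l := by
  refine (totalDegree_smul_le _ _).trans ((totalDegree_mul _ _).trans ?_)
  have h1 := (totalDegree_axial_le (legD l m.natAbs)).trans (natDegree_legD_le _ _)
  have h2 : (azim m).totalDegree ≤ m.natAbs := by
    unfold azim
    split_ifs
    · exact (totalDegree_zeta_le _).1
    · exact (totalDegree_zeta_le _).2
  have := mem_orders.1 hm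
  omega

end Span

/-! ### Finite orthonormal expansions for a symmetric bilinear form -/

section Bilinear

variable {M ι : Type*} [AddCommGroup M] [Module ℝ M] {B : M →ₗ[ℝ] M →ₗ[ℝ] ℝ} {e : ι → M}
  {s : Finset ι}

/-- A family is orthonormal on a finite set of indices. -/
def OrthonormalOn (B : M →ₗ[ℝ] M →ₗ[ℝ] ℝ) (e : ι → M) (s : Finset ι) : Prop :=
  (∀ i ∈ s, B (e i) (e i) = 1) ∧ ∀ i ∈ s, ∀ j ∈ s, i ≠ j → B (e i) (e j) = 0

lemma OrthonormalOn.apply_sum_left (h : OrthonormalOn B e s) (c : ι → ℝ) {j : ι} (hj : j ∈ s) :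
    B (∑ i ∈ s, c i • e i) (e j) = c j := by
  simp only [map_sum, map_smul, LinearMap.sum_apply, LinearMap.smul_apply, smul_eq_mul]
  rw [Finset.sum_eq_single_of_mem j hj, h.1 j hj, mul_one]
  intro i hi hij
  rw [h.2 i hi j hj hij, mul_zero]

lemma OrthonormalOn.apply_sum_sum (h : OrthonormalOn B e s) (c d : ι → ℝ) :
    B (∑ i ∈ s, c i • e i) (∑ i ∈ s, d i • e i) = ∑ i ∈ s, c i * d i := by
  rw [map_sum]
  refine Finset.sum_congr rfl fun j hj => ?_
  rw [map_smul, h.apply_sum_left c hj, smul_eq_mul, mul_comm]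

lemma OrthonormalOn.apply_sub_sub (h : OrthonormalOn B e s) (hB : ∀ x y, B x y = B y x) (x : M) :
    B (x - ∑ i ∈ s, B x (e i) • e i) (x - ∑ i ∈ s, B x (e i) • e i) =
      B x x - ∑ i ∈ s, B x (e i) ^ 2 := by
  have h1 : B x (∑ i ∈ s, B x (e i) • e i) = ∑ i ∈ s, B x (e i) ^ 2 := by
    rw [map_sum]
    exact Finset.sum_congr rfl fun i _ => by rw [map_smul, smul_eq_mul, sq]
  have h2 : B (∑ i ∈ s, B x (e i) • e i) (∑ i ∈ s, B x (e i) • e i) = ∑ i ∈ s, B x (e i) ^ 2 := by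
    rw [h.apply_sum_sum]
    exact Finset.sum_congr rfl fun i _ => (sq _).symm
  rw [map_sub, map_sub, LinearMap.sub_apply, LinearMap.sub_apply, h2, h1,
    hB (∑ i ∈ s, B x (e i) • e i) x, h1]
  ring

lemma OrthonormalOn.bessel (h : OrthonormalOn B e s) (hB : ∀ x y, B x y = B y x)
    (hpos : ∀ x, 0 ≤ B x x) (x : M) : ∑ i ∈ s, B x (e i) ^ 2 ≤ B x x := by
  have := hpos (x - ∑ i ∈ s, B x (e i) • e i)
  rw [h.apply_sub_sub hB] at this
  linarith

end Bilinear

/-! ### The L² inner product of continuous functions and fields -/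

section Inner

variable {E : Type*} [NormedAddCommGroup E] [InnerProductSpace ℝ E]

lemma integrable_inner (u v : C(S2, E)) : Integrable (fun x => inner ℝ (u x) (v x)) surf :=
  integrable_of_continuous (u.continuous.inner v.continuous)

/-- The `L²` inner product of continuous functions on the sphere. -/
noncomputable def ip : C(S2, E) →ₗ[ℝ] C(S2, E) →ₗ[ℝ] ℝ :=
  LinearMap.mk₂ ℝ (fun u v => ∫ x, inner ℝ (u x) (v x) ∂surf)
    (fun u u' v => by
      simp only [ContinuousMap.add_apply, inner_add_left]
      exact integral_add (integrable_inner u v) (integrable_inner u' v))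
    (fun c u v => by
      simp only [ContinuousMap.smul_apply, inner_smul_left]
      exact integral_const_mul c _)
    (fun u v v' => by
      simp only [ContinuousMap.add_apply, inner_add_right]
      exact integral_add (integrable_inner u v) (integrable_inner u v'))
    (fun c u v => by
      simp only [ContinuousMap.smul_apply, inner_smul_right]
      exact integral_const_mul c _)

lemma ip_apply (u v : C(S2, E)) : ip u v = ∫ x, inner ℝ (u x) (v x) ∂surf := rfl

lemma ip_comm (u v : C(S2, E)) : ip u v = ip v u := by
  simp only [ip_apply, real_inner_comm]

lemma ip_self_nonneg (u : C(S2, E)) : 0 ≤ ip u u :=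
  integral_nonneg fun _ => real_inner_self_nonneg

lemma ip_self_eq (u : C(S2, E)) : ip u u = ∫ x, ‖u x‖ ^ 2 ∂surf := by
  simp only [ip_apply, real_inner_self_eq_norm_sq]

end Inner

/-! ### Surface gradients and surface curls of polynomials -/

section Fields

open MvPolynomial

lemma cross_zero (x y : E3) : cross x y 0 = x 1 * y 2 - x 2 * y 1 := by
  simp [cross, cross_apply]

lemma cross_one (x y : E3) : cross x y 1 = x 2 * y 0 - x 0 * y 2 := by
  simp [cross, cross_apply]

lemma cross_two (x y : E3) : cross x y 2 = x 0 * y 1 - x 1 * y 0 := by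
  simp [cross, cross_apply]

lemma ext3 {x y : E3} (h0 : x 0 = y 0) (h1 : x 1 = y 1) (h2 : x 2 = y 2) : x = y := by
  ext i
  fin_cases i <;> assumption

lemma inner_cross_self_left (x y : E3) : inner ℝ x (cross x y) = 0 := by
  simp only [inner_eq, cross_zero, cross_one, cross_two]
  ring

lemma inner_cross_comm (x y z : E3) : inner ℝ (cross x y) z = inner ℝ y (cross z x) := by
  simp only [inner_eq, cross_zero, cross_one, cross_two]
  ring

lemma cross_anticomm' (x y : E3) : cross x y = -cross y x := by
  apply ext3 <;> simp only [PiLp.neg_apply, cross_zero, cross_one, cross_two] <;> ring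

lemma cross_cross (x y z : E3) : cross x (cross y z) = inner ℝ x z • y - inner ℝ x y • z := by
  apply ext3 <;>
    simp only [PiLp.sub_apply, PiLp.smul_apply, smul_eq_mul, inner_eq, cross_zero, cross_one,
      cross_two] <;> ring

lemma inner_cross_cross (x y z : E3) : inner ℝ (cross x y) (cross x z) =
    inner ℝ x x * inner ℝ y z - inner ℝ x y * inner ℝ x z := by
  simp only [inner_eq, cross_zero, cross_one, cross_two]
  ring

/-- Expands (x × y)(x × y)ᵀ in v, x, y, which lets the divergence-free kernel be merged with the
curl-free one. -/
lemma inner_cross_smul_cross (x y v : E3) : inner ℝ (cross x y) v • cross x y =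
    (inner ℝ x x * inner ℝ y y - inner ℝ x y ^ 2) • v - (inner ℝ y y * inner ℝ x v) • x
      - (inner ℝ x x * inner ℝ y v) • y
      + inner ℝ x y • (inner ℝ y v • x + inner ℝ x v • y) := by
  apply ext3 <;>
    simp only [PiLp.sub_apply, PiLp.add_apply, PiLp.smul_apply, smul_eq_mul, inner_eq, cross_zero,
      cross_one, cross_two] <;> ring

lemma inner_self_sphere (x : S2) : inner ℝ (x : E3) (x : E3) = 1 := by
  rw [real_inner_self_eq_norm_sq, norm_sphere, one_pow]

/-- The surface curl of a polynomial. -/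
noncomputable def lcurl (p : Poly3) (x : E3) : E3 := WithLp.toLp 2 fun i => ev x (ang i p)

/-- The surface gradient of a polynomial. -/
noncomputable def lgrad (p : Poly3) (x : E3) : E3 := grad p x - inner ℝ x (grad p x) • x

lemma lcurl_apply (p : Poly3) (x : E3) (i : Fin 3) : lcurl p x i = ev x (ang i p) := rfl

lemma grad_apply (p : Poly3) (x : E3) (i : Fin 3) : grad p x i = ev x (pderiv i p) := rfl

lemma lcurl_eq (p : Poly3) (x : E3) : lcurl p x = cross x (grad p x) := by
  apply ext3 <;> simp only [cross_zero, cross_one, cross_two, lcurl_apply, grad_apply,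
    ang_zero_apply, ang_one_apply, ang_two_apply, map_sub, map_mul, ev_X]

lemma surfCurl_ev (p : Poly3) (x : E3) : surfCurl (fun y => ev y p) x = lcurl p x := by
  rw [surfCurl, gradient_ev, lcurl_eq]

lemma surfGrad_ev (p : Poly3) (x : E3) : surfGrad (fun y => ev y p) x = lgrad p x := by
  rw [surfGrad, gradient_ev, lgrad]

lemma inner_self_lcurl (p : Poly3) (x : E3) : inner ℝ x (lcurl p x) = 0 := by
  rw [lcurl_eq, inner_cross_self_left]

lemma inner_self_lgrad (p : Poly3) (x : S2) : inner ℝ (x : E3) (lgrad p x) = 0 := by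
  rw [lgrad, inner_sub_right, inner_smul_right, inner_self_sphere]
  ring

lemma lgrad_eq (p : Poly3) (x : S2) : lgrad p x = -cross x (lcurl p x) := by
  rw [lcurl_eq, cross_cross, inner_self_sphere, lgrad]
  simp

lemma inner_lcurl (p : Poly3) (x w : E3) : inner ℝ (lcurl p x) w = ev x (rot w.ofLp p) := by
  rw [inner_eq, rot_eq_ang]
  simp only [lcurl_apply, map_add, map_smul, smul_eq_mul]
  ring

lemma inner_lgrad (p : Poly3) (x : S2) (w : E3) :
    inner ℝ (lgrad p x) w = inner ℝ (lcurl p x) (cross x w) := by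
  rw [lgrad_eq, inner_neg_left, inner_cross_comm, cross_anticomm' w, inner_neg_right, neg_neg]

lemma inner_lgrad_lgrad (p q : Poly3) (x : S2) :
    inner ℝ (lgrad p x) (lgrad q x) = inner ℝ (lcurl p x) (lcurl q x) := by
  rw [lgrad_eq, lgrad_eq, inner_neg_neg, inner_cross_cross, inner_self_sphere, inner_self_lcurl]
  ring

lemma inner_lcurl_lgrad (p q : Poly3) (x : E3) :
    inner ℝ (lcurl p x) (lgrad q x) = inner ℝ (lcurl p x) (grad q x) := by
  rw [lgrad, inner_sub_right, inner_smul_right, real_inner_comm x (lcurl p x), inner_self_lcurl]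
  ring

lemma continuous_lcurl (p : Poly3) : Continuous fun x : S2 => lcurl p x :=
  (PiLp.continuous_toLp 2 _).comp (continuous_pi fun i => continuous_ev_sphere (ang i p))

lemma continuous_grad (p : Poly3) : Continuous fun x : S2 => grad p x :=
  (PiLp.continuous_toLp 2 _).comp (continuous_pi fun i => continuous_ev_sphere (pderiv i p))

lemma continuous_lgrad (p : Poly3) : Continuous fun x : S2 => lgrad p x :=
  (continuous_grad p).sub
    (Continuous.smul (f := fun x : S2 => inner ℝ (x : E3) (grad p x))
      (continuous_subtype_val.inner (continuous_grad p)) continuous_subtype_val)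

/-- The surface curl, as a linear map into the continuous vector fields. -/
noncomputable def curlF : Poly3 →ₗ[ℝ] C(S2, E3) where
  toFun p := ⟨fun x => lcurl p x, continuous_lcurl p⟩
  map_add' p q := by
    ext x i
    simp [lcurl]
  map_smul' c p := by
    ext x i
    simp [lcurl]

/-- The surface gradient, as a linear map into the continuous vector fields. -/
noncomputable def gradF : Poly3 →ₗ[ℝ] C(S2, E3) where
  toFun p := ⟨fun x => lgrad p x, continuous_lgrad p⟩
  map_add' p q := by
    ext x i
    simp [lgrad, grad, inner_eq]
    ring
  map_smul' c p := by
    ext x i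
    simp [lgrad, grad, inner_eq]
    ring

lemma curlF_apply (p : Poly3) (x : S2) : curlF p x = lcurl p x := rfl

lemma gradF_apply (p : Poly3) (x : S2) : gradF p x = lgrad p x := rfl

lemma curlF_sph_mul (q : Poly3) : curlF (sph * q) = 0 := by
  ext x i
  have : ang i sph = 0 := rot_sph _
  simp [curlF_apply, lcurl_apply, Derivation.leibniz, this]

lemma gradF_sph_mul (q : Poly3) : gradF (sph * q) = 0 := by
  ext1 x
  rw [gradF_apply, lgrad_eq, ← curlF_apply, curlF_sph_mul]
  apply ext3 <;> simp [cross_zero, cross_one, cross_two]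

/-- Green's formula: the inner product of two curls is the sum of products of angular derivatives,
integrated by parts. -/
lemma ip_curlF_curlF (p q : Poly3) : ip (curlF p) (curlF q) = -intS (p * lap q) := by
  have : -intS (p * lap q) = intS (∑ i, ang i p * ang i q) := by
    simp only [intS_ang_mul, lap_apply, mul_add, map_add, Fin.sum_univ_three]
    ring
  rw [this, ip_apply, intS_apply]
  congr 1
  ext x
  rw [curlF_apply, curlF_apply, inner_eq, Fin.sum_univ_three]
  simp [lcurl_apply]

lemma ip_gradF_gradF (p q : Poly3) : ip (gradF p) (gradF q) = -intS (p * lap q) := by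
  rw [← ip_curlF_curlF, ip_apply, ip_apply]
  simp only [curlF_apply, gradF_apply, inner_lgrad_lgrad]

/-- Moving the angular derivatives off p leaves ∑ᵢ Lᵢ ∂ᵢ q, which vanishes because partial
derivatives commute. -/
lemma ip_curlF_gradF (p q : Poly3) : ip (curlF p) (gradF q) = 0 := by
  have h0 : ∑ i, ang i (pderiv i q) = 0 := by
    simp only [Fin.sum_univ_three, ang_zero_apply, ang_one_apply, ang_two_apply]
    rw [pderiv_comm 2 0, pderiv_comm 1 0, pderiv_comm 2 1]
    ring
  have h1 : intS (∑ i, ang i p * pderiv i q) = 0 := by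
    simp only [map_sum, intS_ang_mul]
    rw [Finset.sum_neg_distrib, ← map_sum, ← Finset.mul_sum, h0]
    simp
  rw [← h1, ip_apply, intS_apply]
  congr 1
  ext x
  rw [curlF_apply, gradF_apply, inner_lcurl_lgrad, inner_eq, Fin.sum_univ_three]
  simp [lcurl_apply, grad_apply]

lemma ip_gradF_curlF (p q : Poly3) : ip (gradF p) (curlF q) = 0 := by
  rw [ip_comm, ip_curlF_gradF]

/-! ### Vector spherical harmonics -/

/-- The index set of the vector spherical harmonics: the degree, the order, and whether the field is
divergence-free. -/
abbrev VIdx : Type := Σ _ : ℕ, ℤ × Bool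

/-- The square root of the eigenvalue. -/
noncomputable def sqrtEig (l : ℕ) : ℝ := Real.sqrt ((l : ℝ) * ((l : ℝ) + 1))

lemma sqrtEig_sq (l : ℕ) : sqrtEig l ^ 2 = (l : ℝ) * (l + 1) := Real.sq_sqrt (by positivity)

lemma sqrtEig_pos {l : ℕ} (hl : 0 < l) : 0 < sqrtEig l := Real.sqrt_pos.2 (by positivity)

/-- The vector spherical harmonics. -/
noncomputable def vharm (i : VIdx) : C(S2, E3) :=
  (sqrtEig i.1)⁻¹ • if i.2.2 then curlF (harm i.1 i.2.1) else gradF (harm i.1 i.2.1)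

lemma vharm_true (l : ℕ) (m : ℤ) :
    vharm ⟨l, m, true⟩ = (sqrtEig l)⁻¹ • curlF (harm l m) := rfl

lemma vharm_false (l : ℕ) (m : ℤ) :
    vharm ⟨l, m, false⟩ = (sqrtEig l)⁻¹ • gradF (harm l m) := rfl

lemma vecY_eq (l : ℕ) (m : ℤ) (x : S2) : vecY l m x = vharm ⟨l, m, true⟩ x := by
  rw [vecY, sphHarm_eq, surfCurl_ev, vharm_true]
  rfl

lemma vecZ_eq (l : ℕ) (m : ℤ) (x : S2) : vecZ l m x = vharm ⟨l, m, false⟩ x := by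
  rw [vecZ, sphHarm_eq, surfGrad_ev, vharm_false]
  rfl

/-- The indices of the vector spherical harmonics of degree `n' < l ≤ n`. -/
noncomputable def vidx (n' n : ℕ) : Finset VIdx :=
  (Finset.Ioc n' n).sigma fun l => orders l ×ˢ Finset.univ

lemma mem_vidx {n' n : ℕ} {i : VIdx} :
    i ∈ vidx n' n ↔ (n' < i.1 ∧ i.1 ≤ n) ∧ i.2.1 ∈ orders i.1 := by
  simp [vidx]

lemma intS_harm_mul_lap (l l' : ℕ) (m m' : ℤ) :
    -intS (harm l m * lap (harm l' m')) = sqrtEig l' ^ 2 * intS (harm l m * harm l' m') := by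
  rw [(isEig_harm l' m').intS_mul_lap, sqrtEig_sq]
  ring

lemma orthonormalOn_vharm (n' n : ℕ) : OrthonormalOn ip vharm (vidx n' n) := by
  constructor
  · rintro ⟨l, m, b⟩ hi
    rw [mem_vidx] at hi
    have hl : sqrtEig l ≠ 0 := (sqrtEig_pos (lt_of_le_of_lt (Nat.zero_le _) hi.1.1)).ne'
    cases b
    · rw [vharm_false, map_smul, map_smul, LinearMap.smul_apply, ip_gradF_gradF, intS_harm_mul_lap,
        intS_harm_sq hi.2, smul_eq_mul, smul_eq_mul]
      field_simp
    · rw [vharm_true, map_smul, map_smul, LinearMap.smul_apply, ip_curlF_curlF, intS_harm_mul_lap,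
        intS_harm_sq hi.2, smul_eq_mul, smul_eq_mul]
      field_simp
  · rintro ⟨l, m, b⟩ - ⟨l', m', b'⟩ - hne
    have key : b = b' → intS (harm l m * harm l' m') = 0 := by
      rintro rfl
      by_cases hl : l = l'
      · subst hl
        refine intS_harm_mul_harm_of_order_ne l l fun hm => hne ?_
        rw [hm]
      · exact intS_harm_mul_harm_of_degree_ne m m' hl
    cases b <;> cases b'
    · rw [vharm_false, vharm_false, map_smul, map_smul, LinearMap.smul_apply, ip_gradF_gradF,
        intS_harm_mul_lap, key rfl]
      simp
    · rw [vharm_false, vharm_true, map_smul, map_smul, LinearMap.smul_apply, ip_gradF_curlF]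
      simp
    · rw [vharm_false, vharm_true, map_smul, map_smul, LinearMap.smul_apply, ip_curlF_gradF]
      simp
    · rw [vharm_true, vharm_true, map_smul, map_smul, LinearMap.smul_apply, ip_curlF_curlF,
        intS_harm_mul_lap, key rfl]
      simp

lemma inner_self_vharm (i : VIdx) (x : S2) : inner ℝ (x : E3) (vharm i x) = 0 := by
  obtain ⟨l, m, b⟩ := i
  cases b
  · rw [vharm_false, ContinuousMap.smul_apply, inner_smul_right, gradF_apply, inner_self_lgrad,
      mul_zero]
  · rw [vharm_true, ContinuousMap.smul_apply, inner_smul_right, curlF_apply, inner_self_lcurl,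
      mul_zero]

/-! ### A family of fields spanned by vector spherical harmonics -/

/-- The field `∇⁎ (κ (x ⬝ y) (v ⬝ x)) + L⁎ (κ (x ⬝ y) ((v × y) ⬝ x))`. -/
noncomputable def transField (κ : Polynomial ℝ) (y v : E3) : C(S2, E3) :=
  gradF (zon y κ * dotP v) + curlF (zon y κ * dotP (cross v y))

lemma grad_dotP (y x : E3) : grad (dotP y) x = y := by
  apply ext3 <;> simp [grad_apply, dotP]

lemma grad_zon_mul_dotP (κ : Polynomial ℝ) (y w x : E3) : grad (zon y κ * dotP w) x =
    ((Polynomial.derivative κ).eval (inner ℝ x y) * inner ℝ x w) • y +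
      κ.eval (inner ℝ x y) • w := by
  ext i
  rw [grad_apply, Derivation.leibniz, zon, Derivation.map_aeval, ← zon]
  have h : ∀ y : E3, ev x (pderiv i (dotP y)) = y i := fun y => by
    rw [← grad_apply, grad_dotP]
  simp [h]
  ring

/-- For v tangential at y the gradient and curl parts combine into one scalar profile κ - (1-t)κ'
times a fixed field. The kernel has the same form in `kerVec_sphere`. -/
lemma transField_apply (κ : Polynomial ℝ) (y : S2) {v : E3} (hv : inner ℝ (y : E3) v = 0) (x : S2) :
    transField κ y v x = (κ - (1 - Polynomial.X) * Polynomial.derivative κ).eval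
        (inner ℝ (x : E3) (y : E3)) •
      ((1 + inner ℝ (x : E3) (y : E3)) • v - inner ℝ (x : E3) v • ((x : E3) + (y : E3))) := by
  have hx := inner_self_sphere x
  have hy := inner_self_sphere y
  rw [transField, ContinuousMap.add_apply, gradF_apply, curlF_apply, lcurl_eq, lgrad,
    grad_zon_mul_dotP, grad_zon_mul_dotP]
  set t := inner ℝ (x : E3) (y : E3) with ht
  set a := κ.eval t
  set b := (Polynomial.derivative κ).eval t
  have e1 : cross (x : E3) ((b * inner ℝ (x : E3) (cross v y)) • (y : E3) + a • cross v y) =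
      -b • (inner ℝ (cross (x : E3) (y : E3)) v • cross (x : E3) (y : E3)) +
        a • cross x (cross v y) := by
    apply ext3 <;> simp only [PiLp.add_apply, PiLp.smul_apply, smul_eq_mul, cross_zero, cross_one,
      cross_two, inner_eq] <;> ring
  rw [e1, inner_cross_smul_cross, cross_cross, hx, hy, hv, inner_add_right, inner_smul_right,
    inner_smul_right, ← ht]
  simp only [Polynomial.eval_sub, Polynomial.eval_mul, Polynomial.eval_one, Polynomial.eval_X]
  change _ = (a - (1 - t) * b) • _
  module

lemma ip_transField_curlF (κ : Polynomial ℝ) (y v : E3) {μ : ℝ} {F : Poly3} (hF : IsEig μ F) :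
    ip (transField κ y v) (curlF F) = μ * intS (zon y κ * dotP (cross v y) * F) := by
  rw [transField, map_add, LinearMap.add_apply, ip_gradF_curlF, ip_curlF_curlF, hF.intS_mul_lap]
  ring

lemma ip_transField_gradF (κ : Polynomial ℝ) (y v : E3) {μ : ℝ} {F : Poly3} (hF : IsEig μ F) :
    ip (transField κ y v) (gradF F) = μ * intS (zon y κ * dotP v * F) := by
  rw [transField, map_add, LinearMap.add_apply, ip_curlF_gradF, ip_gradF_gradF, hF.intS_mul_lap]
  ring

lemma rot_dotP (w : E3) (y : E3) : rot w.ofLp (dotP y) = dotP (cross y w) := by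
  rw [rot_apply]
  simp [dotP, cross_zero, cross_one, cross_two]
  ring

/-- The Funk-Hecke formula for the transport fields. -/
lemma ip_transField_derivative {l : ℕ} (G : Polynomial ℝ) (y : S2) {v : E3}
    (hv : inner ℝ (y : E3) v = 0) {F : Poly3} (hF : IsEig ((l : ℝ) * (l + 1)) F) :
    ip (transField (Polynomial.derivative G) y v) (curlF F) =
        -(2 * Real.pi * int1 (legOp G * legendre l)) * inner ℝ v (curlF F y) ∧
      ip (transField (Polynomial.derivative G) y v) (gradF F) =
        -(2 * Real.pi * int1 (legOp G * legendre l)) * inner ℝ v (gradF F y) := by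
  -- The factor G'(x·y) ((y × w)·x) is an infinitesimal rotation of G(x·y). It is moved onto F,
  -- which stays an eigenfunction of the same degree, and Funk–Hecke applies.
  have key : ∀ w : E3, intS (zon y (Polynomial.derivative G) * dotP (cross y w) * F) =
      -(2 * Real.pi * int1 (G * legendre l) * ev (y : E3) (rot w.ofLp F)) := by
    intro w
    rw [← rot_dotP, ← rot_zon, intS_rot_mul, funkHecke (hF.rot _)]
  rw [int1_legOp_mul_legendre, ip_transField_curlF _ _ _ hF, ip_transField_gradF _ _ _ hF,
    curlF_apply, gradF_apply, real_inner_comm, inner_lcurl, real_inner_comm, inner_lgrad]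
  constructor
  · have e : cross v (y : E3) = cross (y : E3) (-v) := by
      apply ext3 <;> simp only [PiLp.neg_apply, cross_zero, cross_one, cross_two] <;> ring
    rw [e, key]
    have : rot (-v).ofLp F = -rot v.ofLp F := by
      rw [rot_eq_ang, rot_eq_ang]
      simp only [PiLp.neg_apply]
      module
    rw [this, map_neg]
    ring
  -- For v tangential at y a double cross product with y returns -v, so the gradient case is an
  -- instance of `key`.
  · have e : v = cross (y : E3) (-cross (y : E3) v) := by
      have := cross_cross (y : E3) (y : E3) v
      rw [hv, inner_self_sphere] at this
      have h2 : cross (y : E3) (-cross (y : E3) v) = -cross (y : E3) (cross (y : E3) v) := by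
        apply ext3 <;> simp only [PiLp.neg_apply, cross_zero, cross_one, cross_two] <;> ring
      rw [h2, this]
      simp
    have h3 := key (-cross (y : E3) v)
    rw [← e] at h3
    rw [h3, inner_lcurl]
    have : rot (-cross (y : E3) v).ofLp F = -rot (cross (y : E3) v).ofLp F := by
      rw [rot_eq_ang, rot_eq_ang]
      simp only [PiLp.neg_apply]
      module
    rw [this, map_neg]
    ring

lemma exists_derivative_eq (p : Polynomial ℝ) : ∃ q, Polynomial.derivative q = p := by
  induction p using Polynomial.induction_on' with
  | add p q hp hq =>
    obtain ⟨a, rfl⟩ := hp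
    obtain ⟨b, rfl⟩ := hq
    exact ⟨a + b, Polynomial.derivative_add⟩
  | monomial n a =>
    refine ⟨Polynomial.monomial (n + 1) (a / (n + 1)), ?_⟩
    rw [Polynomial.derivative_monomial, Nat.add_sub_cancel]
    congr 1
    push_cast
    field_simp

/-- The left-hand side is the derivative of (X - 1) κ, so κ is the primitive of k that vanishes at
1, divided by X - 1. -/
lemma exists_sub_mul_derivative_eq (k : Polynomial ℝ) :
    ∃ κ : Polynomial ℝ, κ - (1 - Polynomial.X) * Polynomial.derivative κ = k := by
  obtain ⟨A, hA⟩ := exists_derivative_eq k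
  obtain ⟨κ, hκ⟩ := Polynomial.dvd_iff_isRoot.2
    (show (A - Polynomial.C (A.eval 1)).IsRoot 1 by simp)
  refine ⟨κ, ?_⟩
  have := congrArg Polynomial.derivative hκ
  rw [Polynomial.derivative_mul, Polynomial.derivative_sub, hA] at this
  simp at this
  rw [this]
  ring

/-- A continuous tangential field orthogonal to all vector spherical harmonics vanishes. -/
lemma eq_zero_of_vharm {u : C(S2, E3)} (hu : IsTangential u)
    (h : ∀ l, 0 < l → ∀ m ∈ orders l, ∀ b, ip u (vharm ⟨l, m, b⟩) = 0) : u = 0 := by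
  -- Degree 0 harmonics are constants and give zero fields, so testing degrees l ≥ 1 suffices.
  have h00 : ∀ m ∈ orders 0, ∃ c, harm 0 m = C c := by
    intro m hm
    have : m = 0 := by have := mem_orders.1 hm; omega
    subst this
    refine ⟨normC 0 0, ?_⟩
    simp [harm, legD_zero, legendre, azim, zeta, MvPolynomial.smul_eq_C_mul]
  have hc : ip u ∘ₗ curlF = 0 := by
    refine eq_zero_of_harm (fun l m hm => ?_) fun q => by simp [curlF_sph_mul]
    rcases Nat.eq_zero_or_pos l with rfl | hl
    · obtain ⟨c, hc⟩ := h00 m hm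
      have : curlF (C c) = 0 := by
        ext x i
        simp [curlF_apply, lcurl_apply]
      simp [hc, this]
    · have := h l hl m hm true
      rw [vharm_true, map_smul, smul_eq_mul] at this
      exact (mul_eq_zero.1 this).resolve_left (inv_ne_zero (sqrtEig_pos hl).ne')
  have hg : ip u ∘ₗ gradF = 0 := by
    refine eq_zero_of_harm (fun l m hm => ?_) fun q => by simp [gradF_sph_mul]
    rcases Nat.eq_zero_or_pos l with rfl | hl
    · obtain ⟨c, hc⟩ := h00 m hm
      have : gradF (C c) = 0 := by
        ext x i
        have : grad (C c) (x : E3) = 0 := by ext j; simp [grad_apply]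
        simp [gradF_apply, lgrad, this]
      simp [hc, this]
    · have := h l hl m hm false
      rw [vharm_false, map_smul, smul_eq_mul] at this
      exact (mul_eq_zero.1 this).resolve_left (inv_ne_zero (sqrtEig_pos hl).ne')
  have hT : ∀ κ y v, ip u (transField κ y v) = 0 := by
    intro κ y v
    rw [transField, map_add]
    have h1 := LinearMap.congr_fun hg (zon y κ * dotP v)
    have h2 := LinearMap.congr_fun hc (zon y κ * dotP (cross v y))
    simp only [LinearMap.comp_apply, LinearMap.zero_apply] at h1 h2
    rw [h1, h2, add_zero]
  ext1 y
  set v := u y with hv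
  have hvy : inner ℝ (y : E3) v = 0 := hu y
  -- Orthogonality to the fields with profile `peak n` says that g integrates to zero against powers
  -- of (1 + x·y)/2. Concentration then gives g(y) = 0, while g(y) = 2 |u(y)|².
  let g : S2 → ℝ := fun x => inner ℝ (u x)
    ((1 + inner ℝ (x : E3) (y : E3)) • v - inner ℝ (x : E3) v • ((x : E3) + (y : E3)))
  have hgc : Continuous g := by
    refine u.continuous.inner (((continuous_const.add (continuous_inner_sphere _)).smul
      continuous_const).sub ((continuous_inner_sphere _).smul
      (continuous_subtype_val.add continuous_const)))
  have hlim := tendsto_peak y hgc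
  have hzero : ∀ n : ℕ, ∫ x : S2, ((1 + inner ℝ (x : E3) (y : E3)) / 2) ^ n * g x ∂surf = 0 := by
    intro n
    obtain ⟨κ, hκ⟩ := exists_sub_mul_derivative_eq (peak n)
    rw [← hT κ y v, ip_apply]
    congr 1
    ext x
    rw [transField_apply κ y hvy, hκ, inner_smul_right]
    congr 1
    rw [peak]
    simp
    rw [mul_comm, div_eq_mul_inv, mul_pow]
  simp only [hzero, mul_zero] at hlim
  have h1 := tendsto_nhds_unique hlim tendsto_const_nhds
  have h2 : g y = 2 * ‖v‖ ^ 2 := by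
    simp only [g, ← hv, inner_sub_right, inner_smul_right, inner_add_right, hvy,
      real_inner_self_eq_norm_sq, norm_sphere]
    ring
  rw [h2] at h1
  simpa using h1

end Fields

/-! ### Pointwise bounds for vector spherical harmonics -/

section Bounds

/-- Restriction of polynomials to the sphere. -/
noncomputable def polyF : Poly3 →ₗ[ℝ] C(S2, ℝ) where
  toFun p := ⟨fun x => ev (x : E3) p, continuous_ev_sphere p⟩
  map_add' p q := by ext x; simp
  map_smul' c p := by ext x; simp

lemma polyF_apply (p : Poly3) (x : S2) : polyF p x = ev (x : E3) p := rfl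

lemma ip_polyF (p q : Poly3) : ip (polyF p) (polyF q) = intS (p * q) := by
  rw [ip_apply, intS_apply]
  congr 1
  ext x
  simp [polyF_apply, mul_comm]

/-- The scalar spherical harmonics on the sphere, indexed by degree and order. -/
noncomputable def sharm (i : Σ _ : ℕ, ℤ) : C(S2, ℝ) := polyF (harm i.1 i.2)

lemma orthonormalOn_sharm (L : Finset ℕ) : OrthonormalOn ip sharm (L.sigma orders) := by
  constructor
  · rintro ⟨l, m⟩ hi
    rw [Finset.mem_sigma] at hi
    rw [sharm, ip_polyF, intS_harm_sq hi.2]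
  · rintro ⟨l, m⟩ - ⟨l', m'⟩ - hne
    rw [sharm, sharm, ip_polyF]
    by_cases hl : l = l'
    · subst hl
      refine intS_harm_mul_harm_of_order_ne l l fun hm => hne ?_
      rw [show m = m' from hm]
    · exact intS_harm_mul_harm_of_degree_ne m m' hl

lemma bessel_sharm (h : C(S2, ℝ)) (L : Finset ℕ) :
    ∑ l ∈ L, ∑ m ∈ orders l, ip h (sharm ⟨l, m⟩) ^ 2 ≤ ip h h := by
  have := (orthonormalOn_sharm L).bessel ip_comm ip_self_nonneg h
  rwa [Finset.sum_sigma] at this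

/-- Bessel's inequality for an infinitesimal rotation of P_l(x·y): by Funk–Hecke its coefficients
are multiples of the rotated harmonics at y, and its norm is at most ‖w‖ times that of the surface
curl of P_l(x·y). -/
lemma sum_sq_rot_harm_le (l : ℕ) (y : S2) (w : E3) :
    ∑ m ∈ orders l, ev (y : E3) (rot w.ofLp (harm l m)) ^ 2 ≤
      (2 * l + 1) / (4 * Real.pi) * (l * (l + 1)) * ‖w‖ ^ 2 := by
  set Z := zon y (legendre l) with hZ
  have hπ := Real.pi_pos
  have hb : 2 * Real.pi * int1 (legendre l * legendre l) = 4 * Real.pi / (2 * l + 1) := by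
    rw [← sq, int1_legendre_sq]; ring
  have h1 : ∀ m, ip (polyF (rot w.ofLp Z)) (sharm ⟨l, m⟩) =
      -(4 * Real.pi / (2 * l + 1) * ev (y : E3) (rot w.ofLp (harm l m))) := by
    intro m
    rw [sharm, ip_polyF, intS_rot_mul, funkHecke ((isEig_harm l m).rot _), hb]
  have h2 := bessel_sharm (polyF (rot w.ofLp Z)) {l}
  rw [Finset.sum_singleton] at h2
  simp only [h1, neg_sq, mul_pow, ← Finset.mul_sum] at h2
  have h3 : ip (polyF (rot w.ofLp Z)) (polyF (rot w.ofLp Z)) ≤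
      ‖w‖ ^ 2 * ((l * (l + 1)) * (4 * Real.pi / (2 * l + 1))) := by
    have h4 : ip (curlF Z) (curlF Z) = (l * (l + 1)) * (4 * Real.pi / (2 * l + 1)) := by
      rw [ip_curlF_curlF, (isEig_zon_legendre y l).intS_mul_lap, ← map_mul, intS_zon, hb]
      ring
    rw [← h4, ip_self_eq, ip_self_eq, ← integral_const_mul]
    refine integral_mono (integrable_of_continuous (by fun_prop))
      (integrable_of_continuous (by fun_prop)) fun x => ?_
    simp only [polyF_apply, ← inner_lcurl, curlF_apply]
    rw [← mul_pow]
    refine pow_le_pow_left₀ (norm_nonneg _) ?_ 2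
    rw [mul_comm]
    exact norm_inner_le_norm _ _
  have h5 := h2.trans h3
  have hl : (0 : ℝ) < 2 * l + 1 := by positivity
  rw [← mul_le_mul_iff_right₀ (show 0 < (4 * Real.pi / (2 * (l : ℝ) + 1)) ^ 2 by positivity)]
  refine h5.trans (le_of_eq ?_)
  field_simp

/-- The curl harmonics pair with w as its infinitesimal rotation, the gradient harmonics as that of
y × w, whose length is at most that of w. -/
lemma sum_sq_inner_vharm_le {l : ℕ} (hl : 0 < l) (y : S2) (w : E3) :
    ∑ m ∈ orders l, ∑ b : Bool, inner ℝ (vharm ⟨l, m, b⟩ y) w ^ 2 ≤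
      (2 * l + 1) / (2 * Real.pi) * ‖w‖ ^ 2 := by
  have hπ := Real.pi_pos
  have hl' : (0 : ℝ) < l := by exact_mod_cast hl
  have h1 := sum_sq_rot_harm_le l y w
  have h2 := sum_sq_rot_harm_le l y (cross (y : E3) w)
  have h3 : ‖cross (y : E3) w‖ ^ 2 ≤ ‖w‖ ^ 2 := by
    rw [← real_inner_self_eq_norm_sq, ← real_inner_self_eq_norm_sq, inner_cross_cross,
      inner_self_sphere]
    nlinarith [sq_nonneg (inner ℝ (y : E3) w)]
  have h4 : ∀ m, ∑ b : Bool, inner ℝ (vharm ⟨l, m, b⟩ y) w ^ 2 =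
      ((l : ℝ) * (l + 1))⁻¹ * (ev (y : E3) (rot w.ofLp (harm l m)) ^ 2 +
        ev (y : E3) (rot (cross (y : E3) w).ofLp (harm l m)) ^ 2) := by
    intro m
    rw [Fintype.sum_bool, vharm_true, vharm_false, ContinuousMap.smul_apply,
      ContinuousMap.smul_apply, real_inner_smul_left, real_inner_smul_left, curlF_apply,
      gradF_apply, inner_lgrad, inner_lcurl, inner_lcurl, mul_pow, mul_pow, inv_pow, sqrtEig_sq]
    ring
  simp only [h4, ← Finset.mul_sum, Finset.sum_add_distrib]
  rw [inv_mul_le_iff₀ (by positivity)]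
  have h5 : (2 * (l : ℝ) + 1) / (4 * Real.pi) * (l * (l + 1)) * ‖cross (y : E3) w‖ ^ 2 ≤
      (2 * l + 1) / (4 * Real.pi) * (l * (l + 1)) * ‖w‖ ^ 2 := by gcongr
  refine (add_le_add h1 (h2.trans h5)).trans (le_of_eq ?_)
  field_simp
  ring

lemma onePlusEig_pos (l : ℕ) : 0 < onePlusEig l := by unfold onePlusEig; positivity

/-- The terms of the series that controls the embedding into continuous functions. -/
noncomputable def embTerm (s : ℝ) (l : ℕ) : ℝ :=
  (2 * l + 1) / (2 * Real.pi) * onePlusEig l ^ (-s)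

lemma embTerm_nonneg (s : ℝ) (l : ℕ) : 0 ≤ embTerm s l :=
  mul_nonneg (div_nonneg (by positivity) (by positivity)) (Real.rpow_nonneg (onePlusEig_pos l).le _)

/-- The terms are of order l^(1-2s); this is where s > 1 enters. -/
lemma summable_embTerm {s : ℝ} (hs : 1 < s) : Summable (embTerm s) := by
  have h1 : Summable fun l : ℕ => 3 / (2 * Real.pi) * (l : ℝ) ^ (1 - 2 * s) :=
    (Real.summable_nat_rpow.2 (by linarith)).mul_left _
  rw [← summable_nat_add_iff 1] at h1 ⊢
  refine Summable.of_nonneg_of_le (fun l => embTerm_nonneg _ _) (fun l => ?_) h1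
  have hl : (1 : ℝ) ≤ ((l + 1 : ℕ) : ℝ) := by exact_mod_cast Nat.succ_pos l
  set x : ℝ := ((l + 1 : ℕ) : ℝ) with hx
  have hπ := Real.pi_pos
  have h2 : onePlusEig (l + 1) ^ (-s) ≤ x ^ (-(2 * s)) := by
    rw [show -(2 * s) = (2 : ℝ) * -s by ring, Real.rpow_mul (by linarith)]
    refine Real.rpow_le_rpow_of_nonpos (by positivity) ?_ (by linarith)
    simp only [onePlusEig, ← hx, Real.rpow_two]
    nlinarith
  have h3 : x ^ (1 - 2 * s) = x * x ^ (-(2 * s)) := by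
    rw [show 1 - 2 * s = 1 + -(2 * s) by ring, Real.rpow_add (by linarith), Real.rpow_one]
  rw [h3, embTerm, ← hx]
  calc (2 * x + 1) / (2 * Real.pi) * onePlusEig (l + 1) ^ (-s)
      ≤ (3 * x) / (2 * Real.pi) * x ^ (-(2 * s)) := by
        gcongr
        · exact Real.rpow_nonneg (onePlusEig_pos _).le _
        · linarith
    _ = 3 / (2 * Real.pi) * (x * x ^ (-(2 * s))) := by ring

/-- The square of the norm of the embedding of the Sobolev space into the continuous functions. -/
noncomputable def embConst (s : ℝ) : ℝ := ∑' l, embTerm s l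

lemma embConst_nonneg (s : ℝ) : 0 ≤ embConst s := tsum_nonneg (embTerm_nonneg s)

/-- Sobolev embedding for finite expansions: pair F(x) with itself, split the weights by
Cauchy–Schwarz, and bound the harmonics at x by `sum_sq_inner_vharm_le`. -/
lemma norm_sq_sum_vharm_le {s : ℝ} (hs : 1 < s) (c : VIdx → ℝ) (n' n : ℕ) (x : S2) :
    ‖(∑ i ∈ vidx n' n, c i • vharm i) x‖ ^ 2 ≤
      embConst s * ∑ l ∈ Finset.Ioc n' n, onePlusEig l ^ s *
        ∑ m ∈ orders l, ∑ b : Bool, c ⟨l, m, b⟩ ^ 2 := by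
  set F := (∑ i ∈ vidx n' n, c i • vharm i) x with hF
  set A := ∑ l ∈ Finset.Ioc n' n, onePlusEig l ^ s *
        ∑ m ∈ orders l, ∑ b : Bool, c ⟨l, m, b⟩ ^ 2 with hA
  have hpow : ∀ l, 0 < onePlusEig l ^ s := fun l => Real.rpow_pos_of_pos (onePlusEig_pos l) _
  have h1 : ‖F‖ ^ 2 = ∑ i ∈ vidx n' n, (onePlusEig i.1 ^ (s / 2) * c i) *
      (onePlusEig i.1 ^ (-s / 2) * inner ℝ (vharm i x) F) := by
    have e : F = ∑ i ∈ vidx n' n, c i • vharm i x := by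
      rw [hF, ContinuousMap.sum_apply]
      rfl
    rw [← real_inner_self_eq_norm_sq]
    nth_rewrite 1 [e]
    rw [sum_inner]
    refine Finset.sum_congr rfl fun i _ => ?_
    rw [real_inner_smul_left]
    have : onePlusEig i.1 ^ (s / 2) * onePlusEig i.1 ^ (-s / 2) = 1 := by
      rw [← Real.rpow_add (onePlusEig_pos _)]
      ring_nf
      exact Real.rpow_zero _
    linear_combination (-c i * inner ℝ (vharm i x) F) * this
  have hsq : ∀ (l : ℕ) (r a : ℝ), (onePlusEig l ^ (r / 2) * a) ^ 2 = onePlusEig l ^ r * a ^ 2 := by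
    intro l r a
    rw [mul_pow, ← Real.rpow_natCast, ← Real.rpow_mul (onePlusEig_pos l).le]
    norm_num
  have h2 := Finset.sum_mul_sq_le_sq_mul_sq (vidx n' n) (fun i => onePlusEig i.1 ^ (s / 2) * c i)
    (fun i => onePlusEig i.1 ^ (-s / 2) * inner ℝ (vharm i x) F)
  rw [← h1] at h2
  have h3 : ∑ i ∈ vidx n' n, (onePlusEig i.1 ^ (s / 2) * c i) ^ 2 = A := by
    simp only [hsq]
    rw [vidx, Finset.sum_sigma, hA]
    refine Finset.sum_congr rfl fun l _ => ?_
    rw [Finset.sum_product, Finset.mul_sum]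
    exact Finset.sum_congr rfl fun m _ => by rw [Finset.mul_sum]
  have h4 : ∑ i ∈ vidx n' n, (onePlusEig i.1 ^ (-s / 2) * inner ℝ (vharm i x) F) ^ 2 ≤
      embConst s * ‖F‖ ^ 2 := by
    simp only [hsq]
    rw [vidx, Finset.sum_sigma]
    calc _ ≤ ∑ l ∈ Finset.Ioc n' n, embTerm s l * ‖F‖ ^ 2 := by
          refine Finset.sum_le_sum fun l hl => ?_
          rw [Finset.sum_product]
          have h5 := sum_sq_inner_vharm_le (lt_of_le_of_lt (Nat.zero_le _)
            (Finset.mem_Ioc.1 hl).1) x F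
          have h6 := mul_le_mul_of_nonneg_left h5 (Real.rpow_nonneg (onePlusEig_pos l).le (-s))
          refine le_trans (le_of_eq ?_) (h6.trans (le_of_eq ?_))
          · simp only [Finset.mul_sum]
          · rw [embTerm]; ring
      _ = (∑ l ∈ Finset.Ioc n' n, embTerm s l) * ‖F‖ ^ 2 := (Finset.sum_mul _ _ _).symm
      _ ≤ embConst s * ‖F‖ ^ 2 := by
          gcongr
          exact (summable_embTerm hs).sum_le_tsum _ fun l _ => embTerm_nonneg s l
  have hA0 : 0 ≤ A := by
    rw [← h3]
    exact Finset.sum_nonneg fun _ _ => sq_nonneg _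
  -- The bound F² · F² ≤ const · F² is divided by ‖F‖², so the value zero is treated apart.
  rcases eq_or_lt_of_le (norm_nonneg F) with h0 | h0
  · rw [← h0]
    have := mul_nonneg (embConst_nonneg s) hA0
    simpa using this
  · have h7 : ‖F‖ ^ 2 * ‖F‖ ^ 2 ≤ embConst s * A * ‖F‖ ^ 2 := by
      calc ‖F‖ ^ 2 * ‖F‖ ^ 2 = (‖F‖ ^ 2) ^ 2 := (sq _).symm
        _ ≤ _ := h2
        _ ≤ A * (embConst s * ‖F‖ ^ 2) := by
            rw [h3]
            exact mul_le_mul_of_nonneg_left h4 hA0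
        _ = _ := by ring
    exact le_of_mul_le_mul_right h7 (by positivity)

/-! ### Expansion of vector fields -/

/-- The sum of the squares of the Fourier coefficients of degree `l`. -/
noncomputable def vpow (u : C(S2, E3)) (l : ℕ) : ℝ :=
  ∑ m ∈ orders l, ∑ b : Bool, ip u (vharm ⟨l, m, b⟩) ^ 2

lemma vpow_nonneg (u : C(S2, E3)) (l : ℕ) : 0 ≤ vpow u l :=
  Finset.sum_nonneg fun _ _ => Finset.sum_nonneg fun _ _ => sq_nonneg _

lemma coeffDiv_eq (u : C(S2, E3)) (l : ℕ) (m : ℤ) :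
    coeffDiv u l m = ip u (vharm ⟨l, m, true⟩) := by
  simp only [coeffDiv, vecY_eq, ip_apply]

lemma coeffCurl_eq (u : C(S2, E3)) (l : ℕ) (m : ℤ) :
    coeffCurl u l m = ip u (vharm ⟨l, m, false⟩) := by
  simp only [coeffCurl, vecZ_eq, ip_apply]

lemma vecSobTerm_eq (s : ℝ) (u : C(S2, E3)) (l : ℕ) :
    vecSobTerm s u l = onePlusEig l ^ s * vpow u l := by
  simp only [vecSobTerm, coeffDiv_eq, coeffCurl_eq, vpow, Fintype.sum_bool]

/-- The weighted squares of the Fourier coefficients of degree `l`. -/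
noncomputable def wpow (s : ℝ) (u : C(S2, E3)) (l : ℕ) : ℝ := onePlusEig l ^ s * vpow u l

lemma wpow_nonneg (s : ℝ) (u : C(S2, E3)) (l : ℕ) : 0 ≤ wpow s u l :=
  mul_nonneg (Real.rpow_nonneg (onePlusEig_pos l).le _) (vpow_nonneg u l)

/-- The square of the vectorial Sobolev norm. -/
noncomputable def sobSq (s : ℝ) (u : C(S2, E3)) : ℝ := ∑' l : ℕ, wpow s u (l + 1)

lemma sobSq_nonneg (s : ℝ) (u : C(S2, E3)) : 0 ≤ sobSq s u :=
  tsum_nonneg fun _ => wpow_nonneg s u _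

/-- The partial sums of the expansion in vector spherical harmonics. -/
noncomputable def vproj (n : ℕ) (u : C(S2, E3)) : C(S2, E3) :=
  ∑ i ∈ vidx 0 n, ip u (vharm i) • vharm i

lemma vproj_sub_vproj {n' n : ℕ} (h : n' ≤ n) (u : C(S2, E3)) :
    vproj n u - vproj n' u = ∑ i ∈ vidx n' n, ip u (vharm i) • vharm i := by
  have hd : Disjoint (vidx 0 n') (vidx n' n) := by
    rw [Finset.disjoint_left]
    intro i hi hi'
    rw [mem_vidx] at hi hi'
    omega
  have hu : vidx 0 n = vidx 0 n' ∪ vidx n' n := by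
    ext i
    rw [Finset.mem_union, mem_vidx, mem_vidx, mem_vidx]
    by_cases h1 : i.2.1 ∈ orders i.1
    · simp only [h1, and_true]; omega
    · simp [h1]
  rw [vproj, vproj, hu, Finset.sum_union hd]
  abel

lemma sum_Ioc_wpow_le {s : ℝ} {u : C(S2, E3)} (hu : Summable fun l : ℕ => wpow s u (l + 1))
    (n' n : ℕ) : ∑ l ∈ Finset.Ioc n' n, wpow s u l ≤ ∑' l : ℕ, wpow s u (l + n' + 1) := by
  have h1 : Summable fun l : ℕ => wpow s u (l + n' + 1) :=
    (summable_nat_add_iff (f := fun l : ℕ => wpow s u (l + 1)) n').2 hu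
  have h2 : ∑ l ∈ Finset.Ioc n' n, wpow s u l =
      ∑ l ∈ Finset.range (n - n'), wpow s u (l + n' + 1) := by
    rw [Finset.range_eq_Ico, Finset.sum_Ico_add' (fun l => wpow s u (l + 1))]
    rw [Finset.sum_Ico_add' (fun l => wpow s u l)]
    refine Finset.sum_congr ?_ fun _ _ => rfl
    ext l
    simp only [Finset.mem_Ioc, Finset.mem_Ico]
    omega
  rw [h2]
  exact h1.sum_le_tsum _ fun l _ => wpow_nonneg s u _

lemma norm_sq_vproj_sub_le {s : ℝ} (hs : 1 < s) {u : C(S2, E3)}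
    (hu : Summable fun l : ℕ => wpow s u (l + 1)) {n' n : ℕ} (h : n' ≤ n) (x : S2) :
    ‖(vproj n u - vproj n' u) x‖ ^ 2 ≤
      embConst s * ∑' l : ℕ, wpow s u (l + n' + 1) := by
  rw [vproj_sub_vproj h]
  refine (norm_sq_sum_vharm_le hs _ n' n x).trans ?_
  exact mul_le_mul_of_nonneg_left (sum_Ioc_wpow_le hu n' n) (embConst_nonneg s)

lemma continuous_ip {E : Type*} [NormedAddCommGroup E] [InnerProductSpace ℝ E] :
    Continuous fun p : C(S2, E) × C(S2, E) => ip p.1 p.2 := by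
  have h : ∀ u v : C(S2, E), ‖ip u v‖ ≤ surf.real Set.univ * ‖u‖ * ‖v‖ := by
    intro u v
    rw [ip_apply]
    refine (norm_integral_le_of_norm_le_const (C := ‖u‖ * ‖v‖)
      (Filter.Eventually.of_forall fun x => ?_)).trans (le_of_eq (by ring))
    exact (norm_inner_le_norm _ _).trans
      (mul_le_mul (u.norm_coe_le_norm x) (v.norm_coe_le_norm x) (norm_nonneg _) (norm_nonneg _))
  exact (LinearMap.mkContinuous₂ (ip : C(S2, E) →ₗ[ℝ] C(S2, E) →ₗ[ℝ] ℝ) (surf.real Set.univ)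
    h).continuous₂

lemma continuous_ip_left {E : Type*} [NormedAddCommGroup E] [InnerProductSpace ℝ E]
    (v : C(S2, E)) : Continuous fun u : C(S2, E) => ip u v :=
  continuous_ip.comp (continuous_id.prodMk continuous_const)

lemma ip_vproj {u : C(S2, E3)} {n : ℕ} {i : VIdx} (hi : i ∈ vidx 0 n) :
    ip (vproj n u) (vharm i) = ip u (vharm i) :=
  (orthonormalOn_vharm 0 n).apply_sum_left (fun i => ip u (vharm i)) hi

lemma inner_self_vproj (n : ℕ) (u : C(S2, E3)) (x : S2) : inner ℝ (x : E3) (vproj n u x) = 0 := by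
  rw [vproj, ContinuousMap.sum_apply, inner_sum]
  refine Finset.sum_eq_zero fun i _ => ?_
  rw [ContinuousMap.smul_apply, inner_smul_right, inner_self_vharm, mul_zero]

/-- The expansion of a continuous field of Sobolev class converges uniformly to the field. -/
lemma tendsto_vproj {s : ℝ} (hs : 1 < s) {u : C(S2, E3)} (ht : IsTangential u)
    (hu : Summable fun l : ℕ => wpow s u (l + 1)) :
    Filter.Tendsto (fun n => vproj n u) Filter.atTop (nhds u) := by
  have htail : Filter.Tendsto (fun n : ℕ => Real.sqrt (embConst s *
      ∑' l : ℕ, wpow s u (l + n + 1))) Filter.atTop (nhds 0) := by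
    have h1 := tendsto_sum_nat_add fun l : ℕ => wpow s u (l + 1)
    have h2 := (h1.const_mul (embConst s)).sqrt
    simpa using h2
  have hdist : ∀ n' n : ℕ, n' ≤ n → dist (vproj n u) (vproj n' u) ≤
      Real.sqrt (embConst s * ∑' l : ℕ, wpow s u (l + n' + 1)) := by
    intro n' n h
    rw [dist_eq_norm, ContinuousMap.norm_le _ (Real.sqrt_nonneg _)]
    intro x
    exact Real.le_sqrt_of_sq_le (norm_sq_vproj_sub_le hs hu h x)
  have hC : CauchySeq fun n => vproj n u := by
    refine cauchySeq_of_le_tendsto_0' _ (fun n m h => ?_) htail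
    rw [dist_comm]
    exact hdist n m h
  obtain ⟨U, hU⟩ := cauchySeq_tendsto_of_complete hC
  -- The uniform limit U is tangential with the same coefficients as u, so completeness identifies
  -- the two.
  suffices h0 : u - U = 0 by
    rw [← sub_eq_zero.1 h0] at hU
    exact hU
  have hUt : IsTangential U := by
    intro x
    have h1 : Filter.Tendsto (fun n => inner ℝ (x : E3) (vproj n u x)) Filter.atTop
        (nhds (inner ℝ (x : E3) (U x))) :=
      tendsto_const_nhds.inner ((continuous_eval_const x).tendsto U |>.comp hU)
    simp only [inner_self_vproj] at h1
    exact (tendsto_nhds_unique h1 tendsto_const_nhds)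
  refine eq_zero_of_vharm (fun x => ?_) fun l hl m hm b => ?_
  · rw [ContinuousMap.sub_apply, inner_sub_right, ht, hUt, sub_zero]
  · rw [map_sub, LinearMap.sub_apply, sub_eq_zero]
    have h1 : Filter.Tendsto (fun n => ip (vproj n u) (vharm ⟨l, m, b⟩)) Filter.atTop
        (nhds (ip U (vharm ⟨l, m, b⟩))) :=
      ((continuous_ip_left (vharm ⟨l, m, b⟩)).tendsto U).comp hU
    refine tendsto_nhds_unique ?_ h1
    refine tendsto_const_nhds.congr' ?_
    filter_upwards [Filter.eventually_ge_atTop l] with n hn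
    have hi : (⟨l, m, b⟩ : VIdx) ∈ vidx 0 n := mem_vidx.2 ⟨⟨hl, hn⟩, hm⟩
    exact (ip_vproj (u := u) hi).symm

lemma norm_sq_vproj_le {s : ℝ} (hs : 1 < s) {u : C(S2, E3)}
    (hu : Summable fun l : ℕ => wpow s u (l + 1)) (n : ℕ) (x : S2) :
    ‖vproj n u x‖ ^ 2 ≤ embConst s * sobSq s u := by
  have := norm_sq_vproj_sub_le hs hu (Nat.zero_le n) x
  have h0 : vproj 0 u = 0 := by
    rw [vproj, vidx, Finset.sum_sigma, Finset.Ioc_self, Finset.sum_empty]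
  simpa [h0, sobSq] using this

lemma norm_sq_le {s : ℝ} (hs : 1 < s) {u : C(S2, E3)} (ht : IsTangential u)
    (hu : Summable fun l : ℕ => wpow s u (l + 1)) (x : S2) :
    ‖u x‖ ^ 2 ≤ embConst s * sobSq s u := by
  have h1 : Filter.Tendsto (fun n => ‖vproj n u x‖ ^ 2) Filter.atTop (nhds (‖u x‖ ^ 2)) :=
    (((continuous_eval_const x).tendsto u).comp (tendsto_vproj hs ht hu)).norm.pow 2
  exact le_of_tendsto' h1 fun n => norm_sq_vproj_le hs hu n x

lemma sum_vidx (f : VIdx → ℝ) (n' n : ℕ) : ∑ i ∈ vidx n' n, f i =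
    ∑ l ∈ Finset.Ioc n' n, ∑ m ∈ orders l, ∑ b : Bool, f ⟨l, m, b⟩ := by
  rw [vidx, Finset.sum_sigma]
  exact Finset.sum_congr rfl fun l _ => Finset.sum_product _ _ _

/-- The squared distance from the partial sums is the limit of partial sums of squares. -/
lemma ip_sub_vproj_le {s : ℝ} (hs : 1 < s) {u : C(S2, E3)} (ht : IsTangential u)
    (hu : Summable fun l : ℕ => wpow s u (l + 1)) (n : ℕ) {T : ℝ}
    (hT : ∀ N, ∑ l ∈ Finset.Ioc n N, vpow u l ≤ T) :
    ip (u - vproj n u) (u - vproj n u) ≤ T := by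
  have h1 := tendsto_vproj hs ht hu
  have h2 : Filter.Tendsto (fun N => ip (vproj N u - vproj n u) (vproj N u - vproj n u))
      Filter.atTop (nhds (ip (u - vproj n u) (u - vproj n u))) := by
    have h3 : Continuous fun v : C(S2, E3) => ip v v :=
      continuous_ip.comp (continuous_id.prodMk continuous_id)
    exact (h3.tendsto _).comp (h1.sub_const _)
  refine le_of_tendsto h2 ?_
  filter_upwards [Filter.eventually_ge_atTop n] with N hN
  rw [vproj_sub_vproj hN, (orthonormalOn_vharm n N).apply_sum_sum]
  refine le_trans (le_of_eq ?_) (hT N)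
  rw [sum_vidx]
  simp only [vpow, sq]

end Bounds

/-! ### Products of Sobolev fields -/

section Product

open MvPolynomial

/-- The components of a vector spherical harmonic, as polynomials. -/
noncomputable def vpoly (i : VIdx) (j : Fin 3) : Poly3 :=
  (sqrtEig i.1)⁻¹ • if i.2.2 then ang j (harm i.1 i.2.1)
    else pderiv j (harm i.1 i.2.1) - (∑ k, X k * pderiv k (harm i.1 i.2.1)) * X j

lemma vharm_apply (i : VIdx) (x : S2) (j : Fin 3) : vharm i x j = ev (x : E3) (vpoly i j) := by
  obtain ⟨l, m, b⟩ := i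
  cases b
  · rw [vharm_false, ContinuousMap.smul_apply, PiLp.smul_apply, gradF_apply, lgrad, vpoly]
    simp [grad_apply, inner_eq, Fin.sum_univ_three]
  · rw [vharm_true, ContinuousMap.smul_apply, PiLp.smul_apply, curlF_apply, lcurl_apply, vpoly]
    simp

lemma totalDegree_X_mul_le (i : Fin 3) {p : Poly3} {d : ℕ} (hp : p.totalDegree ≤ d) :
    (X i * p).totalDegree ≤ d + 1 := by
  refine (totalDegree_mul _ _).trans ?_
  rw [totalDegree_X]
  omega

lemma totalDegree_ang_le (i : Fin 3) (p : Poly3) : (ang i p).totalDegree ≤ p.totalDegree + 1 := by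
  have h : ∀ j k : Fin 3, (X j * pderiv k p).totalDegree ≤ p.totalDegree + 1 := fun j k =>
    totalDegree_X_mul_le j (totalDegree_pderiv_le k p)
  fin_cases i
  · exact (congrArg totalDegree (ang_zero_apply p)).trans_le
      ((totalDegree_sub _ _).trans (max_le (h _ _) (h _ _)))
  · exact (congrArg totalDegree (ang_one_apply p)).trans_le
      ((totalDegree_sub _ _).trans (max_le (h _ _) (h _ _)))
  · exact (congrArg totalDegree (ang_two_apply p)).trans_le
      ((totalDegree_sub _ _).trans (max_le (h _ _) (h _ _)))

/-- The crude bound n + 2 comes from not counting the degree lost in differentiation; the projection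
in the gradient multiplies by two coordinates. -/
lemma totalDegree_vpoly_le {n : ℕ} {i : VIdx} (hi : i ∈ vidx 0 n) (j : Fin 3) :
    (vpoly i j).totalDegree ≤ n + 2 := by
  rw [mem_vidx] at hi
  have hd := (totalDegree_harm_le hi.2).trans hi.1.2
  refine (totalDegree_smul_le _ _).trans ?_
  split_ifs
  · exact (totalDegree_ang_le _ _).trans (by omega)
  · refine (totalDegree_sub _ _).trans (max_le ?_ ?_)
    · exact (totalDegree_pderiv_le _ _).trans (by omega)
    · rw [mul_comm]
      refine totalDegree_X_mul_le j (totalDegree_finsetSum_le fun k _ => ?_)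
      exact totalDegree_X_mul_le k ((totalDegree_pderiv_le _ _).trans hd)

/-- The pointwise inner product of continuous fields. -/
noncomputable def dotF (u v : C(S2, E3)) : C(S2, ℝ) := ⟨fun x => inner ℝ (u x) (v x), by fun_prop⟩

lemma dotF_apply (u v : C(S2, E3)) (x : S2) : dotF u v x = inner ℝ (u x) (v x) := rfl

/-- The product of two truncations is a polynomial of degree at most 2(n+2) on the sphere. -/
lemma ip_dotF_vproj_sharm (u v : C(S2, E3)) (n : ℕ) {l : ℕ} (hl : 2 * n + 4 < l) (m : ℤ) :
    ip (dotF (vproj n u) (vproj n v)) (sharm ⟨l, m⟩) = 0 := by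
  let P (w : C(S2, E3)) (j : Fin 3) : Poly3 := ∑ i ∈ vidx 0 n, ip w (vharm i) • vpoly i j
  have hP : ∀ w x j, vproj n w x j = ev (x : E3) (P w j) := by
    intro w x j
    simp only [P, vproj, ContinuousMap.sum_apply, ContinuousMap.smul_apply, map_sum, map_smul,
      WithLp.ofLp_sum, Finset.sum_apply, PiLp.smul_apply, vharm_apply]
  have hd : ∀ w j, (P w j).totalDegree ≤ n + 2 := fun w j =>
    totalDegree_finsetSum_le fun i hi => (totalDegree_smul_le _ _).trans (totalDegree_vpoly_le hi j)
  have e : dotF (vproj n u) (vproj n v) = polyF (∑ j, P u j * P v j) := by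
    ext x
    rw [dotF_apply, polyF_apply, inner_eq, Fin.sum_univ_three]
    simp [hP]
  rw [e, sharm, ip_polyF]
  refine intS_mul_harm_eq_zero (n := 2 * n + 4) (totalDegree_finsetSum_le fun j _ => ?_) hl m
  have h1 := hd u j
  have h2 := hd v j
  exact (totalDegree_mul _ _).trans (by omega)

/-- The sum of the squares of the Fourier coefficients of degree `l` of a scalar function. -/
noncomputable def spow (h : C(S2, ℝ)) (l : ℕ) : ℝ := ∑ m ∈ orders l, ip h (sharm ⟨l, m⟩) ^ 2

lemma spow_nonneg (h : C(S2, ℝ)) (l : ℕ) : 0 ≤ spow h l := Finset.sum_nonneg fun _ _ => sq_nonneg _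

lemma one_le_onePlusEig (l : ℕ) : 1 ≤ onePlusEig l := by
  unfold onePlusEig
  have : (0 : ℝ) ≤ (l : ℝ) * (l + 1) := by positivity
  linarith

lemma vpow_le_wpow {s : ℝ} (hs : 0 ≤ s) (u : C(S2, E3)) (l : ℕ) : vpow u l ≤ wpow s u l :=
  le_mul_of_one_le_left (vpow_nonneg u l) (Real.one_le_rpow (one_le_onePlusEig l) hs)

lemma ip_sub_vproj_le_tsum {s : ℝ} (hs : 1 < s) {u : C(S2, E3)} (ht : IsTangential u)
    (hu : Summable fun l : ℕ => wpow s u (l + 1)) (n : ℕ) :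
    ip (u - vproj n u) (u - vproj n u) ≤ ∑' l : ℕ, vpow u (l + n + 1) := by
  have h0 : Summable fun l : ℕ => vpow u (l + 1) :=
    Summable.of_nonneg_of_le (fun l => vpow_nonneg u _)
      (fun l => vpow_le_wpow (by linarith) u _) hu
  refine ip_sub_vproj_le hs ht hu n fun N => ?_
  have h1 := sum_Ioc_wpow_le (s := 0) (u := u) (by simpa [wpow] using h0) n N
  simpa [wpow] using h1

/-- A summation by parts: a comparison of tails gives a comparison of weighted sums. -/
lemma tsum_weight_le (a b d : ℕ → ENNReal) (φ : ℕ → ℕ)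
    (h : ∀ n, ∑' k, (if n ≤ k then a k else 0) ≤ ∑' l, if n ≤ φ l then b l else 0) :
    ∑' k, (∑ n ∈ Finset.range (k + 1), d n) * a k ≤
      ∑' l, (∑ n ∈ Finset.range (φ l + 1), d n) * b l := by
  have e : ∀ (c : ENNReal) (k : ℕ), (∑ n ∈ Finset.range (k + 1), d n) * c =
      ∑' n, d n * if n ≤ k then c else 0 := by
    intro c k
    rw [tsum_eq_sum (s := Finset.range (k + 1)), Finset.sum_mul]
    · refine Finset.sum_congr rfl fun n hn => ?_
      rw [if_pos (Finset.mem_range_succ_iff.1 hn)]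
    · intro n hn
      rw [Finset.mem_range_succ_iff] at hn
      rw [if_neg hn, mul_zero]
  calc ∑' k, (∑ n ∈ Finset.range (k + 1), d n) * a k
      = ∑' k, ∑' n, d n * (if n ≤ k then a k else 0) := tsum_congr fun k => e _ k
    _ = ∑' n, d n * ∑' k, (if n ≤ k then a k else 0) := by
        rw [ENNReal.tsum_comm]
        exact tsum_congr fun n => ENNReal.tsum_mul_left
    _ ≤ ∑' n, d n * ∑' l, (if n ≤ φ l then b l else 0) :=
        ENNReal.tsum_le_tsum fun n => mul_le_mul_right (h n) _
    _ = ∑' l, ∑' n, d n * (if n ≤ φ l then b l else 0) := by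
        rw [ENNReal.tsum_comm]
        exact tsum_congr fun n => ENNReal.tsum_mul_left.symm
    _ = _ := tsum_congr fun l => (e _ _).symm

lemma norm_inner_sub_sq_le {a a' b b' : E3} {A B : ℝ} (hb : ‖b‖ ^ 2 ≤ B) (ha : ‖a'‖ ^ 2 ≤ A) :
    (inner ℝ a b - inner ℝ a' b') ^ 2 ≤ 2 * B * ‖a - a'‖ ^ 2 + 2 * A * ‖b - b'‖ ^ 2 := by
  have e : inner ℝ a b - inner ℝ a' b' = inner ℝ (a - a') b + inner ℝ a' (b - b') := by
    rw [inner_sub_left, inner_sub_right]; ring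
  have h1 := sq_le_sq' (by
    linarith [(abs_le.1 (abs_real_inner_le_norm (a - a') b)).1])
    (abs_le.1 (abs_real_inner_le_norm (a - a') b)).2
  have h2 := sq_le_sq' (by
    linarith [(abs_le.1 (abs_real_inner_le_norm a' (b - b'))).1])
    (abs_le.1 (abs_real_inner_le_norm a' (b - b'))).2
  have h3 : ‖a - a'‖ ^ 2 * ‖b‖ ^ 2 ≤ ‖a - a'‖ ^ 2 * B := by gcongr
  have h4 : ‖a'‖ ^ 2 * ‖b - b'‖ ^ 2 ≤ A * ‖b - b'‖ ^ 2 := by gcongr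
  rw [e]
  nlinarith [sq_nonneg (inner ℝ (a - a') b - inner ℝ a' (b - b'))]

lemma ip_dotF_sub_le {s : ℝ} (hs : 1 < s) {u v : C(S2, E3)} (hut : IsTangential u)
    (hvt : IsTangential v) (hu : Summable fun l : ℕ => wpow s u (l + 1))
    (hv : Summable fun l : ℕ => wpow s v (l + 1)) (n : ℕ) :
    ip (dotF u v - dotF (vproj n u) (vproj n v)) (dotF u v - dotF (vproj n u) (vproj n v)) ≤
      2 * embConst s * (sobSq s v * ∑' l : ℕ, vpow u (l + n + 1) +
        sobSq s u * ∑' l : ℕ, vpow v (l + n + 1)) := by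
  have hA : 0 ≤ embConst s * sobSq s u := mul_nonneg (embConst_nonneg s) (sobSq_nonneg s u)
  have hB : 0 ≤ embConst s * sobSq s v := mul_nonneg (embConst_nonneg s) (sobSq_nonneg s v)
  calc _ ≤ ∫ x, (2 * (embConst s * sobSq s v) * ‖(u - vproj n u) x‖ ^ 2 +
          2 * (embConst s * sobSq s u) * ‖(v - vproj n v) x‖ ^ 2) ∂surf := by
        rw [ip_self_eq]
        refine integral_mono (integrable_of_continuous (by fun_prop))
          (integrable_of_continuous (by fun_prop)) fun x => ?_
        simp only [ContinuousMap.sub_apply, dotF_apply, Real.norm_eq_abs, sq_abs]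
        exact norm_inner_sub_sq_le (norm_sq_le hs hvt hv x) (norm_sq_vproj_le hs hu n x)
    _ = 2 * (embConst s * sobSq s v) * ip (u - vproj n u) (u - vproj n u) +
          2 * (embConst s * sobSq s u) * ip (v - vproj n v) (v - vproj n v) := by
        rw [integral_add (integrable_of_continuous (by fun_prop))
          (integrable_of_continuous (by fun_prop)), integral_const_mul, integral_const_mul,
          ip_self_eq, ip_self_eq]
    _ ≤ 2 * (embConst s * sobSq s v) * ∑' l : ℕ, vpow u (l + n + 1) +
          2 * (embConst s * sobSq s u) * ∑' l : ℕ, vpow v (l + n + 1) :=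
        add_le_add
          (mul_le_mul_of_nonneg_left (ip_sub_vproj_le_tsum hs hut hu n) (by linarith))
          (mul_le_mul_of_nonneg_left (ip_sub_vproj_le_tsum hs hvt hv n) (by linarith))
    _ = _ := by ring

/-- In degrees above 2n+4 the product of truncations has no coefficients, so Bessel may be applied
to its difference from u·v. -/
lemma sum_spow_le {s : ℝ} (hs : 1 < s) {u v : C(S2, E3)} (hut : IsTangential u)
    (hvt : IsTangential v) (hu : Summable fun l : ℕ => wpow s u (l + 1))
    (hv : Summable fun l : ℕ => wpow s v (l + 1)) (n : ℕ) (L : Finset ℕ)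
    (hL : n = 0 ∨ ∀ l ∈ L, 2 * n + 4 < l) :
    ∑ l ∈ L, spow (dotF u v) l ≤ 2 * embConst s * (sobSq s v * ∑' l : ℕ, vpow u (l + n + 1) +
        sobSq s u * ∑' l : ℕ, vpow v (l + n + 1)) := by
  refine le_trans ?_ (ip_dotF_sub_le hs hut hvt hu hv n)
  refine le_trans (le_of_eq ?_) (bessel_sharm _ L)
  refine Finset.sum_congr rfl fun l hl => Finset.sum_congr rfl fun m _ => ?_
  rw [map_sub, LinearMap.sub_apply]
  -- For n = 0 the truncations vanish, so no restriction on the degrees is needed; this covers the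
  -- lowest degrees.
  rcases hL with rfl | hL
  · have h0 : vproj 0 u = 0 := by
      rw [vproj, vidx, Finset.sum_sigma, Finset.Ioc_self, Finset.sum_empty]
    have h1 : dotF (vproj 0 u) (vproj 0 v) = 0 := by
      ext x
      simp [dotF_apply, h0]
    rw [h1, map_zero, LinearMap.zero_apply, sub_zero]
  · rw [ip_dotF_vproj_sharm u v n (hL l hl), sub_zero]

lemma onePlusEig_mono : Monotone onePlusEig := by
  intro a b h
  have : (a : ℝ) ≤ b := by exact_mod_cast h
  unfold onePlusEig
  gcongr

/-- The square of the constant in the product estimate. -/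
noncomputable def prodConst (s : ℝ) : ℝ := 4 * embConst s * 21 ^ s

lemma prodConst_nonneg (s : ℝ) : 0 ≤ prodConst s :=
  mul_nonneg (mul_nonneg (by norm_num) (embConst_nonneg s)) (by positivity)

/-- The product estimate for Sobolev fields. -/
lemma sobolev_dotF {s : ℝ} (hs : 1 < s) {u v : C(S2, E3)} (hut : IsTangential u)
    (hvt : IsTangential v) (hu : Summable fun l : ℕ => wpow s u (l + 1))
    (hv : Summable fun l : ℕ => wpow s v (l + 1)) :
    (Summable fun l => onePlusEig l ^ s * spow (dotF u v) l) ∧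
      ∑' l, onePlusEig l ^ s * spow (dotF u v) l ≤ prodConst s * (sobSq s u * sobSq s v) := by
  set w : ℕ → ℝ := fun l => onePlusEig l ^ s with hw
  have hw0 : ∀ l, 0 ≤ w l := fun l => Real.rpow_nonneg (onePlusEig_pos l).le _
  have hwm : Monotone w := fun a b h =>
    Real.rpow_le_rpow (onePlusEig_pos a).le (onePlusEig_mono h) (by linarith)
  -- The constant 21 is a convenient upper bound for the ratio of 1+λ at 2(l+1)+4 to 1+λ at l+1.
  have hwD : ∀ l, w (2 * (l + 1) + 4) ≤ 21 ^ s * w (l + 1) := by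
    intro l
    rw [hw, ← Real.mul_rpow (by norm_num) (onePlusEig_pos _).le]
    refine Real.rpow_le_rpow (onePlusEig_pos _).le ?_ (by linarith)
    unfold onePlusEig
    push_cast
    nlinarith [Nat.cast_nonneg (α := ℝ) l]
  set K := 2 * embConst s with hK
  have hK0 : 0 ≤ K := mul_nonneg (by norm_num) (embConst_nonneg s)
  set A := sobSq s u with hA
  set B := sobSq s v with hB
  have hA0 : 0 ≤ A := sobSq_nonneg s u
  have hB0 : 0 ≤ B := sobSq_nonneg s v
  set b : ℕ → ℝ := fun l => K * (B * vpow u (l + 1) + A * vpow v (l + 1)) with hb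
  have hb0 : ∀ l, 0 ≤ b l := fun l =>
    mul_nonneg hK0 (add_nonneg (mul_nonneg hB0 (vpow_nonneg _ _)) (mul_nonneg hA0 (vpow_nonneg _ _)))
  have hsu : Summable fun l : ℕ => vpow u (l + 1) :=
    Summable.of_nonneg_of_le (fun l => vpow_nonneg u _) (fun l => vpow_le_wpow (by linarith) u _) hu
  have hsv : Summable fun l : ℕ => vpow v (l + 1) :=
    Summable.of_nonneg_of_le (fun l => vpow_nonneg v _) (fun l => vpow_le_wpow (by linarith) v _) hv
  have hsb : Summable b := ((hsu.mul_left B).add (hsv.mul_left A)).mul_left K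
  have htail : ∀ n, K * (B * ∑' l : ℕ, vpow u (l + n + 1) + A * ∑' l : ℕ, vpow v (l + n + 1)) =
      ∑' l, b (l + n) := by
    intro n
    have h1 : Summable fun l : ℕ => vpow u (l + n + 1) :=
      (summable_nat_add_iff (f := fun l : ℕ => vpow u (l + 1)) n).2 hsu
    have h2 : Summable fun l : ℕ => vpow v (l + n + 1) :=
      (summable_nat_add_iff (f := fun l : ℕ => vpow v (l + 1)) n).2 hsv
    rw [← tsum_mul_left, ← tsum_mul_left, ← (h1.mul_left B).tsum_add (h2.mul_left A),
      ← tsum_mul_left]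
  -- The increments of the weight, whose partial sums recover it; they are nonnegative because the
  -- weight increases.
  set d : ℕ → ENNReal := fun n =>
    ENNReal.ofReal (match n with | 0 => w 0 | n + 1 => w (n + 1) - w n) with hd
  have hdw : ∀ k, ∑ n ∈ Finset.range (k + 1), d n = ENNReal.ofReal (w k) := by
    intro k
    induction k with
    | zero => simp [hd]
    | succ k ih =>
      rw [Finset.sum_range_succ, ih, hd]
      simp only
      rw [← ENNReal.ofReal_add (hw0 k) (sub_nonneg.2 (hwm (Nat.le_succ k)))]
      congr 1
      ring
  have key := tsum_weight_le (fun k => ENNReal.ofReal (spow (dotF u v) k))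
    (fun l => ENNReal.ofReal (b l)) d (fun l => 2 * (l + 1) + 4) (by
      intro n
      -- The truncation degree for the tail k ≥ n: if n ≥ 5 then 2n₀+4 < n, and always n ≤
      -- 2(l+n₀+1)+4. For n < 5 it is 0 and the unrestricted case applies.
      set n₀ := (n - 5) / 2 with hn₀
      refine le_trans (b := ENNReal.ofReal (∑' l, b (l + n₀))) ?_ ?_
      · rw [ENNReal.tsum_eq_iSup_sum]
        refine iSup_le fun L => ?_
        rw [← Finset.sum_filter, ← ENNReal.ofReal_sum_of_nonneg fun k _ => spow_nonneg _ _]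
        refine ENNReal.ofReal_le_ofReal ?_
        rw [← htail]
        refine sum_spow_le hs hut hvt hu hv n₀ _ ?_
        rcases Nat.lt_or_ge n 5 with hn | hn
        · left; omega
        · right
          intro l hl
          have := (Finset.mem_filter.1 hl).2
          omega
      · have hinj : Function.Injective fun l : ℕ => l + n₀ := fun _ _ h => Nat.add_right_cancel h
        rw [ENNReal.ofReal_tsum_of_nonneg (fun l => hb0 _)
          ((summable_nat_add_iff n₀).2 hsb)]
        refine le_trans (le_of_eq ?_) (ENNReal.tsum_comp_le_tsum_of_injective hinj _)
        refine tsum_congr fun l => ?_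
        rw [if_pos]
        omega)
  simp only [hdw, ← ENNReal.ofReal_mul (hw0 _)] at key
  have hwb : HasSum (fun l => 21 ^ s * (w (l + 1) * b l)) (prodConst s * (A * B)) := by
    have h1 := ((hu.hasSum.mul_left B).add (hv.hasSum.mul_left A)).mul_left (21 ^ s * K)
    have e1 : (fun l => 21 ^ s * (w (l + 1) * b l)) = fun l => 21 ^ s * K *
        (B * wpow s u (l + 1) + A * wpow s v (l + 1)) := by
      ext l
      simp only [hb, wpow, hw]
      ring
    have e2 : prodConst s * (A * B) = 21 ^ s * K * (B * A + A * B) := by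
      rw [prodConst, hK]
      ring
    rw [e1, e2]
    exact h1
  have hbound : ∑' k, ENNReal.ofReal (w k * spow (dotF u v) k) ≤
      ENNReal.ofReal (prodConst s * (A * B)) := by
    refine key.trans ?_
    rw [← hwb.tsum_eq, ENNReal.ofReal_tsum_of_nonneg
      (fun l => mul_nonneg (by positivity) (mul_nonneg (hw0 _) (hb0 l))) hwb.summable]
    refine ENNReal.tsum_le_tsum fun l => ENNReal.ofReal_le_ofReal ?_
    rw [← mul_assoc (21 ^ s)]
    exact mul_le_mul_of_nonneg_right (hwD l) (hb0 l)
  have hnn : ∀ k, 0 ≤ w k * spow (dotF u v) k := fun k => mul_nonneg (hw0 k) (spow_nonneg _ _)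
  have hsum : Summable fun k => w k * spow (dotF u v) k := by
    have h1 : ∑' k, ENNReal.ofReal (w k * spow (dotF u v) k) ≠ ⊤ :=
      ne_top_of_le_ne_top ENNReal.ofReal_ne_top hbound
    have h2 := ENNReal.summable_toReal h1
    simpa only [ENNReal.toReal_ofReal (hnn _)] using h2
  refine ⟨hsum, ?_⟩
  rw [← ENNReal.ofReal_tsum_of_nonneg hnn hsum] at hbound
  exact (ENNReal.ofReal_le_ofReal_iff
    (mul_nonneg (prodConst_nonneg s) (mul_nonneg hA0 hB0))).1 hbound

end Product

/-! ### The matrix-valued kernels -/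

section Kernel

/-- The field `x ↦ Ψ(x, y) v`. -/
noncomputable def kerVec (ψ : ℝ → ℝ) (y v x : E3) : E3 :=
  WithLp.toLp 2 (kernel ψ x.ofLp y.ofLp *ᵥ v.ofLp)

lemma matQ_mulVec (x y v : E3) : WithLp.toLp 2 (matQ x.ofLp y.ofLp *ᵥ v.ofLp) =
    -(inner ℝ (cross x y) v • cross x y) := by
  ext i
  simp only [matQ, neg_mulVec, vecMulVec_mulVec, cross, inner_eq]
  simp [dotProduct, Fin.sum_univ_three]
  ring

lemma dotProduct_eq (x y : E3) : x.ofLp ⬝ᵥ y.ofLp = inner ℝ x y := by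
  simp [dotProduct, Fin.sum_univ_three, inner_eq]

lemma matR_mulVec (x y v : E3) : WithLp.toLp 2 (matR x.ofLp y.ofLp *ᵥ v.ofLp) =
    inner ℝ x y • v - inner ℝ x v • y := by
  ext i
  simp [matR, sub_mulVec, smul_mulVec, vecMulVec_mulVec, dotProduct_eq]

lemma matV_mulVec (x y v : E3) : WithLp.toLp 2 (matV x.ofLp y.ofLp *ᵥ v.ofLp) =
    (inner ℝ x v - inner ℝ x y * inner ℝ y v) • (y - inner ℝ x y • x) := by
  ext i
  simp [matV, vecMulVec_mulVec, dotProduct_eq, sub_dotProduct, smul_dotProduct]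
  ring

lemma matW_mulVec (x y v : E3) : WithLp.toLp 2 (matW x.ofLp y.ofLp *ᵥ v.ofLp) =
    v - inner ℝ y v • y - (inner ℝ x v - inner ℝ y v * inner ℝ x y) • x := by
  ext i
  simp [matW, ← mulVec_mulVec, sub_mulVec, vecMulVec_mulVec, dotProduct_eq, mulVec_sub,
    mulVec_smul]
  ring

lemma kerVec_eq (ψ : ℝ → ℝ) (x y : E3) (v : E3) : kerVec ψ y v x =
    deriv (kappa ψ) (inner ℝ x y) • (-(inner ℝ (cross x y) v • cross x y) +
      (inner ℝ x v - inner ℝ x y * inner ℝ y v) • (y - inner ℝ x y • x)) +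
    kappa ψ (inner ℝ x y) • (inner ℝ x y • v - inner ℝ x v • y + (v - inner ℝ y v • y -
      (inner ℝ x v - inner ℝ y v * inner ℝ x y) • x)) := by
  rw [← matQ_mulVec, ← matR_mulVec, ← matV_mulVec, ← matW_mulVec]
  ext i
  simp [kerVec, kernel, kernelDiv, kernelCurl, add_mulVec, smul_mulVec, dotProduct_eq]
  ring

/-- On the sphere the kernel is the sum of the two fields in the definition of the transport. -/
lemma kerVec_sphere (ψ : ℝ → ℝ) (x y : S2) {v : E3} (hv : inner ℝ (y : E3) v = 0) :
    kerVec ψ y v x = (kappa ψ (inner ℝ (x : E3) (y : E3)) -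
        (1 - inner ℝ (x : E3) (y : E3)) * deriv (kappa ψ) (inner ℝ (x : E3) (y : E3))) •
      ((1 + inner ℝ (x : E3) (y : E3)) • v - inner ℝ (x : E3) v • ((x : E3) + (y : E3))) := by
  rw [kerVec_eq, inner_cross_smul_cross, inner_self_sphere, inner_self_sphere, hv]
  module

/-- A continuous function on the real line that agrees with `ψ` on `[-1, 1]`. -/
noncomputable def extend (ψ : ℝ → ℝ) : ℝ → ℝ :=
  Set.IccExtend (show (-1 : ℝ) ≤ 1 by norm_num) ((Set.Icc (-1 : ℝ) 1).domRestrict ψ)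

lemma extend_eq (ψ : ℝ → ℝ) {t : ℝ} (ht : t ∈ Set.Icc (-1 : ℝ) 1) : extend ψ t = ψ t :=
  Set.IccExtend_of_mem _ _ ht

lemma continuous_extend {ψ : ℝ → ℝ} (hψ : ContinuousOn ψ (Set.Icc (-1) 1)) :
    Continuous (extend ψ) :=
  (continuousOn_iff_continuous_domRestrict.1 hψ).Icc_extend'

lemma integral_extend (ψ : ℝ → ℝ) {t : ℝ} (ht : t ∈ Set.Icc (-1 : ℝ) 1) :
    ∫ s in (-1 : ℝ)..t, extend ψ s = ∫ s in (-1 : ℝ)..t, ψ s := by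
  refine intervalIntegral.integral_congr fun s hs => ?_
  rw [Set.uIcc_of_le ht.1] at hs
  exact extend_eq ψ ⟨hs.1, hs.2.trans ht.2⟩

lemma intervalIntegrable_of_mem {ψ : ℝ → ℝ} (hψ : ContinuousOn ψ (Set.Icc (-1) 1)) {t : ℝ}
    (ht : t ∈ Set.Icc (-1 : ℝ) 1) : IntervalIntegrable ψ volume (-1) t := by
  refine ContinuousOn.intervalIntegrable ?_
  rw [Set.uIcc_of_le ht.1]
  exact hψ.mono (Set.Icc_subset_Icc_right ht.2)

lemma one_sub_sq_pos {t : ℝ} (ht : t ∈ Set.Ioo (-1 : ℝ) 1) : 0 < 1 - t ^ 2 := by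
  nlinarith [ht.1, ht.2]

lemma kappa_of_mem_Ioo {ψ : ℝ → ℝ} (hψ : ContinuousOn ψ (Set.Icc (-1) 1)) {t : ℝ}
    (ht : t ∈ Set.Ioo (-1 : ℝ) 1) : kappa ψ t =
      ((t + 1) - 4 * Real.pi * ∫ s in (-1 : ℝ)..t, extend ψ s) / (4 * Real.pi * (1 - t ^ 2)) := by
  have ht' : t ∈ Set.Icc (-1 : ℝ) 1 := Set.Ioo_subset_Icc_self ht
  rw [kappa, if_neg ht.2.ne, if_neg ht.1.ne', integral_extend ψ ht',
    intervalIntegral.integral_sub (by simp) ((intervalIntegrable_of_mem hψ ht').const_mul _),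
    intervalIntegral.integral_const_mul, one_div_mul_eq_div]
  simp

/-- The quotient rule for the defining formula. At an interior point the derivative of the integral
is the integrand, taken through the continuous extension of ψ. -/
lemma deriv_kappa {ψ : ℝ → ℝ} (hψ : ContinuousOn ψ (Set.Icc (-1) 1)) {t : ℝ}
    (ht : t ∈ Set.Ioo (-1 : ℝ) 1) : (1 - t ^ 2) * deriv (kappa ψ) t =
      2 * t * kappa ψ t + (1 - 4 * Real.pi * ψ t) / (4 * Real.pi) := by
  have hπ := Real.pi_pos
  have hd := one_sub_sq_pos ht
  have h1 : HasDerivAt (fun t : ℝ => (t + 1) - 4 * Real.pi * ∫ s in (-1 : ℝ)..t, extend ψ s)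
      (1 - 4 * Real.pi * extend ψ t) t :=
    ((hasDerivAt_id t).add_const 1).sub
      (((continuous_extend hψ).integral_hasStrictDerivAt (-1) t).hasDerivAt.const_mul _)
  have h2 : HasDerivAt (fun t : ℝ => 4 * Real.pi * (1 - t ^ 2)) (4 * Real.pi * (-(2 * t))) t := by
    have := (((hasDerivAt_id t).pow 2).const_sub 1).const_mul (4 * Real.pi)
    simpa using this
  have h3 := h1.div h2 (by positivity)
  have h4 : kappa ψ =ᶠ[nhds t] fun t =>
      ((t + 1) - 4 * Real.pi * ∫ s in (-1 : ℝ)..t, extend ψ s) / (4 * Real.pi * (1 - t ^ 2)) := by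
    filter_upwards [isOpen_Ioo.mem_nhds ht] with s hs
    exact kappa_of_mem_Ioo hψ hs
  rw [(h3.congr_of_eventuallyEq h4).deriv, kappa_of_mem_Ioo hψ ht,
    extend_eq ψ (Set.Ioo_subset_Icc_self ht)]
  field_simp
  ring

/-- The scalar factor of the kernel, multiplied by `1 + t`. -/
noncomputable def transFactor (ψ : ℝ → ℝ) (t : ℝ) : ℝ :=
  (1 + t) * ψ t - ∫ s in (-1 : ℝ)..t, ψ s

/-- After multiplication by (1+t)² the combination κ - (1-t)κ' becomes (1+t)ψ - ∫ψ, free of κ and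
κ'. This allows approximation of ψ in the sup norm. -/
lemma kerVec_transport {ψ : ℝ → ℝ} (hψ : ContinuousOn ψ (Set.Icc (-1) 1))
    (hn : 2 * Real.pi * ∫ t in (-1 : ℝ)..1, ψ t = 1) (x y : S2) {v : E3}
    (hv : inner ℝ (y : E3) v = 0) :
    (1 + inner ℝ (x : E3) (y : E3)) ^ 2 • kerVec ψ y v x =
      transFactor ψ (inner ℝ (x : E3) (y : E3)) •
      ((1 + inner ℝ (x : E3) (y : E3)) • v - inner ℝ (x : E3) v • ((x : E3) + (y : E3))) := by
  have hπ := Real.pi_pos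
  rw [kerVec_sphere ψ x y hv, smul_smul]
  congr 1
  set t := inner ℝ (x : E3) (y : E3) with ht
  have h1 : t ≤ 1 := inner_sphere_le x y
  have h2 : -1 ≤ t := neg_one_le_inner_sphere x y
  -- At t = 1 the derivative has factor 0, and the assigned value of κ matches because of the
  -- normalization of ψ.
  rcases eq_or_lt_of_le h1 with h1 | h1
  · rw [h1, transFactor, kappa, if_pos rfl]
    have : ∫ t in (-1 : ℝ)..1, ψ t = 1 / (2 * Real.pi) := by
      field_simp; linarith
    rw [this]
    field_simp
    ring
  rcases eq_or_lt_of_le h2 with h2 | h2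
  · rw [← h2, transFactor]
    simp
  have hm : t ∈ Set.Ioo (-1 : ℝ) 1 := ⟨h2, h1⟩
  have hd := deriv_kappa hψ hm
  have hk := kappa_of_mem_Ioo hψ hm
  rw [eq_div_iff (by have := one_sub_sq_pos hm; positivity),
    integral_extend ψ (Set.Ioo_subset_Icc_self hm)] at hk
  have h3 : (1 - 4 * Real.pi * ψ t) / (4 * Real.pi) * (4 * Real.pi) = 1 - 4 * Real.pi * ψ t := by
    field_simp
  have h4 : (4 * Real.pi) * ((1 + t) ^ 2 * (kappa ψ t - (1 - t) * deriv (kappa ψ) t)) =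
      (4 * Real.pi) * transFactor ψ t := by
    rw [transFactor]
    linear_combination (-(4 * Real.pi) * (1 + t)) * hd + hk - (1 + t) * h3
  exact mul_left_cancel₀ (by positivity) h4

/-- At the antipode the transport relation reads 0 = 0, so the value there has to be computed
separately. -/
lemma kerVec_antipode (ψ : ℝ → ℝ) (x y : S2) {v : E3} (hv : inner ℝ (y : E3) v = 0)
    (ht : inner ℝ (x : E3) (y : E3) = -1) : kerVec ψ y v x = 0 := by
  rw [kerVec_sphere ψ x y hv, ht]
  have : (x : E3) + y = 0 := by
    rw [← norm_eq_zero, ← sq_eq_zero_iff, norm_add_sq_real, ht, norm_sphere, norm_sphere]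
    norm_num
  rw [this]
  simp

lemma inner_kerVec (ψ : ℝ → ℝ) (x y : S2) {v : E3} (hv : inner ℝ (y : E3) v = 0) :
    inner ℝ (x : E3) (kerVec ψ y v x) = 0 := by
  rw [kerVec_sphere ψ x y hv, inner_smul_right, inner_sub_right, inner_smul_right, inner_smul_right,
    inner_add_right, inner_self_sphere]
  ring

/-- Every polynomial is, up to a constant, in the range of the Legendre operator. -/
lemma exists_eq_sub_legOp (p : Polynomial ℝ) :
    ∃ (c : ℝ) (G : Polynomial ℝ), p = Polynomial.C c - legOp G := by
  have hX : ∀ n : ℕ, ∃ (c : ℝ) (G : Polynomial ℝ), Polynomial.X ^ n = Polynomial.C c - legOp G := by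
    intro n
    induction n using Nat.strong_induction_on with
    | _ n ih =>
      rcases n with _ | n
      · exact ⟨1, 0, by simp⟩
      · obtain ⟨c, G, h⟩ : ∃ (c : ℝ) (G : Polynomial ℝ),
            (((n : ℝ) + 1) * n) • (Polynomial.X : Polynomial ℝ) ^ (n - 1) =
              Polynomial.C c - legOp G := by
          rcases n with _ | n
          · exact ⟨0, 0, by simp⟩
          · obtain ⟨c, G, h⟩ := ih (n + 1 - 1) (by omega)
            refine ⟨((((n + 1 : ℕ) : ℝ) + 1) * ((n + 1 : ℕ) : ℝ)) * c,
              ((((n + 1 : ℕ) : ℝ) + 1) * ((n + 1 : ℕ) : ℝ)) • G, ?_⟩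
            rw [h, smul_sub, map_smul, Polynomial.smul_C, smul_eq_mul]
        have h2 := legOp_X_pow (n + 1)
        push_cast at h2
        rw [show ((n : ℝ) + 1) * (n + 1 - 1) = (n + 1) * n by ring, h] at h2
        set r : ℝ := ((n : ℝ) + 1) * (n + 1 + 1) with hr
        have hr0 : r ≠ 0 := by positivity
        refine ⟨r⁻¹ * c, r⁻¹ • (G + Polynomial.X ^ (n + 1)), ?_⟩
        rw [map_smul, map_add, h2, show Polynomial.C (r⁻¹ * c) = r⁻¹ • Polynomial.C c by
          rw [Polynomial.smul_C, smul_eq_mul], ← smul_sub]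
        rw [show Polynomial.C c - (legOp G + (Polynomial.C c - legOp G -
          r • (Polynomial.X : Polynomial ℝ) ^ (n + 1))) = r • Polynomial.X ^ (n + 1) by abel,
          smul_smul, inv_mul_cancel₀ hr0, one_smul]
  induction p using Polynomial.induction_on' with
  | add p q hp hq =>
    obtain ⟨c, G, rfl⟩ := hp
    obtain ⟨c', G', rfl⟩ := hq
    exact ⟨c + c', G + G', by rw [map_add, map_add]; abel⟩
  | monomial n a =>
    obtain ⟨c, G, h⟩ := hX n
    refine ⟨a * c, a • G, ?_⟩
    rw [← Polynomial.C_mul_X_pow_eq_monomial, h, map_smul, Polynomial.smul_eq_C_mul,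
      Polynomial.C_mul, mul_sub]

/-- The transport field of a polynomial profile, with its Fourier coefficients. -/
lemma exists_polynomial_field (p : Polynomial ℝ) (y : S2) {v : E3}
    (hv : inner ℝ (y : E3) v = 0) : ∃ w : C(S2, E3),
    (∀ x : S2, (1 + inner ℝ (x : E3) (y : E3)) ^ 2 • w x =
      transFactor (fun t => p.eval t) (inner ℝ (x : E3) (y : E3)) •
      ((1 + inner ℝ (x : E3) (y : E3)) • v - inner ℝ (x : E3) v • ((x : E3) + (y : E3)))) ∧
    (∀ x : S2, inner ℝ (x : E3) (y : E3) = -1 → w x = 0) ∧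
    ∀ l, 0 < l → ∀ m b, ip w (vharm ⟨l, m, b⟩) =
      zonalCoeff (fun t => p.eval t) l * inner ℝ v (vharm ⟨l, m, b⟩ y) := by
  -- Then G' plays the role of κ. The constant c drops out of `transFactor` and of all coefficients
  -- with l ≥ 1, so the approximating polynomials need not be normalized.
  obtain ⟨c, G, rfl⟩ := exists_eq_sub_legOp p
  refine ⟨transField (Polynomial.derivative G) y v, fun x => ?_, fun x hx => ?_, fun l hl m b => ?_⟩
  · rw [transField_apply _ y hv, smul_smul]
    congr 1
    set t := inner ℝ (x : E3) (y : E3)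
    have h : ∫ s in (-1 : ℝ)..t, (Polynomial.C c - legOp G).eval s =
        c * (1 + t) - (1 - t ^ 2) * (Polynomial.derivative G).eval t := by
      have := intervalIntegral.integral_eq_sub_of_hasDerivAt (a := (-1 : ℝ)) (b := t)
        (fun s _ => (Polynomial.C c * Polynomial.X -
          (1 - Polynomial.X ^ 2) * Polynomial.derivative G).hasDerivAt s)
        ((Polynomial.derivative _).continuous.intervalIntegrable _ _)
      rw [show Polynomial.derivative (Polynomial.C c * Polynomial.X -
          (1 - Polynomial.X ^ 2) * Polynomial.derivative G) = Polynomial.C c - legOp G by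
        rw [legOp_apply]
        simp
        ring] at this
      rw [this]
      simp
      ring
    rw [transFactor, h, legOp_apply]
    simp
    ring
  · rw [transField_apply _ y hv, hx]
    have : (x : E3) + y = 0 := by
      rw [← norm_eq_zero, ← sq_eq_zero_iff, norm_add_sq_real, hx, norm_sphere, norm_sphere]
      norm_num
    rw [this]
    simp
  · have hz : zonalCoeff (fun t => (Polynomial.C c - legOp G).eval t) l =
        -(2 * Real.pi * int1 (legOp G * legendre l)) := by
      have h0 : int1 (Polynomial.C c * legendre l) = 0 :=
        int1_mul_legendre_of_degree_lt l _ (Polynomial.degree_C_le.trans_lt (by exact_mod_cast hl))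
      have h1 : zonalCoeff (fun t => (Polynomial.C c - legOp G).eval t) l =
          2 * Real.pi * int1 ((Polynomial.C c - legOp G) * legendre l) := by
        simp only [zonalCoeff, int1, LinearMap.coe_mk, AddHom.coe_mk, Polynomial.eval_mul]
      rw [h1, sub_mul, map_sub, h0]
      ring
    have h2 := ip_transField_derivative G y hv (isEig_harm l m)
    rw [hz]
    cases b
    · rw [vharm_false, map_smul, h2.2, ContinuousMap.smul_apply, inner_smul_right, smul_eq_mul]
      ring
    · rw [vharm_true, map_smul, h2.1, ContinuousMap.smul_apply, inner_smul_right, smul_eq_mul]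
      ring

/-- The integral runs over an interval of length 1 + t, which supplies one of the two factors lost
in dividing by (1+t)². -/
lemma abs_transFactor_sub_le {ψ φ : ℝ → ℝ} (hψ : ContinuousOn ψ (Set.Icc (-1) 1))
    (hφ : ContinuousOn φ (Set.Icc (-1) 1)) {ε : ℝ}
    (h : ∀ t ∈ Set.Icc (-1 : ℝ) 1, |ψ t - φ t| ≤ ε) {t : ℝ} (ht : t ∈ Set.Icc (-1 : ℝ) 1) :
    |transFactor ψ t - transFactor φ t| ≤ 2 * ε * (1 + t) := by
  have h1 : |∫ s in (-1 : ℝ)..t, (ψ s - φ s)| ≤ ε * |t - (-1)| := by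
    rw [← Real.norm_eq_abs]
    refine intervalIntegral.norm_integral_le_of_norm_le_const fun s hs => ?_
    rw [Real.norm_eq_abs]
    refine h s ?_
    rw [Set.uIoc_of_le ht.1] at hs
    exact ⟨hs.1.le, hs.2.trans ht.2⟩
  have h2 := h t ht
  have h3 : 0 ≤ 1 + t := by linarith [ht.1]
  have e : transFactor ψ t - transFactor φ t =
      (1 + t) * (ψ t - φ t) - ∫ s in (-1 : ℝ)..t, (ψ s - φ s) := by
    rw [intervalIntegral.integral_sub (intervalIntegrable_of_mem hψ ht)
      (intervalIntegrable_of_mem hφ ht), transFactor, transFactor]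
    ring
  rw [sub_neg_eq_add, add_comm t, abs_of_nonneg h3] at h1
  rw [e]
  calc _ ≤ |(1 + t) * (ψ t - φ t)| + |∫ s in (-1 : ℝ)..t, (ψ s - φ s)| := abs_sub _ _
    _ ≤ (1 + t) * ε + ε * (1 + t) := by
      rw [abs_mul, abs_of_nonneg h3]
      gcongr
    _ = 2 * ε * (1 + t) := by ring

/-- Supplies the other factor 1 + t: since v ⊥ y, x·v = (x+y)·v, and |x+y|² = 2(1+t). -/
lemma norm_transport_le (x y : S2) {v : E3} (hv : inner ℝ (y : E3) v = 0) :
    ‖(1 + inner ℝ (x : E3) (y : E3)) • v - inner ℝ (x : E3) v • ((x : E3) + (y : E3))‖ ≤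
      3 * (1 + inner ℝ (x : E3) (y : E3)) * ‖v‖ := by
  set t := inner ℝ (x : E3) (y : E3) with ht
  have h3 : 0 ≤ 1 + t := by linarith [neg_one_le_inner_sphere x y]
  have h4 : ‖(x : E3) + y‖ ^ 2 = 2 * (1 + t) := by
    rw [norm_add_sq_real, norm_sphere, norm_sphere, ← ht]; ring
  have h5 : |inner ℝ (x : E3) v| ≤ ‖(x : E3) + y‖ * ‖v‖ := by
    have := abs_real_inner_le_norm ((x : E3) + y) v
    rwa [inner_add_left, hv, add_zero] at this
  calc _ ≤ ‖(1 + t) • v‖ + ‖inner ℝ (x : E3) v • ((x : E3) + (y : E3))‖ := norm_sub_le _ _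
    _ ≤ (1 + t) * ‖v‖ + (‖(x : E3) + y‖ * ‖v‖) * ‖(x : E3) + y‖ := by
      rw [norm_smul, norm_smul, Real.norm_eq_abs, Real.norm_eq_abs, abs_of_nonneg h3]
      gcongr
    _ = 3 * (1 + t) * ‖v‖ := by linear_combination ‖v‖ * h4

lemma norm_kerVec_sub_le {ψ : ℝ → ℝ} (hψ : ContinuousOn ψ (Set.Icc (-1) 1))
    (hn : 2 * Real.pi * ∫ t in (-1 : ℝ)..1, ψ t = 1) {p : Polynomial ℝ} {ε : ℝ}
    (hp : ∀ t ∈ Set.Icc (-1 : ℝ) 1, |ψ t - p.eval t| ≤ ε) (y : S2) {v : E3}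
    (hv : inner ℝ (y : E3) v = 0) {w : C(S2, E3)}
    (hw : ∀ x : S2, (1 + inner ℝ (x : E3) (y : E3)) ^ 2 • w x =
      transFactor (fun t => p.eval t) (inner ℝ (x : E3) (y : E3)) •
      ((1 + inner ℝ (x : E3) (y : E3)) • v - inner ℝ (x : E3) v • ((x : E3) + (y : E3))))
    (hw0 : ∀ x : S2, inner ℝ (x : E3) (y : E3) = -1 → w x = 0) (x : S2) :
    ‖kerVec ψ y v x - w x‖ ≤ 6 * ε * ‖v‖ := by
  have hε : 0 ≤ ε := (abs_nonneg _).trans (hp 0 (by simp))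
  have h1 := kerVec_transport hψ hn x y hv
  have h2 := hw x
  have h3 := norm_transport_le x y hv
  have hm : inner ℝ (x : E3) (y : E3) ∈ Set.Icc (-1 : ℝ) 1 :=
    ⟨neg_one_le_inner_sphere x y, inner_sphere_le x y⟩
  have h4 := abs_transFactor_sub_le hψ p.continuous.continuousOn hp hm
  rcases eq_or_lt_of_le hm.1 with h | h
  · rw [kerVec_antipode ψ x y hv h.symm, hw0 x h.symm, sub_zero, norm_zero]
    positivity
  set t := inner ℝ (x : E3) (y : E3)
  have ht : 0 < 1 + t := by linarith
  have h5 : (1 + t) ^ 2 * ‖kerVec ψ y v x - w x‖ ≤ (1 + t) ^ 2 * (6 * ε * ‖v‖) := by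
    calc (1 + t) ^ 2 * ‖kerVec ψ y v x - w x‖ = ‖(1 + t) ^ 2 • (kerVec ψ y v x - w x)‖ := by
          rw [norm_smul, Real.norm_eq_abs, abs_of_nonneg (by positivity)]
      _ = |transFactor ψ t - transFactor (fun t => p.eval t) t| *
          ‖(1 + t) • v - inner ℝ (x : E3) v • ((x : E3) + (y : E3))‖ := by
          rw [smul_sub, h1, h2, ← sub_smul, norm_smul, Real.norm_eq_abs]
      _ ≤ (2 * ε * (1 + t)) * (3 * (1 + t) * ‖v‖) := by gcongr
      _ = _ := by ring
  exact le_of_mul_le_mul_left h5 (by positivity)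

lemma abs_zonalCoeff_sub_le {ψ : ℝ → ℝ} (hψ : ContinuousOn ψ (Set.Icc (-1) 1)) (l : ℕ) :
    ∃ M, ∀ (p : Polynomial ℝ) (ε : ℝ), (∀ t ∈ Set.Icc (-1 : ℝ) 1, |ψ t - p.eval t| ≤ ε) →
      |zonalCoeff ψ l - zonalCoeff (fun t => p.eval t) l| ≤ ε * M := by
  obtain ⟨B, hB⟩ := (isCompact_Icc (a := (-1 : ℝ)) (b := 1)).exists_bound_of_continuousOn
    (legendre l).continuous.continuousOn
  refine ⟨2 * Real.pi * (B * 2), fun p ε hp => ?_⟩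
  have hε : 0 ≤ ε := (abs_nonneg _).trans (hp 0 (by simp))
  have hi : ∀ {φ : ℝ → ℝ}, ContinuousOn φ (Set.Icc (-1) 1) →
      IntervalIntegrable (fun t => φ t * (legendre l).eval t) volume (-1) 1 := fun hφ =>
    intervalIntegrable_of_mem (hφ.mul (legendre l).continuous.continuousOn) (by simp)
  have e : zonalCoeff ψ l - zonalCoeff (fun t => p.eval t) l =
      2 * Real.pi * ∫ t in (-1 : ℝ)..1, (ψ t - p.eval t) * (legendre l).eval t := by
    rw [zonalCoeff, zonalCoeff, ← mul_sub,
      ← intervalIntegral.integral_sub (hi hψ) (hi p.continuous.continuousOn)]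
    simp only [sub_mul]
  have h1 : |∫ t in (-1 : ℝ)..1, (ψ t - p.eval t) * (legendre l).eval t| ≤
      ε * B * |1 - (-1 : ℝ)| := by
    rw [← Real.norm_eq_abs]
    refine intervalIntegral.norm_integral_le_of_norm_le_const fun s hs => ?_
    rw [Set.uIoc_of_le (by norm_num : (-1 : ℝ) ≤ 1)] at hs
    have hs' : s ∈ Set.Icc (-1 : ℝ) 1 := ⟨hs.1.le, hs.2⟩
    rw [norm_mul, Real.norm_eq_abs]
    exact mul_le_mul (hp s hs') (hB s hs') (norm_nonneg _) hε
  rw [e, abs_mul, abs_of_pos Real.two_pi_pos]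
  calc _ ≤ 2 * Real.pi * (ε * B * |1 - (-1 : ℝ)|) := by gcongr
    _ = _ := by norm_num; ring

/-- The kernel fields are continuous, and the kernel acts on vector spherical harmonics by
multiplication with the Fourier-Legendre coefficients. -/
theorem exists_kerField {ψ : ℝ → ℝ} (hψ : ContinuousOn ψ (Set.Icc (-1) 1))
    (hn : 2 * Real.pi * ∫ t in (-1 : ℝ)..1, ψ t = 1) (y : S2) {v : E3}
    (hv : inner ℝ (y : E3) v = 0) : ∃ w : C(S2, E3), (∀ x : S2, w x = kerVec ψ y v x) ∧
      ∀ l, 0 < l → ∀ m b, ip w (vharm ⟨l, m, b⟩) =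
        zonalCoeff ψ l * inner ℝ v (vharm ⟨l, m, b⟩ y) := by
  have hp : ∀ n : ℕ, ∃ p : Polynomial ℝ, ∀ t ∈ Set.Icc (-1 : ℝ) 1,
      |ψ t - p.eval t| ≤ 1 / ((n : ℝ) + 1) := by
    intro n
    obtain ⟨p, h⟩ := exists_polynomial_near_of_continuousOn (-1) 1 ψ hψ (1 / ((n : ℝ) + 1))
      Nat.one_div_pos_of_nat
    exact ⟨p, fun t ht => by rw [abs_sub_comm]; exact (h t ht).le⟩
  choose p hp using hp
  choose w hw hw0 hwi using fun n => exists_polynomial_field (p n) y hv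
  have hb : ∀ n (x : S2), ‖kerVec ψ y v x - w n x‖ ≤ 6 * (1 / ((n : ℝ) + 1)) * ‖v‖ := fun n x =>
    norm_kerVec_sub_le hψ hn (hp n) y hv (hw n) (hw0 n) x
  have h0 : Filter.Tendsto (fun n : ℕ => 6 * (1 / ((n : ℝ) + 1)) * ‖v‖) Filter.atTop (nhds 0) := by
    simpa using (tendsto_one_div_add_atTop_nhds_zero_nat.const_mul (6 : ℝ)).mul_const ‖v‖
  -- The polynomial fields converge uniformly to the kernel field, so continuity and all Fourier
  -- coefficients pass to the limit.
  have hu : TendstoUniformly (fun n x => w n x) (fun x : S2 => kerVec ψ y v x) Filter.atTop := by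
    rw [Metric.tendstoUniformly_iff]
    intro ε hε
    filter_upwards [h0.eventually (gt_mem_nhds hε)] with n h x
    rw [dist_eq_norm]
    exact (hb n x).trans_lt h
  have hc : Continuous fun x : S2 => kerVec ψ y v x :=
    hu.continuous (Filter.Eventually.of_forall fun n => (w n).continuous).frequently
  refine ⟨⟨_, hc⟩, fun x => rfl, fun l hl m b => ?_⟩
  have h1 : Filter.Tendsto w Filter.atTop (nhds ⟨_, hc⟩) :=
    ContinuousMap.tendsto_iff_tendstoUniformly.2 hu
  have h2 := ((continuous_ip_left (vharm ⟨l, m, b⟩)).tendsto _).comp h1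
  obtain ⟨M, hM⟩ := abs_zonalCoeff_sub_le hψ l
  have h3 : Filter.Tendsto (fun n => zonalCoeff (fun t => (p n).eval t) l) Filter.atTop
      (nhds (zonalCoeff ψ l)) := by
    rw [tendsto_iff_dist_tendsto_zero]
    refine squeeze_zero (fun _ => dist_nonneg) (fun n => ?_)
      (by simpa using (tendsto_one_div_add_atTop_nhds_zero_nat (𝕜 := ℝ)).mul_const M)
    rw [dist_comm, Real.dist_eq]
    exact (hM _ _ (hp n)).trans_eq (by ring)
  refine tendsto_nhds_unique h2 ?_
  refine (h3.mul_const (inner ℝ v (vharm ⟨l, m, b⟩ y))).congr fun n => ?_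
  exact (hwi n l hl m b).symm

end Kernel

/-! ### Quadrature errors and the quasi-interpolant -/

section QuasiInterpolant

/-- The error of the equal-weight quadrature. -/
noncomputable def quadErr {N : ℕ} (X : Fin N → S2) : C(S2, ℝ) →ₗ[ℝ] ℝ where
  toFun h := (∫ x, h x ∂surf) - quad X h
  map_add' h k := by
    have : ∫ x, (h + k) x ∂surf = (∫ x, h x ∂surf) + ∫ x, k x ∂surf :=
      integral_add (integrable_of_continuous h.continuous) (integrable_of_continuous k.continuous)
    rw [this]
    simp only [quad, ContinuousMap.add_apply, Finset.sum_add_distrib]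
    ring
  map_smul' c h := by
    have : ∫ x, (c • h) x ∂surf = c * ∫ x, h x ∂surf := integral_const_mul c _
    rw [this]
    simp only [quad, ContinuousMap.smul_apply, smul_eq_mul, ← Finset.mul_sum, RingHom.id_apply]
    ring

lemma quadErr_dotF {N : ℕ} (X : Fin N → S2) (u v : C(S2, E3)) :
    quadErr X (dotF u v) = ip u v - quad X (dotF u v) := rfl

lemma quadErr_dotF_sum {N : ℕ} (X : Fin N → S2) (u : C(S2, E3)) {ι : Type*} (s : Finset ι)
    (c : ι → ℝ) (e : ι → C(S2, E3)) :
    quadErr X (dotF u (∑ i ∈ s, c i • e i)) = ∑ i ∈ s, c i * quadErr X (dotF u (e i)) := by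
  have : dotF u (∑ i ∈ s, c i • e i) = ∑ i ∈ s, c i • dotF u (e i) := by
    ext x
    simp [dotF_apply, inner_sum, inner_smul_right]
  rw [this, map_sum]
  simp only [map_smul, smul_eq_mul]

/-- The quasi-interpolant of a continuous tangential field and its Fourier coefficients. -/
lemma exists_quasiInterp {ψ : ℝ → ℝ} (hψ : ContinuousOn ψ (Set.Icc (-1) 1))
    (hn : 2 * Real.pi * ∫ t in (-1 : ℝ)..1, ψ t = 1) {N : ℕ} (X : Fin N → S2) {u : C(S2, E3)}
    (hu : IsTangential u) : ∃ w : C(S2, E3), (∀ x, w x = quasiInterp ψ X u x) ∧ IsTangential w ∧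
      ∀ l, 0 < l → ∀ m b, ip w (vharm ⟨l, m, b⟩) =
        zonalCoeff ψ l * quad X (dotF u (vharm ⟨l, m, b⟩)) := by
  -- One kernel field per node; averaging their coefficients turns the pairings at the nodes into
  -- the quadrature of the product of u and the harmonic.
  choose k hk hki using fun j => exists_kerField hψ hn (X j) (hu (X j))
  refine ⟨(4 * Real.pi / N) • ∑ j, k j, fun x => ?_, fun x => ?_, fun l hl m b => ?_⟩
  · rw [ContinuousMap.smul_apply, ContinuousMap.sum_apply]
    simp only [hk]
    rfl
  · rw [ContinuousMap.smul_apply, ContinuousMap.sum_apply, inner_smul_right, inner_sum]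
    simp only [hk, inner_kerVec ψ x _ (hu _), Finset.sum_const_zero, mul_zero]
  · rw [map_smul, map_sum, LinearMap.smul_apply, LinearMap.sum_apply]
    simp only [hki _ l hl, quad, dotF_apply, smul_eq_mul, ← Finset.mul_sum]
    ring

/-- The Sobolev norm of a finite expansion in vector spherical harmonics. -/
lemma sobSq_sum_vharm (s : ℝ) (c : VIdx → ℝ) (L : ℕ) :
    (Summable fun l : ℕ => wpow s (∑ i ∈ vidx 0 L, c i • vharm i) (l + 1)) ∧
      sobSq s (∑ i ∈ vidx 0 L, c i • vharm i) =
        ∑ l ∈ Finset.Ioc 0 L, onePlusEig l ^ s * ∑ m ∈ orders l, ∑ b : Bool, c ⟨l, m, b⟩ ^ 2 := by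
  set g := ∑ i ∈ vidx 0 L, c i • vharm i with hg
  have hin : ∀ l ∈ Finset.Ioc 0 L, wpow s g l =
      onePlusEig l ^ s * ∑ m ∈ orders l, ∑ b : Bool, c ⟨l, m, b⟩ ^ 2 := by
    intro l hl
    rw [wpow, vpow]
    congr 1
    refine Finset.sum_congr rfl fun m hm => Finset.sum_congr rfl fun b _ => ?_
    have hi : (⟨l, m, b⟩ : VIdx) ∈ vidx 0 L := mem_vidx.2 ⟨Finset.mem_Ioc.1 hl, hm⟩
    rw [hg, (orthonormalOn_vharm 0 L).apply_sum_left c hi]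
  have hout : ∀ l, L < l → wpow s g l = 0 := by
    intro l hl
    rw [wpow, vpow, Finset.sum_eq_zero, mul_zero]
    refine fun m hm => Finset.sum_eq_zero fun b _ => ?_
    rw [hg, map_sum, LinearMap.sum_apply, Finset.sum_eq_zero, zero_pow two_ne_zero]
    intro i hi
    have hi' := mem_vidx.1 hi
    have h1 : i ∈ vidx 0 l := mem_vidx.2 ⟨⟨hi'.1.1, hi'.1.2.trans hl.le⟩, hi'.2⟩
    have h2 : (⟨l, m, b⟩ : VIdx) ∈ vidx 0 l :=
      mem_vidx.2 ⟨⟨(Nat.zero_le L).trans_lt hl, le_rfl⟩, hm⟩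
    have h3 : i ≠ ⟨l, m, b⟩ := by
      rintro rfl
      exact absurd hi'.1.2 (not_le.2 hl)
    rw [map_smul, LinearMap.smul_apply, (orthonormalOn_vharm 0 l).2 i h1 _ h2 h3, smul_zero]
  have hs : ∀ l ∉ Finset.range L, wpow s g (l + 1) = 0 := fun l hl =>
    hout _ (by rw [Finset.mem_range] at hl; omega)
  refine ⟨summable_of_ne_finset_zero hs, ?_⟩
  rw [sobSq, tsum_eq_sum hs, ← Finset.sum_congr rfl hin, Finset.range_eq_Ico,
    Finset.sum_Ico_add' (wpow s g) 0 L 1]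
  rfl

lemma memLp_of_continuous {E : Type*} [NormedAddCommGroup E] (f : C(S2, E)) : MemLp f 2 surf := by
  refine MemLp.of_bound f.continuous.aestronglyMeasurable_of_compactSpace ‖f‖
    (Filter.Eventually.of_forall f.norm_coe_le_norm)

lemma sobTerm_eq (s : ℝ) (h : C(S2, ℝ)) (l : ℕ) : sobTerm s h l = onePlusEig l ^ s * spow h l := by
  simp only [sobTerm, spow, VecQI.coeff, ip_apply, sharm, polyF_apply, sphHarm_eq]
  congr 1
  refine Finset.sum_congr rfl fun m _ => ?_
  congr 2
  ext x
  simp [mul_comm]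

/-- The squared moduli, summed over one degree, of the quadrature errors of the products with
vector spherical harmonics. -/
noncomputable def errPow {N : ℕ} (X : Fin N → S2) (u : C(S2, E3)) (l : ℕ) : ℝ :=
  ∑ m ∈ orders l, ∑ b : Bool, quadErr X (dotF u (vharm ⟨l, m, b⟩)) ^ 2

lemma errPow_nonneg {N : ℕ} (X : Fin N → S2) (u : C(S2, E3)) (l : ℕ) : 0 ≤ errPow X u l :=
  Finset.sum_nonneg fun _ _ => Finset.sum_nonneg fun _ _ => sq_nonneg _

/-- A duality estimate for the quadrature errors, damped by multipliers `z`. -/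
lemma sum_errPow_le {σ τ : ℝ} (hσ : 1 < σ) {N : ℕ} {X : Fin N → S2} {δ : ℝ}
    (hX : ∀ f : S2 → ℝ, Continuous f → MemSobolev σ f →
      |(∫ x, f x ∂surf) - quad X f| ≤ δ * sobNorm σ f)
    {u : C(S2, E3)} (hut : IsTangential u) (hu : Summable fun l : ℕ => wpow σ u (l + 1))
    {z : ℕ → ℝ} {A : ℝ} (hz : ∀ l, 0 < l → z l ^ 2 * onePlusEig l ^ (τ + σ) ≤ A) (L : ℕ) :
    ∑ l ∈ Finset.Ioc 0 L, onePlusEig l ^ τ * (z l ^ 2 * errPow X u l) ≤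
      δ ^ 2 * prodConst σ * A * sobSq σ u := by
  have hA : 0 ≤ A := (mul_nonneg (sq_nonneg _)
    (Real.rpow_nonneg (onePlusEig_pos 1).le _)).trans (hz 1 one_pos)
  set S := ∑ l ∈ Finset.Ioc 0 L, onePlusEig l ^ τ * (z l ^ 2 * errPow X u l) with hS
  have hS0 : 0 ≤ S := Finset.sum_nonneg fun l _ =>
    mul_nonneg (Real.rpow_nonneg (onePlusEig_pos l).le _)
      (mul_nonneg (sq_nonneg _) (errPow_nonneg X u l))
  -- The dual field is chosen so that the quadrature error of u·g reproduces the sum S itself.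
  set c : VIdx → ℝ := fun i =>
    onePlusEig i.1 ^ τ * z i.1 ^ 2 * quadErr X (dotF u (vharm i)) with hc
  set g := ∑ i ∈ vidx 0 L, c i • vharm i with hg
  obtain ⟨hgs, hgn⟩ := sobSq_sum_vharm σ c L
  rw [← hg] at hgs hgn
  have hgt : IsTangential g := by
    intro x
    rw [hg, ContinuousMap.sum_apply, inner_sum]
    refine Finset.sum_eq_zero fun i _ => ?_
    rw [ContinuousMap.smul_apply, inner_smul_right, inner_self_vharm, mul_zero]
  have h1 : quadErr X (dotF u g) = S := by
    rw [hg, quadErr_dotF_sum, sum_vidx, hS]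
    refine Finset.sum_congr rfl fun l _ => ?_
    simp only [errPow, Finset.mul_sum, hc]
    refine Finset.sum_congr rfl fun m _ => Finset.sum_congr rfl fun b _ => ?_
    ring
  -- The square of a coefficient of g carries z⁴ and weight 2τ; together with weight σ this is the
  -- factor bounded by A times a term of S.
  have h2 : sobSq σ g ≤ A * S := by
    rw [hgn, hS, Finset.mul_sum]
    refine Finset.sum_le_sum fun l hl => ?_
    have ho := onePlusEig_pos l
    have e : onePlusEig l ^ σ * ∑ m ∈ orders l, ∑ b : Bool, c ⟨l, m, b⟩ ^ 2 =
        (z l ^ 2 * onePlusEig l ^ (τ + σ)) * (onePlusEig l ^ τ * (z l ^ 2 * errPow X u l)) := by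
      rw [Real.rpow_add ho]
      simp only [hc, mul_pow, ← Finset.mul_sum]
      rw [errPow]
      ring
    rw [e]
    exact mul_le_mul_of_nonneg_right (hz l (Finset.mem_Ioc.1 hl).1)
      (mul_nonneg (Real.rpow_nonneg ho.le _) (mul_nonneg (sq_nonneg _) (errPow_nonneg X u l)))
  obtain ⟨h3, h4⟩ := sobolev_dotF hσ hut hgt hu hgs
  have h5 : S ≤ δ * sobNorm σ (dotF u g) := by
    rw [← h1]
    refine (le_abs_self _).trans (hX _ (dotF u g).continuous ⟨memLp_of_continuous _, ?_⟩)
    simpa only [funext (sobTerm_eq σ (dotF u g))] using h3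
  have h6 : sobNorm σ (dotF u g) ^ 2 ≤ prodConst σ * (sobSq σ u * (A * S)) := by
    simp only [sobNorm, sobTerm_eq]
    rw [Real.sq_sqrt (tsum_nonneg fun l => mul_nonneg
      (Real.rpow_nonneg (onePlusEig_pos l).le _) (spow_nonneg _ _))]
    refine h4.trans ?_
    have := sobSq_nonneg σ u
    have := prodConst_nonneg σ
    gcongr
  -- The chain gives S² ≤ const · S, and S > 0 is needed to cancel.
  rcases hS0.eq_or_lt with h0 | h0
  · rw [← h0]
    have := sobSq_nonneg σ u
    have := prodConst_nonneg σ
    positivity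
  · refine le_of_mul_le_mul_right ?_ h0
    calc S * S ≤ (δ * sobNorm σ (dotF u g)) * (δ * sobNorm σ (dotF u g)) :=
          mul_self_le_mul_self hS0 h5
      _ = δ ^ 2 * sobNorm σ (dotF u g) ^ 2 := by ring
      _ ≤ δ ^ 2 * (prodConst σ * (sobSq σ u * (A * S))) := by gcongr
      _ = _ := by ring

/-- The error estimate in terms of bounds for the multipliers. -/
lemma sobSq_sub_quasiInterp_le {σ τ : ℝ} (hσ : 1 < σ) {N : ℕ} {X : Fin N → S2} {δ : ℝ}
    (hX : ∀ f : S2 → ℝ, Continuous f → MemSobolev σ f →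
      |(∫ x, f x ∂surf) - quad X f| ≤ δ * sobNorm σ f)
    {u w : C(S2, E3)} (hut : IsTangential u) (hu : Summable fun l : ℕ => wpow σ u (l + 1))
    {z : ℕ → ℝ} (hw : ∀ l, 0 < l → ∀ m b, ip w (vharm ⟨l, m, b⟩) =
      z l * quad X (dotF u (vharm ⟨l, m, b⟩)))
    {A B : ℝ} (hA : ∀ l, 0 < l → z l ^ 2 * onePlusEig l ^ (τ + σ) ≤ A)
    (hB : ∀ l, 0 < l → (1 - z l) ^ 2 * onePlusEig l ^ τ ≤ B * onePlusEig l ^ σ) :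
    (Summable fun l : ℕ => wpow τ (u - w) (l + 1)) ∧
      sobSq τ (u - w) ≤ 2 * (B + δ ^ 2 * prodConst σ * A) * sobSq σ u := by
  have hc : ∀ l, 0 < l → vpow (u - w) l ≤
      2 * ((1 - z l) ^ 2 * vpow u l) + 2 * (z l ^ 2 * errPow X u l) := by
    intro l hl
    simp only [vpow, errPow, Finset.mul_sum, ← Finset.sum_add_distrib]
    refine Finset.sum_le_sum fun m _ => Finset.sum_le_sum fun b _ => ?_
    rw [map_sub, LinearMap.sub_apply, hw l hl, quadErr_dotF]
    set a := ip u (vharm ⟨l, m, b⟩)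
    set q := quad X (dotF u (vharm ⟨l, m, b⟩))
    -- The error coefficient is (1-z)a + z(a-q); its square is bounded by twice the sum of the
    -- squares.
    linarith [sq_nonneg ((1 - z l) * a - z l * (a - q)),
      show (a - z l * q) ^ 2 + ((1 - z l) * a - z l * (a - q)) ^ 2 =
        2 * ((1 - z l) ^ 2 * a ^ 2) + 2 * (z l ^ 2 * (a - q) ^ 2) by ring]
  have hb : ∀ L, ∑ l ∈ Finset.range L, wpow τ (u - w) (l + 1) ≤
      2 * (B + δ ^ 2 * prodConst σ * A) * sobSq σ u := by
    intro L
    have e : ∀ f : ℕ → ℝ, ∑ l ∈ Finset.range L, f (l + 1) = ∑ l ∈ Finset.Ioc 0 L, f l := by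
      intro f
      rw [Finset.range_eq_Ico, Finset.sum_Ico_add' f 0 L 1]
      rfl
    have h1 : ∀ l ∈ Finset.Ioc 0 L, wpow τ (u - w) l ≤
        2 * (B * wpow σ u l) + 2 * (onePlusEig l ^ τ * (z l ^ 2 * errPow X u l)) := by
      intro l hl
      have hl' := (Finset.mem_Ioc.1 hl).1
      calc wpow τ (u - w) l ≤ onePlusEig l ^ τ *
            (2 * ((1 - z l) ^ 2 * vpow u l) + 2 * (z l ^ 2 * errPow X u l)) :=
            mul_le_mul_of_nonneg_left (hc l hl') (Real.rpow_nonneg (onePlusEig_pos l).le _)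
        _ = 2 * ((1 - z l) ^ 2 * onePlusEig l ^ τ * vpow u l) +
            2 * (onePlusEig l ^ τ * (z l ^ 2 * errPow X u l)) := by ring
        _ ≤ 2 * (B * onePlusEig l ^ σ * vpow u l) +
            2 * (onePlusEig l ^ τ * (z l ^ 2 * errPow X u l)) := by
            have := mul_le_mul_of_nonneg_right (hB l hl') (vpow_nonneg u l)
            linarith
        _ = _ := by rw [wpow]; ring
    have hB0 : 0 ≤ B := by
      refine nonneg_of_mul_nonneg_left ?_ (Real.rpow_pos_of_pos (onePlusEig_pos 1) σ)
      exact (mul_nonneg (sq_nonneg _) (Real.rpow_nonneg (onePlusEig_pos 1).le _)).trans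
        (hB 1 one_pos)
    have h2 : ∑ l ∈ Finset.Ioc 0 L, wpow σ u l ≤ sobSq σ u := by
      rw [← e]
      exact hu.sum_le_tsum _ fun l _ => wpow_nonneg σ u _
    have h3 := sum_errPow_le hσ hX hut hu hA L
    rw [e (wpow τ (u - w))]
    refine (Finset.sum_le_sum h1).trans ?_
    rw [Finset.sum_add_distrib, ← Finset.mul_sum, ← Finset.mul_sum, ← Finset.mul_sum]
    have h4 := mul_le_mul_of_nonneg_left h2 hB0
    linarith
  have hn := fun l : ℕ => wpow_nonneg τ (u - w) (l + 1)
  exact ⟨summable_of_sum_range_le hn hb, Real.tsum_le_of_sum_range_le hn hb⟩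

end QuasiInterpolant

/-! ### Bounds for the multipliers -/

section Multipliers

/-- The square root of `1 + λ_l`. -/
noncomputable def sobRoot (l : ℕ) : ℝ := Real.sqrt (onePlusEig l)

lemma sobRoot_pos (l : ℕ) : 0 < sobRoot l := Real.sqrt_pos.2 (onePlusEig_pos l)

lemma onePlusEig_rpow (l : ℕ) (s : ℝ) : onePlusEig l ^ s = (sobRoot l ^ s) ^ 2 := by
  rw [Real.rpow_pow_comm (sobRoot_pos l).le, sobRoot, Real.sq_sqrt (onePlusEig_pos l).le]

lemma le_sobRoot (l : ℕ) : (l : ℝ) ≤ sobRoot l :=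
  Real.le_sqrt_of_sq_le (by rw [onePlusEig]; nlinarith [(Nat.cast_nonneg l : (0 : ℝ) ≤ l)])

lemma sobRoot_le (l : ℕ) : sobRoot l ≤ l + 1 :=
  Real.sqrt_le_iff.2 ⟨by positivity,
    by rw [onePlusEig]; nlinarith [(Nat.cast_nonneg l : (0 : ℝ) ≤ l)]⟩

lemma one_le_sobRoot (l : ℕ) : 1 ≤ sobRoot l := Real.one_le_sqrt.2 (one_le_onePlusEig l)

/-- Because ρ < 1, ρ√(1+λ_l) ≤ ρ(l+1) ≤ 1 + ρl, so the assumed decay absorbs the weight at the cost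
of ρ^(-s). -/
lemma sq_mul_onePlusEig_le {z c ρ s : ℝ} (hρ : 0 < ρ) (hρ1 : ρ < 1) (hc : 0 < c) (hs : 0 ≤ s)
    {l : ℕ} (hz : |z| ≤ c * (1 + ρ * l) ^ (-s)) :
    z ^ 2 * onePlusEig l ^ s ≤ (c * ρ ^ (-s)) ^ 2 := by
  have hr := sobRoot_pos l
  have h1 : ρ * sobRoot l ≤ 1 + ρ * l := by
    nlinarith [mul_le_mul_of_nonneg_left (sobRoot_le l) hρ.le]
  have h2 : |z| * sobRoot l ^ s ≤ c * ρ ^ (-s) := by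
    calc |z| * sobRoot l ^ s ≤ c * (1 + ρ * l) ^ (-s) * sobRoot l ^ s := by gcongr
      _ ≤ c * (ρ * sobRoot l) ^ (-s) * sobRoot l ^ s := by
        have := Real.rpow_le_rpow_of_nonpos (by positivity) h1 (neg_nonpos.2 hs)
        gcongr
      _ = c * ρ ^ (-s) * (sobRoot l ^ (-s) * sobRoot l ^ s) := by
        rw [Real.mul_rpow hρ.le hr.le]; ring
      _ = c * ρ ^ (-s) := by rw [← Real.rpow_add hr, neg_add_cancel, Real.rpow_zero, mul_one]
  rw [onePlusEig_rpow, ← sq_abs z, ← mul_pow]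
  gcongr

/-- In low degrees lρ ≤ 1, so the exponent σ may be lowered to σ - τ. Otherwise ρ√(1+λ_l) is bounded
below, and the uniform bound on |1 - z_l| from the decay suffices. -/
lemma exists_abs_one_sub_zonalCoeff_le {ψ : ℝ → ℝ → ℝ} {σ τ : ℝ} (hτ : 0 ≤ τ) (hτσ : τ ≤ σ)
    (ho : HasOrder ψ σ) (hd : HasDecay ψ (τ + σ)) :
    ∃ C ≥ 0, ∀ ρ, 0 < ρ → ρ < 1 → ∀ l : ℕ, 0 < l →
      |1 - zonalCoeff (ψ ρ) l| ≤ C * (ρ * sobRoot l) ^ (σ - τ) := by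
  obtain ⟨ρ₀, hρ₀, -, c₁, hc₁, c₂, -, ho⟩ := ho
  obtain ⟨c, hc, hd⟩ := hd
  -- A lower bound for ρ√(1+λ_l) outside the low-degree case: from ρ(l+1) > 1 and l ≥ 1 one gets ρl
  -- ≥ 1/2, and for ρ ≥ ρ₀ it is at least ρ₀.
  set q := min ρ₀ (1 / 2) with hq
  have hq0 : 0 < q := lt_min hρ₀ (by norm_num)
  have hδ : 0 ≤ σ - τ := sub_nonneg.2 hτσ
  have hq1 : 0 < q ^ (σ - τ) := Real.rpow_pos_of_pos hq0 _
  refine ⟨c₁ + (1 + c) / q ^ (σ - τ), by positivity, fun ρ hρ hρ1 l hl => ?_⟩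
  have hl' : (1 : ℝ) ≤ l := by exact_mod_cast hl
  have hr := sobRoot_pos l
  have hp : 0 ≤ (ρ * sobRoot l) ^ (σ - τ) := by positivity
  have hb : |1 - zonalCoeff (ψ ρ) l| ≤ 1 + c := by
    have h1 := hd ρ hρ hρ1 l hl
    have h2 : (1 + ρ * (l : ℝ)) ^ (-(τ + σ)) ≤ 1 :=
      Real.rpow_le_one_of_one_le_of_nonpos (by nlinarith) (by linarith)
    calc _ ≤ |(1 : ℝ)| + |zonalCoeff (ψ ρ) l| := abs_sub _ _
      _ ≤ 1 + c * 1 := by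
        rw [abs_one]
        exact add_le_add le_rfl (h1.trans (mul_le_mul_of_nonneg_left h2 hc.le))
      _ = 1 + c := by ring
  by_cases hcase : ρ < ρ₀ ∧ l ≤ ⌊ρ⁻¹ - 1⌋₊
  · have h1 := (ho ρ hρ hcase.1).1 l hcase.2
    have h2 : (l : ℝ) ≤ ρ⁻¹ - 1 := (Nat.le_floor_iff' hl.ne').1 hcase.2
    have h3 : (l : ℝ) * ρ ≤ 1 := by
      have : (l : ℝ) ≤ ρ⁻¹ := by linarith
      calc (l : ℝ) * ρ ≤ ρ⁻¹ * ρ := by gcongr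
        _ = 1 := inv_mul_cancel₀ hρ.ne'
    have h4 : ((l : ℝ) * ρ) ^ σ ≤ (ρ * sobRoot l) ^ (σ - τ) := by
      calc ((l : ℝ) * ρ) ^ σ ≤ ((l : ℝ) * ρ) ^ (σ - τ) :=
            Real.rpow_le_rpow_of_exponent_ge (by positivity) h3 (by linarith)
        _ ≤ (ρ * sobRoot l) ^ (σ - τ) := by
            rw [mul_comm]
            have := le_sobRoot l
            gcongr
    have h5 : 0 ≤ (1 + c) / q ^ (σ - τ) * (ρ * sobRoot l) ^ (σ - τ) := by positivity
    have h6 := mul_le_mul_of_nonneg_left h4 hc₁.le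
    linarith
  · have h1 : q ≤ ρ * sobRoot l := by
      rcases lt_or_ge ρ ρ₀ with h | h
      · have h2 : ρ⁻¹ - 1 < l := (Nat.floor_lt' hl.ne').1 (not_le.1 fun h' => hcase ⟨h, h'⟩)
        have h3 : 1 < ρ * (l + 1) := by
          calc 1 = ρ * ρ⁻¹ := (mul_inv_cancel₀ hρ.ne').symm
            _ < ρ * (l + 1) := by gcongr; linarith
        have h4 := mul_le_mul_of_nonneg_left (le_sobRoot l) hρ.le
        have h5 := min_le_right ρ₀ (1 / 2)
        nlinarith
      · have h2 := mul_le_mul_of_nonneg_left (one_le_sobRoot l) hρ.le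
        have h5 := min_le_left ρ₀ (1 / 2)
        linarith
    have h2 : q ^ (σ - τ) ≤ (ρ * sobRoot l) ^ (σ - τ) := Real.rpow_le_rpow hq0.le h1 hδ
    calc _ ≤ 1 + c := hb
      _ = (1 + c) / q ^ (σ - τ) * q ^ (σ - τ) := by field_simp
      _ ≤ (1 + c) / q ^ (σ - τ) * (ρ * sobRoot l) ^ (σ - τ) := by gcongr
      _ ≤ _ := by
        have := mul_nonneg hc₁.le hp
        rw [add_mul]
        linarith

lemma sq_one_sub_mul_onePlusEig_le {z C ρ σ τ : ℝ} (hρ : 0 < ρ) {l : ℕ}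
    (hz : |1 - z| ≤ C * (ρ * sobRoot l) ^ (σ - τ)) :
    (1 - z) ^ 2 * onePlusEig l ^ τ ≤ (C * ρ ^ (σ - τ)) ^ 2 * onePlusEig l ^ σ := by
  have hr := sobRoot_pos l
  rw [onePlusEig_rpow, onePlusEig_rpow, ← sq_abs (1 - z), ← mul_pow, ← mul_pow]
  have e : C * ρ ^ (σ - τ) * sobRoot l ^ σ = C * (ρ * sobRoot l) ^ (σ - τ) * sobRoot l ^ τ := by
    rw [Real.mul_rpow hρ.le hr.le, ← mul_assoc, mul_assoc _ _ (sobRoot l ^ τ), ← Real.rpow_add hr,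
      sub_add_cancel]
  rw [e]
  gcongr

end Multipliers

end VecQI

/-! ### The error estimate -/

theorem mainTheorem7 (σ τ : ℝ) (hσ : 1 < σ) (hτ : 0 ≤ τ) (hτσ : τ ≤ σ)
    (N : ℕ → ℕ) (X : ∀ n, Fin (N n) → VecQI.S2) (hX : VecQI.IsQMCDesign σ N X)
    (ψ : ℝ → ℝ → ℝ) (hψ : VecQI.IsZonalFamily ψ)
    (hψ_order : VecQI.HasOrder ψ σ) (hψ_decay : VecQI.HasDecay ψ (τ + σ)) :
    ∃ C > 0, ∀ ρ, 0 < ρ → ρ < 1 → ∀ n, ∀ f : VecQI.S2 → VecQI.E3,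
      Continuous f → VecQI.MemVecSobolev σ f →
        VecQI.MemVecSobolev τ (fun x => f x - VecQI.quasiInterp (ψ ρ) (X n) f x) ∧
        VecQI.vecSobNorm τ (fun x => f x - VecQI.quasiInterp (ψ ρ) (X n) f x) ≤
          C * (ρ ^ (σ - τ) + ρ ^ (-(τ + σ)) * (N n : ℝ) ^ (-(σ / 2))) * VecQI.vecSobNorm σ f := by
  open VecQI in
  obtain ⟨c, hc, hX⟩ := hX.bound
  obtain ⟨C, hC, hM⟩ := exists_abs_one_sub_zonalCoeff_le hτ hτσ hψ_order hψ_decay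
  obtain ⟨d, hd, hdec⟩ := hψ_decay
  have hK := prodConst_nonneg σ
  set K := prodConst σ with hK'
  -- Here 1 + K replaces √K, since K ≤ (1+K)². The factor 2 absorbs 2(p² + q²) ≤ (2M)² for p, q ≤ M.
  refine ⟨2 * (C + c * (1 + K) * d), by positivity, fun ρ hρ hρ1 n f hf hfs => ?_⟩
  set u : C(S2, E3) := ⟨f, hf⟩ with hu
  have hut : IsTangential u := hfs.1
  have hus : Summable fun l : ℕ => wpow σ u (l + 1) := by
    have := hfs.2.2
    simpa only [← hu, show f = u from rfl, vecSobTerm_eq, wpow] using this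
  obtain ⟨w, hw, hwt, hwi⟩ := exists_quasiInterp (hψ.cont ρ hρ hρ1) (hψ.normalized ρ hρ hρ1)
    (X n) hut
  have e : (fun x => f x - quasiInterp (ψ ρ) (X n) f x) = (u - w : C(S2, E3)) := by
    ext1 x
    rw [ContinuousMap.sub_apply, hw]
    rfl
  obtain ⟨h1, h2⟩ := sobSq_sub_quasiInterp_le (τ := τ) hσ (hX n) hut hus
    (z := zonalCoeff (ψ ρ)) hwi
    (fun l hl => sq_mul_onePlusEig_le hρ hρ1 hd (by linarith) (hdec ρ hρ hρ1 l hl))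
    (fun l hl => sq_one_sub_mul_onePlusEig_le hρ (hM ρ hρ hρ1 l hl))
  have hnorm : ∀ s (v : C(S2, E3)), vecSobNorm s v = Real.sqrt (sobSq s v) := by
    intro s v
    simp only [vecSobNorm, sobSq, vecSobTerm_eq, wpow]
  rw [e]
  refine ⟨⟨fun x => ?_, memLp_of_continuous _, ?_⟩, ?_⟩
  · rw [ContinuousMap.sub_apply, inner_sub_right, hut x, hwt x, sub_zero]
  · simpa only [vecSobTerm_eq, wpow] using h1
  rw [hnorm, show f = u from rfl, hnorm]
  set a := ρ ^ (σ - τ)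
  set b := ρ ^ (-(τ + σ))
  set r := (N n : ℝ) ^ (-(σ / 2)) with hr
  have ha : 0 ≤ a := Real.rpow_nonneg hρ.le _
  have hb : 0 ≤ b := Real.rpow_nonneg hρ.le _
  have hr0 : 0 ≤ r := Real.rpow_nonneg (Nat.cast_nonneg _) _
  have hU := sobSq_nonneg σ u
  rw [← hK'] at h2
  have h3 : 2 * ((C * a) ^ 2 + (c * r) ^ 2 * K * (d * b) ^ 2) ≤
      (2 * (C + c * (1 + K) * d) * (a + b * r)) ^ 2 := by
    have e1 : (c * r) ^ 2 * K * (d * b) ^ 2 ≤ (c * (1 + K) * d * (b * r)) ^ 2 := by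
      calc (c * r) ^ 2 * K * (d * b) ^ 2 = K * (c * d * (b * r)) ^ 2 := by ring
        _ ≤ (1 + K) ^ 2 * (c * d * (b * r)) ^ 2 := by gcongr; nlinarith
        _ = _ := by ring
    have e2 : C * a ≤ (C + c * (1 + K) * d) * (a + b * r) := by
      gcongr
      · exact le_add_of_nonneg_right (by positivity)
      · exact le_add_of_nonneg_right (by positivity)
    have e3 : c * (1 + K) * d * (b * r) ≤ (C + c * (1 + K) * d) * (a + b * r) := by
      gcongr
      · exact le_add_of_nonneg_left hC
      · exact le_add_of_nonneg_left ha
    have e4 := pow_le_pow_left₀ (by positivity) e2 2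
    have e5 := pow_le_pow_left₀ (by positivity) e3 2
    rw [mul_assoc 2, mul_pow 2]
    linarith
  have h4 : 0 ≤ 2 * (C + c * (1 + K) * d) * (a + b * r) := by positivity
  calc Real.sqrt (sobSq τ (u - w)) ≤
        Real.sqrt ((2 * (C + c * (1 + K) * d) * (a + b * r)) ^ 2 * sobSq σ u) :=
        Real.sqrt_le_sqrt (h2.trans (mul_le_mul_of_nonneg_right h3 hU))
    _ = _ := by rw [Real.sqrt_mul (sq_nonneg _), Real.sqrt_sq h4]
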